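/- **Conventions.** Let $B_n$ be the Artin braid group with generators $\sigma_1,\dots,\sigma_{n-1}$, $\rho:B_n\to S_n$ the standard homomorphism $\sigma_i\mapsto(i,i+1)$, $PB_n=\ker\rho$ the pure braid group, $x_{12}=\sigma_1^2$, $x_{23}=\sigma_2^2$, $x_{13}=\sigma_2\sigma_1^2\sigma_2^{-1}$; in a product $gh$ the braid $h$ comes first. Let $\mathsf{PaB}^{\le 4}$ be the truncation to arities $1,\dots,4$ of the operad (in groupoids) of parenthesized braids: the objects of $\mathsf{PaB}(n)$ are the full parenthesizations of the words $p(1)p(2)\cdots p(n)$, $p\in S_n$; a morphism from an object with permutation $p$ to an object with permutation $q$ is a braid $g\in B_n$ with $\rho(g)=q^{-1}p$; the groupoid composition is multiplication of braids, $S_n$ acts from the left by relabelling, and $\gamma\circ_i\eta$ replaces the strand of $\gamma$ labelled $i$ by the strands of $\eta$. We write $\mathfrak{ou}(\gamma)$ for the braid underlying a morphism $\gamma$, and for $g\in B_n$ we let $\mathfrak m(g)$ be the morphism with underlying braid $g$ and source $(..(12)3..)n$ whose target is the left-normed parenthesization of the word of $\rho(g)^{-1}$. Let $\alpha:(12)3\to1(23)$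 be given by the trivial braid and $\beta=\mathfrak m(\sigma_1):12\to21$. A morphism of truncated operads consists of functors in arities $1,\dots,4$ that respect the symmetric group actions, the insertions $\circ_i$ and the unit. Let $\mathsf{NFI}_{PB_4}(B_4)$ be the set of finite-index normal subgroups $N$ of $B_4$ with $N\le PB_4$. Let $\varphi_{123},\varphi_{12,3,4},\varphi_{1,23,4},\varphi_{1,2,34},\varphi_{234}:PB_3\to PB_4$ and $\varphi_{12},\varphi_{12,3},\varphi_{1,23},\varphi_{23}:PB_2\to PB_3$ be the homomorphisms sending $h$ to $\mathfrak{ou}$ of, respectively, $\mathrm{id}_{12}\circ_1\mathfrak m(h)$, $\mathfrak m(h)\circ_1\mathrm{id}_{12}$, $\mathfrak m(h)\circ_2\mathrm{id}_{12}$, $\mathfrak m(h)\circ_3\mathrm{id}_{12}$, $\mathrm{id}_{12}\circ_2\mathfrak m(h)$; and $\mathrm{id}_{12}\circ_1\mathfrak m(h)$, $\mathfrak m(h)\circ_1\mathrm{id}_{12}$, $\mathfrak m(h)\circ_2\mathrm{id}_{12}$, $\mathrm{id}_{12}\circ_2\mathfrak m(h)$. For $N\in\mathsf{NFI}_{PB_4}(B_4)$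 let $N_{PB_4}=N$, let $N_{PB_3}\le PB_3$ be the intersection of the preimages of $N$ under the first five homomorphisms, $N_{PB_2}\le PB_2$ the intersection of the preimages of $N_{PB_3}$ under the last four, $N_{PB_1}=1$, and $N_{\mathrm{ord}}=|PB_2:N_{PB_2}|$. For morphisms $\gamma,\gamma'$ of $\mathsf{PaB}(n)$ let $\gamma\sim_N\gamma'$ mean that they have the same source and target and $\mathfrak{ou}(\gamma^{-1}\gamma')\in N_{PB_n}$; this relation is compatible with all structure, and $\mathcal P_N:\mathsf{PaB}^{\le4}\to\mathsf{PaB}^{\le4}/{\sim_N}$ denotes the projection. A morphism $T:\mathsf{PaB}^{\le4}\to\mathsf{PaB}^{\le4}/{\sim_N}$ induces homomorphisms $T^{PB_n}=\mathfrak{ou}\circ T\circ\mathfrak m:PB_n\to PB_n/N_{PB_n}$. A *GT-pair* for $N$ is an element $[(m,f)]$ of $\mathbb Z/N_{\mathrm{ord}}\times PB_3/N_{PB_3}$ having a representative $(m,f)\in\mathbb Z\times PB_3$ with $$\sigma_1x_{12}^m\,f^{-1}\,\sigma_2x_{23}^m\,f\,N_{PB_3}=f^{-1}\sigma_1\sigma_2(x_{13}x_{23})^m\,N_{PB_3},$$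 $$f^{-1}\,\sigma_2x_{23}^m\,f\,\sigma_1x_{12}^m\,N_{PB_3}=\sigma_2\sigma_1(x_{12}x_{13})^m f\,N_{PB_3},$$ $$\varphi_{234}(f)\,\varphi_{1,23,4}(f)\,\varphi_{123}(f)\,N=\varphi_{1,2,34}(f)\,\varphi_{12,3,4}(f)\,N .$$ **Theorem.** (0) For every $N\in\mathsf{NFI}_{PB_4}(B_4)$ and every GT-pair $[(m,f)]$ for $N$ there is exactly one morphism of truncated operads $T_{m,f}:\mathsf{PaB}^{\le4}\to\mathsf{PaB}^{\le4}/{\sim_N}$ with $T_{m,f}(\alpha)=[\alpha\cdot\mathfrak m(f)]$ and $T_{m,f}(\beta)=[\beta\cdot\mathfrak m(x_{12}^m)]$; it is the identity on objects. The GT-pair is called a *GT-shadow*, and we write $[(m,f)]\in\mathsf{GT}(N)$, if $T_{m,f}^{PB_n}$ is onto for $n=2,3,4$. In the following, isomorphisms between quotients of $\mathsf{PaB}^{\le 4}$ are isomorphisms of truncated operads that act as the identity on objects. (1) Let $[(m,f)]\in\mathsf{GT}(N)$ and $N^{\mathfrak s}:=\ker T_{m,f}^{PB_4}$ (the *source*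 of the GT-shadow). Then $N^{\mathfrak s}\in\mathsf{NFI}_{PB_4}(B_4)$, and for all morphisms $\gamma,\gamma'$ of $\mathsf{PaB}(n)$, $1\le n\le4$, one has $T_{m,f}(\gamma)=T_{m,f}(\gamma')$ if and only if $\gamma\sim_{N^{\mathfrak s}}\gamma'$. (2) In the situation of (1) there is a unique isomorphism $T_{m,f}^{\mathrm{isom}}:\mathsf{PaB}^{\le4}/{\sim_{N^{\mathfrak s}}}\to\mathsf{PaB}^{\le4}/{\sim_N}$ with $T_{m,f}=T_{m,f}^{\mathrm{isom}}\circ\mathcal P_{N^{\mathfrak s}}$. (3) For all $\tilde N,N\in\mathsf{NFI}_{PB_4}(B_4)$ the assignment $[(m,f)]\mapsto T_{m,f}^{\mathrm{isom}}$ is a bijection from $\{[(m,f)]\in\mathsf{GT}(N):\ker T_{m,f}^{PB_4}=\tilde N\}$ onto the set of isomorphisms $\mathsf{PaB}^{\le4}/{\sim_{\tilde N}}\to\mathsf{PaB}^{\le4}/{\sim_N}$. (4) Consequently there is a groupoid $\mathsf{GTSh}$ with set of objects $\mathsf{NFI}_{PB_4}(B_4)$ in which the morphisms $\tilde N\to N$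 are the GT-shadows in $\mathsf{GT}(N)$ with source $\tilde N$, and in which identities, composition and inverses correspond under (3) to the identities, composition and inverses of isomorphisms. -/

import Mathlib

namespace GTShadows

/-! ## Braid groups -/

/-- Artin's relators on the generators `σ₁, …, σₙ₋₁`; the generator `σᵢ` has index `i - 1`. -/
def braidRels (n : ℕ) : Set (FreeGroup (Fin (n - 1))) :=
  {r | ∃ i j : Fin (n - 1), (i : ℕ) + 2 ≤ j ∧
      r = .of i * .of j * (.of i)⁻¹ * (.of j)⁻¹} ∪
  {r | ∃ i j : Fin (n - 1), (i : ℕ) + 1 = j ∧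
      r = .of i * .of j * .of i * (.of j)⁻¹ * (.of i)⁻¹ * (.of j)⁻¹}

/-- The Artin braid group on `n` strands. Strand positions are numbered `0, …, n - 1`. -/
abbrev B (n : ℕ) : Type := PresentedGroup (braidRels n)

/-- `s n i` is the generator that crosses the strands at positions `i` and `i + 1` (so it is
`σ_{i+1}` in the usual numbering); it is `1` when there are no such positions. -/
def s (n i : ℕ) : B n := if h : i < n - 1 then PresentedGroup.of ⟨i, h⟩ else 1

theorem s_comm (n : ℕ) {i j : ℕ} (h : i + 2 ≤ j) : s n i * s n j = s n j * s n i := by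
  unfold s
  by_cases hj : j < n - 1
  · have hi : i < n - 1 := by omega
    rw [dif_pos hi, dif_pos hj]
    have := PresentedGroup.one_of_mem (rels := braidRels n) (Or.inl ⟨⟨i, hi⟩, ⟨j, hj⟩, h, rfl⟩)
    simp only [map_mul, map_inv] at this
    rw [mul_inv_eq_one, mul_inv_eq_iff_eq_mul] at this
    exact this
  · rw [dif_neg hj]; simp

theorem s_comm_of (n : ℕ) {i j : ℕ} (h : i + 2 ≤ j ∨ j + 2 ≤ i) :
    s n i * s n j = s n j * s n i :=
  h.elim (s_comm n) fun h => (s_comm n h).symm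

theorem s_braid {n i : ℕ} (h : i + 2 < n) :
    s n i * s n (i + 1) * s n i = s n (i + 1) * s n i * s n (i + 1) := by
  have hi : i < n - 1 := by omega
  have hj : i + 1 < n - 1 := by omega
  unfold s
  rw [dif_pos hi, dif_pos hj]
  have := PresentedGroup.one_of_mem (rels := braidRels n)
    (Or.inr ⟨⟨i, hi⟩, ⟨i + 1, hj⟩, rfl, rfl⟩)
  simp only [map_mul, map_inv] at this
  rw [mul_inv_eq_one, mul_inv_eq_iff_eq_mul, mul_inv_eq_iff_eq_mul] at this
  exact this

/-- The homomorphism out of the braid group given by images of the generators. -/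
def liftB {G : Type} [Group G] (n : ℕ) (f : ℕ → G)
    (hc : ∀ i j, i + 2 ≤ j → j + 1 < n → f i * f j = f j * f i)
    (hb : ∀ i, i + 2 < n → f i * f (i + 1) * f i = f (i + 1) * f i * f (i + 1)) : B n →* G :=
  PresentedGroup.toGroup (rels := braidRels n) (f := fun i : Fin (n - 1) => f i) (by
    rintro r (⟨i, j, h, rfl⟩ | ⟨i, j, h, rfl⟩)
    · simp only [map_mul, map_inv, FreeGroup.lift_apply_of]
      rw [mul_inv_eq_one, mul_inv_eq_iff_eq_mul]
      exact hc i j h (by omega)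
    · simp only [map_mul, map_inv, FreeGroup.lift_apply_of]
      rw [mul_inv_eq_one, mul_inv_eq_iff_eq_mul, mul_inv_eq_iff_eq_mul, ← h]
      exact hb i (by omega))

theorem liftB_s {G : Type} [Group G] (n : ℕ) (f : ℕ → G)
    (hc : ∀ i j, i + 2 ≤ j → j + 1 < n → f i * f j = f j * f i)
    (hb : ∀ i, i + 2 < n → f i * f (i + 1) * f i = f (i + 1) * f i * f (i + 1)) {i : ℕ} (h : i + 1 < n) :
    liftB (G := G) n f hc hb (s n i) = f i := by
  have hi : i < n - 1 := by omega
  unfold s liftB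
  rw [dif_pos hi]
  exact PresentedGroup.toGroup.of _

theorem B_induction {n : ℕ} {P : B n → Prop} (one : P 1) (gen : ∀ i, i + 1 < n → P (s n i))
    (mul : ∀ g h, P g → P h → P (g * h)) (inv : ∀ g, P g → P g⁻¹) (g : B n) : P g := by
  let H : Subgroup (B n) :=
    { carrier := {g | P g}, one_mem' := one, mul_mem' := fun {a b} => mul a b,
      inv_mem' := fun {a} => inv a }
  refine PresentedGroup.generated_by _ H (fun j => ?_) g
  have := gen j (by omega)
  unfold s at this
  rwa [dif_pos j.2] at this

/-- The transposition of `i` and `i + 1`. -/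
def tr (n i : ℕ) : Equiv.Perm (Fin n) :=
  if h : i + 1 < n then Equiv.swap ⟨i, by omega⟩ ⟨i + 1, h⟩ else 1

theorem tr_val {n i : ℕ} (h : i + 1 < n) (p : Fin n) :
    (tr n i p : ℕ) = if (p : ℕ) = i then i + 1 else if (p : ℕ) = i + 1 then i else p := by
  unfold tr
  rw [dif_pos h, Equiv.swap_apply_def]
  simp only [Fin.ext_iff]
  split_ifs <;> rfl

theorem tr_comm {n i j : ℕ} (h : i + 2 ≤ j) (hj : j + 1 < n) :
    tr n i * tr n j = tr n j * tr n i := by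
  unfold tr
  rw [dif_pos hj, dif_pos (by omega)]
  refine (Equiv.Perm.disjoint_iff_disjoint_support.2 ?_).commute
  rw [Equiv.Perm.support_swap (by simp [Fin.ext_iff]),
    Equiv.Perm.support_swap (by simp [Fin.ext_iff])]
  simp only [Finset.disjoint_insert_left, Finset.disjoint_singleton_left, Finset.mem_insert,
    Finset.mem_singleton, Fin.ext_iff]
  omega

theorem tr_braid {n i : ℕ} (h : i + 2 < n) :
    tr n i * tr n (i + 1) * tr n i = tr n (i + 1) * tr n i * tr n (i + 1) := by
  have key : ∀ x y z : Fin n, x ≠ y → x ≠ z → y ≠ z →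
      Equiv.swap x y * Equiv.swap y z * Equiv.swap x y =
      Equiv.swap y z * Equiv.swap x y * Equiv.swap y z := fun x y z h1 h2 h3 => by
    rw [Equiv.swap_mul_swap_mul_swap h1 h2, Equiv.swap_comm x y, Equiv.swap_comm y z,
      Equiv.swap_mul_swap_mul_swap h3.symm h2.symm, Equiv.swap_comm]
  unfold tr
  rw [dif_pos (show i + 1 < n by omega), dif_pos (show i + 1 + 1 < n by omega)]
  exact key _ _ _ (by simp [Fin.ext_iff]) (by simp [Fin.ext_iff]; omega) (by simp [Fin.ext_iff])

/-- The standard homomorphism from the braid group to the symmetric group. -/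
def rho (n : ℕ) : B n →* Equiv.Perm (Fin n) :=
  liftB n (tr n) (fun _ _ => tr_comm) (fun _ => tr_braid)

theorem rho_s {n i : ℕ} (h : i + 1 < n) : rho n (s n i) = tr n i := liftB_s _ _ _ _ h

/-- The pure braid group. -/
def PB (n : ℕ) : Subgroup (B n) := (rho n).ker

theorem mem_PB {n : ℕ} {g : B n} : g ∈ PB n ↔ rho n g = 1 := MonoidHom.mem_ker

/-! ## Cabling and juxtaposition -/

/-- The braid in which a block of `k` parallel strands at positions `i, …, i + k - 1` passes over
the strand at position `i + k`: the product `s i * s (i+1) * ⋯ * s (i+k-1)`. -/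
def blockL (n i : ℕ) : ℕ → B n
  | 0 => 1
  | k + 1 => blockL n i k * s n (i + k)

/-- The braid in which the strand at position `i` passes over a block of `k` parallel strands at
positions `i + 1, …, i + k`: the product `s (i+k-1) * ⋯ * s (i+1) * s i`. -/
def blockR (n i : ℕ) : ℕ → B n
  | 0 => 1
  | k + 1 => s n (i + k) * blockR n i k

theorem blockL_succ_left (n i k : ℕ) : blockL n i (k + 1) = s n i * blockL n (i + 1) k := by
  induction k with
  | zero => simp [blockL]
  | succ k ih =>
    rw [blockL, ih, blockL, mul_assoc, show i + 1 + k = i + (k + 1) by omega]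

theorem blockR_succ_right (n i k : ℕ) : blockR n i (k + 1) = blockR n (i + 1) k * s n i := by
  induction k with
  | zero => simp [blockR]
  | succ k ih =>
    rw [blockR, ih, blockR, mul_assoc, show i + 1 + k = i + (k + 1) by omega]

theorem blockL_comm (n i k j : ℕ) (h : j + 2 ≤ i ∨ i + k + 1 ≤ j) :
    Commute (blockL n i k) (s n j) := by
  induction k with
  | zero => exact Commute.one_left _
  | succ k ih =>
    exact Commute.mul_left (ih (by omega)) (s_comm_of n (by omega))

theorem blockR_comm (n i k j : ℕ) (h : j + 2 ≤ i ∨ i + k + 1 ≤ j) :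
    Commute (blockR n i k) (s n j) := by
  induction k with
  | zero => exact Commute.one_left _
  | succ k ih =>
    exact Commute.mul_left (s_comm_of n (by omega)) (ih (by omega))

theorem blockL_slide {n i k j : ℕ} (hi : i ≤ j) (hj : j + 2 ≤ i + k) (hn : i + k < n) :
    blockL n i k * s n j = s n (j + 1) * blockL n i k := by
  induction k with
  | zero => omega
  | succ k ih =>
    rcases Nat.lt_or_ge (j + 1) (i + k) with h | h
    · rw [blockL, mul_assoc, s_comm_of n (by omega), ← mul_assoc, ih (by omega) (by omega),
        mul_assoc]
    · obtain ⟨l, rfl⟩ : ∃ l, k = l + 1 := ⟨k - 1, by omega⟩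
      have e1 : i + l = j := by omega
      have e2 : i + (l + 1) = j + 1 := by omega
      have c := (blockL_comm n i l (j + 1) (by omega)).eq
      have b := s_braid (n := n) (i := j) (by omega)
      rw [blockL, blockL, e1, e2]
      calc blockL n i l * s n j * s n (j + 1) * s n j
          = blockL n i l * (s n j * s n (j + 1) * s n j) := by simp only [mul_assoc]
        _ = (blockL n i l * s n (j + 1)) * s n j * s n (j + 1) := by
            rw [b]; simp only [mul_assoc]
        _ = _ := by rw [c]; simp only [mul_assoc]

theorem blockR_slide {n i k j : ℕ} (hi : i ≤ j) (hj : j + 2 ≤ i + k) (hn : i + k < n) :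
    s n j * blockR n i k = blockR n i k * s n (j + 1) := by
  induction k with
  | zero => omega
  | succ k ih =>
    rcases Nat.lt_or_ge (j + 1) (i + k) with h | h
    · rw [blockR, ← mul_assoc, s_comm_of n (by omega), mul_assoc, ih (by omega) (by omega),
        mul_assoc]
    · obtain ⟨l, rfl⟩ : ∃ l, k = l + 1 := ⟨k - 1, by omega⟩
      have e1 : i + l = j := by omega
      have e2 : i + (l + 1) = j + 1 := by omega
      have c := (blockR_comm n i l (j + 1) (by omega)).eq
      have b := s_braid (n := n) (i := j) (by omega)
      rw [blockR, blockR, e1, e2]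
      calc s n j * (s n (j + 1) * (s n j * blockR n i l))
          = (s n j * s n (j + 1) * s n j) * blockR n i l := by simp only [mul_assoc]
        _ = s n (j + 1) * s n j * (blockR n i l * s n (j + 1)) := by
            rw [b, c]; simp only [mul_assoc]
        _ = _ := by simp only [mul_assoc]

theorem blockL_slide_blockL {n i k : ℕ} (l : ℕ) (hl : l ≤ k) (hn : i + k + 1 < n) :
    blockL n i (k + 1) * blockL n i l = blockL n (i + 1) l * blockL n i (k + 1) := by
  induction l with
  | zero => simp [blockL]
  | succ l ih =>
    rw [show blockL n i (l + 1) = blockL n i l * s n (i + l) from rfl,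
      show blockL n (i + 1) (l + 1) = blockL n (i + 1) l * s n (i + 1 + l) from rfl,
      ← mul_assoc, ih (by omega), mul_assoc, blockL_slide (by omega) (by omega) (by omega),
      mul_assoc, show i + 1 + l = i + l + 1 by omega]

theorem blockL_slide_blockR {n i k : ℕ} (l : ℕ) (hl : l ≤ k) (hn : i + k + 1 < n) :
    blockL n i (k + 1) * blockR n i l = blockR n (i + 1) l * blockL n i (k + 1) := by
  induction l with
  | zero => simp [blockR]
  | succ l ih =>
    rw [show blockR n i (l + 1) = s n (i + l) * blockR n i l from rfl,
      show blockR n (i + 1) (l + 1) = s n (i + 1 + l) * blockR n (i + 1) l from rfl,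
      ← mul_assoc, blockL_slide (by omega) (by omega) (by omega), mul_assoc, ih (by omega),
      mul_assoc, show i + 1 + l = i + l + 1 by omega]

theorem blockR_slide_blockR {n i k : ℕ} (l : ℕ) (hl : l ≤ k) (hn : i + k + 1 < n) :
    blockR n i l * blockR n i (k + 1) = blockR n i (k + 1) * blockR n (i + 1) l := by
  induction l with
  | zero => simp [blockR]
  | succ l ih =>
    rw [show blockR n i (l + 1) = s n (i + l) * blockR n i l from rfl,
      show blockR n (i + 1) (l + 1) = s n (i + 1 + l) * blockR n (i + 1) l from rfl,
      mul_assoc, ih (by omega), ← mul_assoc, blockR_slide (by omega) (by omega) (by omega),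
      mul_assoc, show i + 1 + l = i + l + 1 by omega]

/-- The result of replacing, in the generator `s i`, the strand that originates at position `p` by
`m` parallel strands. -/
def thick (N m i p : ℕ) : B N :=
  if p < i then s N (i + m - 1)
  else if p = i then blockL N i m
  else if p = i + 1 then blockR N i m
  else s N i

theorem thick_comm {N m i j : ℕ} (p : ℕ) (h : i + 2 ≤ j) :
    thick N m i (if p = j then j + 1 else if p = j + 1 then j else p) * thick N m j p =
    thick N m j (if p = i then i + 1 else if p = i + 1 then i else p) * thick N m i p := by
  have L := fun a b h => (blockL_comm N a m b h).eq
  have R := fun a b h => (blockR_comm N a m b h).eq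
  unfold thick
  split_ifs <;> first
    | omega
    | exact s_comm_of N (by omega)
    | exact L _ _ (by omega)
    | exact R _ _ (by omega)
    | exact (L _ _ (by omega)).symm
    | exact (R _ _ (by omega)).symm

theorem thick_below {N m i p : ℕ} (h : p < i) : thick N m i p = s N (i + m - 1) := if_pos h

theorem thick_self (N m i : ℕ) : thick N m i i = blockL N i m := by simp [thick]

theorem thick_succ (N m i : ℕ) : thick N m i (i + 1) = blockR N i m := by simp [thick]

theorem thick_above {N m i p : ℕ} (h : i + 1 < p) : thick N m i p = s N i := by
  rw [thick, if_neg (by omega), if_neg (by omega), if_neg (by omega)]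

theorem thick_braid {N m i p q r q' r' : ℕ} (h : i + m + 1 < N) (hp : p + m ≤ N)
    (hq : q = if p = i then i + 1 else if p = i + 1 then i else p)
    (hr : r = if q = i + 1 then i + 2 else if q = i + 2 then i + 1 else q)
    (hq' : q' = if p = i + 1 then i + 2 else if p = i + 2 then i + 1 else p)
    (hr' : r' = if q' = i then i + 1 else if q' = i + 1 then i else q') :
    thick N m i r * thick N m (i + 1) q * thick N m i p =
    thick N m (i + 1) r' * thick N m i q' * thick N m (i + 1) p := by
  have h1 := blockL_slide_blockL (n := N) (i := i) m le_rfl (by omega)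
  have h2 := blockL_slide_blockR (n := N) (i := i) m le_rfl (by omega)
  have h3 := blockR_slide_blockR (n := N) (i := i) m le_rfl (by omega)
  have h4 := blockL_succ_left N i m
  have h5 := blockR_succ_right N i m
  have h6 : blockL N i (m + 1) = blockL N i m * s N (i + m) := rfl
  have h7 : blockR N i (m + 1) = s N (i + m) * blockR N i m := rfl
  have e : i + 1 + m - 1 = i + m := by omega
  rcases Nat.lt_or_ge p i with c | c
  · obtain ⟨rfl, rfl, rfl, rfl⟩ : q = p ∧ r = p ∧ q' = p ∧ r' = p := by
      split_ifs at hq hq' hr hr' <;> omega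
    have := s_braid (n := N) (i := i + m - 1) (by omega)
    rw [thick_below c, thick_below (Nat.lt_succ_of_lt c), e]
    rwa [show i + m - 1 + 1 = i + m by omega] at this
  · obtain ⟨d, hd⟩ := Nat.exists_eq_add_of_le c
    rcases d with _ | _ | _ | d
    · obtain ⟨a1, a2, a3, a4⟩ : q = i + 1 ∧ r = i + 1 + 1 ∧ q' = i ∧ r' = i + 1 := by
        split_ifs at hq hq' hr hr' <;> omega
      rw [a1, a2, a3, a4, hd, thick_above (Nat.lt_succ_self _), add_zero, thick_self, thick_self,
        thick_below (Nat.lt_succ_self _), e, ← h4, h1, h6, mul_assoc]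
    · obtain ⟨a1, a2, a3, a4⟩ : q = i ∧ r = i ∧ q' = i + 1 + 1 ∧ r' = i + 1 + 1 := by
        split_ifs at hq hq' hr hr' <;> omega
      rw [a1, a2, a3, a4, hd, thick_self, thick_below (Nat.lt_succ_self _), zero_add, thick_succ,
        thick_succ, thick_above (Nat.lt_succ_self _), thick_self, e, ← h6, h2, h4, mul_assoc]
    · obtain ⟨a1, a2, a3, a4⟩ : q = i + 1 + 1 ∧ r = i + 1 ∧ q' = i + 1 ∧ r' = i := by
        split_ifs at hq hq' hr hr' <;> omega
      rw [a1, a2, a3, a4, hd, show i + (0 + 1 + 1) = i + 1 + 1 by omega, thick_succ, thick_succ,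
        thick_above (Nat.lt_succ_self _), thick_below (Nat.lt_succ_self _), e, mul_assoc,
        ← h5, h3, h7]
    · have a1 : q = p := by rw [hq, if_neg (by omega), if_neg (by omega)]
      have a2 : r = p := by rw [hr, a1, if_neg (by omega), if_neg (by omega)]
      have a3 : q' = p := by rw [hq', if_neg (by omega), if_neg (by omega)]
      have a4 : r' = p := by rw [hr', a3, if_neg (by omega), if_neg (by omega)]
      rw [a1, a2, a3, a4, thick_above (by omega), thick_above (by omega)]
      exact s_braid (by omega)

/-- The permutation of `Fin n × B k` that swaps the positions `i`, `i + 1` and multiplies on the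
left by the corresponding thickened generator. -/
def thickPerm (n m k i : ℕ) : Equiv.Perm (Fin n × B k) where
  toFun x := (tr n i x.1, thick k m i x.1 * x.2)
  invFun x := ((tr n i)⁻¹ x.1, (thick k m i ((tr n i)⁻¹ x.1 : Fin n))⁻¹ * x.2)
  left_inv x := by simp
  right_inv x := by simp

/-- The action of the braid group on `Fin n × B k` (with `n + m = k + 1`) that encodes the cabling
of one strand, with `m` parallel strands put in its place. -/
def cableHom {n m k : ℕ} (h : n + m = k + 1) : B n →* Equiv.Perm (Fin n × B k) :=
  liftB n (thickPerm n m k)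
    (fun i j hij hj => by
      refine Equiv.ext fun x => Prod.ext (congrArg (fun e => e x.1) (tr_comm hij hj)) ?_
      · change thick k m i (tr n j x.1) * (thick k m j x.1 * x.2) =
          thick k m j (tr n i x.1) * (thick k m i x.1 * x.2)
        rw [← mul_assoc, ← mul_assoc, tr_val (show i + 1 < n by omega), tr_val hj,
          thick_comm _ hij])
    (fun i hi => by
      have t1 := tr_val (show i + 1 < n by omega)
      have t2 := tr_val (show i + 1 + 1 < n by omega)
      refine Equiv.ext fun x => Prod.ext (congrArg (fun e => e x.1) (tr_braid hi)) ?_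
      · change thick k m i (tr n (i + 1) (tr n i x.1)) *
            (thick k m (i + 1) (tr n i x.1) * (thick k m i x.1 * x.2)) =
          thick k m (i + 1) (tr n i (tr n (i + 1) x.1)) *
            (thick k m i (tr n (i + 1) x.1) * (thick k m (i + 1) x.1 * x.2))
        rw [← mul_assoc, ← mul_assoc, ← mul_assoc, ← mul_assoc,
          thick_braid (by omega) (by omega) (t1 _) (t2 _) (t2 _) (t1 _)])

/-- The braid on `k = n + m - 1` strands obtained from `g` by replacing the strand that originates
at position `p` by `m` parallel strands. -/
def cable {n m k : ℕ} (h : n + m = k + 1) (p : Fin n) (g : B n) : B k := (cableHom h g (p, 1)).2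

/-- The braid `g` on the strands `p, …, p + m - 1`, with the other strands vertical. -/
def shift {m k : ℕ} (p : ℕ) (h : p + m ≤ k) : B m →* B k :=
  liftB m (fun j => s k (p + j)) (fun i j hij _ => s_comm k (by omega))
    (fun i hi => s_braid (i := p + i) (by omega))

theorem cableHom_apply {n m k : ℕ} (h : n + m = k + 1) (g : B n) (p : Fin n) (x : B k) :
    cableHom h g (p, x) = (rho n g p, cable h p g * x) := by
  have key : ∀ (g : B n) (p : Fin n) (x : B k), (cableHom h g (p, x)).1 = rho n g p ∧
      ∀ y, (cableHom h g (p, x * y)).2 = (cableHom h g (p, x)).2 * y := by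
    intro g
    induction g using B_induction with
    | one => simp
    | gen i hi =>
      intro p x
      rw [cableHom, liftB_s _ _ _ _ hi, rho_s hi]
      simp [thickPerm, mul_assoc]
    | mul a b ha hb =>
      intro p x
      simp only [map_mul, Equiv.Perm.coe_mul, Function.comp_apply]
      refine ⟨?_, fun y => ?_⟩
      · rw [← Prod.mk.eta (p := cableHom h b (p, x)), (ha _ _).1, (hb _ _).1]
      · rw [← Prod.mk.eta (p := cableHom h b (p, x * y)), (hb _ _).1, (hb _ _).2, (ha _ _).2,
          ← (hb p x).1]
    | inv a ha =>
      intro p x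
      obtain ⟨⟨q, z⟩, hq⟩ := (cableHom h a).surjective (p, x)
      have e1 := (ha q z).1
      rw [hq] at e1
      have e2 : ∀ y, cableHom h a (q, z * y) = (p, x * y) := fun y => by
        refine Prod.ext ?_ ?_
        · rw [(ha _ _).1]; exact e1.symm
        · rw [(ha _ _).2, hq]
      have e3 : ∀ y, (cableHom h a)⁻¹ (p, x * y) = (q, z * y) := fun y => by
        rw [← e2]; exact Equiv.symm_apply_apply _ _
      rw [map_inv, map_inv]
      have e4 := e3 1
      rw [mul_one, mul_one] at e4
      refine ⟨?_, fun y => ?_⟩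
      · rw [e4]
        simp only at e1
        rw [e1]; exact (Equiv.symm_apply_apply _ _).symm
      · rw [e3, e4]
  refine Prod.ext (key g p x).1 ?_
  have := (key g p 1).2 x
  rwa [one_mul] at this

theorem cable_mul {n m k : ℕ} (h : n + m = k + 1) (p : Fin n) (g g' : B n) :
    cable h p (g * g') = cable h (rho n g' p) g * cable h p g' := by
  rw [cable, map_mul, Equiv.Perm.coe_mul, Function.comp_apply, cableHom_apply, cableHom_apply,
    mul_one]

theorem cable_one {n m k : ℕ} (h : n + m = k + 1) (p : Fin n) : cable h p 1 = 1 := by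
  simp [cable]

theorem cable_inv {n m k : ℕ} (h : n + m = k + 1) (p : Fin n) (g : B n) :
    cable h p g⁻¹ = (cable h ((rho n g)⁻¹ p) g)⁻¹ := by
  have := cable_mul h p g g⁻¹
  rw [mul_inv_cancel, cable_one, map_inv] at this
  exact (inv_eq_of_mul_eq_one_right this.symm).symm

theorem cable_s {n m k : ℕ} (h : n + m = k + 1) (p : Fin n) {i : ℕ} (hi : i + 1 < n) :
    cable h p (s n i) = thick k m i p := by
  rw [cable, cableHom, liftB_s _ _ _ _ hi]
  simp [thickPerm]

theorem shift_s {m k p : ℕ} (h : p + m ≤ k) {j : ℕ} (hj : j + 1 < m) :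
    shift p h (s m j) = s k (p + j) := liftB_s _ _ _ _ hj

/-! ## Block permutations -/

/-- The new number of the position (or label) `l ≠ i` after `i` has been replaced by a block of `m`
consecutive ones. -/
def outv (m i l : ℕ) : ℕ := if l < i then l else l + m - 1

/-- The underlying function of `insPerm`. -/
def insVal {n m k : ℕ} (h : n + m = k + 1) (i : Fin n) (θ : Equiv.Perm (Fin n))
    (η : Equiv.Perm (Fin m)) (x : Fin k) : ℕ :=
  if h1 : (x : ℕ) < i then outv m (θ i) (θ ⟨x, by omega⟩)
  else if h2 : (x : ℕ) < i + m then θ i + η ⟨x - i, by omega⟩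
  else outv m (θ i) (θ ⟨x - m + 1, by omega⟩)

theorem insVal_out {n m k : ℕ} (h : n + m = k + 1) {i : Fin n} (θ : Equiv.Perm (Fin n))
    (η : Equiv.Perm (Fin m)) {x : Fin k} {l : Fin n} (hl : l ≠ i) (hx : (x : ℕ) = outv m i l) :
    insVal h i θ η x = outv m (θ i) (θ l) := by
  have hl' : (l : ℕ) ≠ i := fun e => hl (Fin.ext e)
  unfold outv at hx
  unfold insVal
  split_ifs at hx with c
  · rw [dif_pos (by omega)]
    congr 3; exact Fin.ext hx
  · rw [dif_neg (by omega), dif_neg (by omega)]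
    congr 3; refine Fin.ext ?_; simp only; omega

theorem insVal_inn {n m k : ℕ} (h : n + m = k + 1) {i : Fin n} (θ : Equiv.Perm (Fin n))
    (η : Equiv.Perm (Fin m)) {x : Fin k} {j : Fin m} (hx : (x : ℕ) = i + j) :
    insVal h i θ η x = θ i + η j := by
  unfold insVal
  rw [dif_neg (by omega), dif_pos (by omega)]
  congr 3; refine Fin.ext ?_; simp only; omega

theorem ins_cases {n m k : ℕ} (h : n + m = k + 1) (i : Fin n) (x : Fin k) :
    (∃ j : Fin m, (x : ℕ) = i + j) ∨ ∃ l : Fin n, l ≠ i ∧ (x : ℕ) = outv m i l := by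
  rcases Nat.lt_or_ge x i with c | c
  · refine Or.inr ⟨⟨x, by omega⟩, fun e => ?_, ?_⟩
    · rw [Fin.ext_iff] at e; simp only at e; omega
    · simp [outv, c]
  · rcases Nat.lt_or_ge x (i + m) with d | d
    · exact Or.inl ⟨⟨x - i, by omega⟩, by simp only; omega⟩
    · refine Or.inr ⟨⟨x - m + 1, by omega⟩, fun e => ?_, ?_⟩
      · rw [Fin.ext_iff] at e; simp only at e; omega
      · simp only [outv]; rw [if_neg (by omega)]; omega

theorem outv_lt {n m k : ℕ} (h : n + m = k + 1) {i l : Fin n} (hl : l ≠ i) : outv m i l < k := by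
  have hl' : (l : ℕ) ≠ i := fun e => hl (Fin.ext e)
  unfold outv; split_ifs <;> omega

theorem insVal_lt {n m k : ℕ} (h : n + m = k + 1) (i : Fin n) (θ : Equiv.Perm (Fin n))
    (η : Equiv.Perm (Fin m)) (x : Fin k) : insVal h i θ η x < k := by
  rcases ins_cases h i x with ⟨j, hj⟩ | ⟨l, hl, hx⟩
  · rw [insVal_inn h θ η hj]; omega
  · rw [insVal_out h θ η hl hx]; exact outv_lt h (fun e => hl (θ.injective e))

theorem insVal_insVal {n m k : ℕ} (h : n + m = k + 1) (i : Fin n) (θ θ' : Equiv.Perm (Fin n))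
    (η η' : Equiv.Perm (Fin m)) (x : Fin k) :
    insVal h (θ i) θ' η' ⟨insVal h i θ η x, insVal_lt h i θ η x⟩ =
      insVal h i (θ' * θ) (η' * η) x := by
  rcases ins_cases h i x with ⟨j, hj⟩ | ⟨l, hl, hx⟩
  · rw [insVal_inn h (θ' * θ) (η' * η) hj, insVal_inn h θ' η' (insVal_inn h θ η hj)]; rfl
  · rw [insVal_out h (θ' * θ) (η' * η) hl hx,
      insVal_out h θ' η' (fun e => hl (θ.injective e)) (insVal_out h θ η hl hx)]; rfl

theorem insVal_one {n m k : ℕ} (h : n + m = k + 1) (i : Fin n) (x : Fin k) :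
    insVal h i 1 1 x = x := by
  rcases ins_cases h i x with ⟨j, hj⟩ | ⟨l, hl, hx⟩
  · rw [insVal_inn h 1 1 hj, hj]; rfl
  · rw [insVal_out h 1 1 hl hx, hx]; rfl

/-- The block permutation `θ ∘ᵢ η` of `k = n + m - 1` letters: the letter `i` is replaced by a block
of `m` letters; the blocks are permuted by `θ` and the letters inside the large block by `η`. -/
def insPerm {n m k : ℕ} (h : n + m = k + 1) (i : Fin n) (θ : Equiv.Perm (Fin n))
    (η : Equiv.Perm (Fin m)) : Equiv.Perm (Fin k) where
  toFun x := ⟨insVal h i θ η x, insVal_lt h i θ η x⟩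
  invFun x := ⟨insVal h (θ i) θ⁻¹ η⁻¹ x, insVal_lt h _ _ _ x⟩
  left_inv x := Fin.ext (by
    simp only
    rw [insVal_insVal, inv_mul_cancel, inv_mul_cancel, insVal_one])
  right_inv x := Fin.ext (by
    have := insVal_insVal h (θ i) θ⁻¹ θ η⁻¹ η x
    rw [mul_inv_cancel, mul_inv_cancel, insVal_one] at this
    simp only [Equiv.Perm.inv_def, Equiv.symm_apply_apply] at this ⊢
    exact this)

theorem insPerm_out {n m k : ℕ} (h : n + m = k + 1) {i : Fin n} (θ : Equiv.Perm (Fin n))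
    (η : Equiv.Perm (Fin m)) {x : Fin k} {l : Fin n} (hl : l ≠ i) (hx : (x : ℕ) = outv m i l) :
    (insPerm h i θ η x : ℕ) = outv m (θ i) (θ l) := insVal_out h θ η hl hx

theorem insPerm_inn {n m k : ℕ} (h : n + m = k + 1) {i : Fin n} (θ : Equiv.Perm (Fin n))
    (η : Equiv.Perm (Fin m)) {x : Fin k} {j : Fin m} (hx : (x : ℕ) = i + j) :
    (insPerm h i θ η x : ℕ) = θ i + η j := insVal_inn h θ η hx

theorem insPerm_mul {n m k : ℕ} (h : n + m = k + 1) (i : Fin n) (θ θ' : Equiv.Perm (Fin n))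
    (η η' : Equiv.Perm (Fin m)) :
    insPerm h (θ i) θ' η' * insPerm h i θ η = insPerm h i (θ' * θ) (η' * η) :=
  Equiv.ext fun x => Fin.ext (insVal_insVal h i θ θ' η η' x)

theorem insPerm_one {n m k : ℕ} (h : n + m = k + 1) (i : Fin n) : insPerm h i 1 1 = 1 :=
  Equiv.ext fun x => Fin.ext (insVal_one h i x)

theorem insPerm_inv {n m k : ℕ} (h : n + m = k + 1) (i : Fin n) (θ : Equiv.Perm (Fin n))
    (η : Equiv.Perm (Fin m)) : (insPerm h i θ η)⁻¹ = insPerm h (θ i) θ⁻¹ η⁻¹ := by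
  refine inv_eq_of_mul_eq_one_left ?_
  rw [insPerm_mul, inv_mul_cancel, inv_mul_cancel, insPerm_one]

theorem insPerm_seq {n m k a b c : ℕ} (h1 : n + m = a + 1) (h2 : a + k = b + 1)
    (h3 : m + k = c + 1) (h4 : n + c = b + 1) (p : Fin n) (q : Fin m) (r : Fin a)
    (hr : (r : ℕ) = p + q) (θ : Equiv.Perm (Fin n)) (η : Equiv.Perm (Fin m))
    (ζ : Equiv.Perm (Fin k)) :
    insPerm h2 r (insPerm h1 p θ η) ζ = insPerm h4 p θ (insPerm h3 q η ζ) := by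
  ext x
  have hr' := insPerm_inn h1 θ η hr
  rcases ins_cases h4 p x with ⟨j, hj⟩ | ⟨l, hl, hx⟩
  · rw [insPerm_inn h4 _ _ hj]
    rcases ins_cases h3 q j with ⟨u, hu⟩ | ⟨u, hu, hv⟩
    · rw [insPerm_inn h3 _ _ hu, insPerm_inn h2 (j := u) _ _ (by omega), hr']
      omega
    · rw [insPerm_out h3 _ _ hu hv]
      have hne : η u ≠ η q := fun e => hu (η.injective e)
      have hu' : (u : ℕ) ≠ q := fun e => hu (Fin.ext e)
      have hne' : (η u : ℕ) ≠ η q := fun e => hne (Fin.ext e)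
      have e := insPerm_inn h1 (x := ⟨p + u, by omega⟩) θ η rfl
      rw [insPerm_out h2 (l := ⟨p + u, by omega⟩) _ _ (by rw [Ne, Fin.ext_iff]; simp only; omega)
        (by unfold outv at hv ⊢; simp only; split_ifs at hv ⊢ <;> omega), hr', e]
      unfold outv; split_ifs <;> omega
  · rw [insPerm_out h4 _ _ hl hx]
    have hl' : (l : ℕ) ≠ p := fun e => hl (Fin.ext e)
    have hne : (θ l : ℕ) ≠ θ p := fun e => hl (θ.injective (Fin.ext e))
    have e := insPerm_out h1 (x := ⟨outv m p l, outv_lt h1 hl⟩) θ η hl rfl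
    have hm := q.2
    have hm' := (η q).2
    rw [insPerm_out h2 (l := ⟨outv m p l, outv_lt h1 hl⟩) _ _
      (by rw [Ne, Fin.ext_iff]; simp only; unfold outv; split_ifs <;> omega)
      (by unfold outv at hx ⊢; simp only; split_ifs at hx ⊢ <;> omega), hr', e]
    unfold outv; split_ifs <;> omega

theorem insPerm_par {n m k a a' b : ℕ} (h1 : n + m = a + 1) (h2 : a + k = b + 1)
    (h1' : n + k = a' + 1) (h2' : a' + m = b + 1) (p q : Fin n) (hpq : p ≠ q) (r : Fin a)
    (r' : Fin a') (hr : (r : ℕ) = outv m p q) (hr' : (r' : ℕ) = outv k q p)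
    (θ : Equiv.Perm (Fin n)) (η : Equiv.Perm (Fin m)) (ζ : Equiv.Perm (Fin k)) :
    insPerm h2 r (insPerm h1 p θ η) ζ = insPerm h2' r' (insPerm h1' q θ ζ) η := by
  ext x
  have e := insPerm_out h1 θ η hpq.symm hr
  have e' := insPerm_out h1' θ ζ hpq hr'
  have hpq' : (p : ℕ) ≠ q := fun e => hpq (Fin.ext e)
  have hθ : (θ p : ℕ) ≠ θ q := fun e => hpq (θ.injective (Fin.ext e))
  rcases ins_cases h2 r x with ⟨j, hj⟩ | ⟨l, hl, hx⟩
  · rw [insPerm_inn h2 _ _ hj, e]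
    have f := insPerm_inn h1' (x := ⟨q + j, by omega⟩) θ ζ rfl
    rw [insPerm_out h2' (l := ⟨q + j, by omega⟩) _ _
      (by rw [Ne, Fin.ext_iff, hr']; unfold outv; simp only; split_ifs <;> omega)
      (by rw [hj, hr, hr']; unfold outv; simp only; split_ifs <;> omega), f, e']
    unfold outv; split_ifs <;> omega
  · rw [insPerm_out h2 _ _ hl hx, e]
    have hl' : (l : ℕ) ≠ r := fun e => hl (Fin.ext e)
    rcases ins_cases h1 p l with ⟨j, hj⟩ | ⟨t, ht, hy⟩
    · rw [insPerm_inn h1 _ _ hj, insPerm_inn h2' (j := j) _ _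
        (by rw [hx, hr, hj, hr']; unfold outv; split_ifs <;> omega), e']
      unfold outv; split_ifs <;> omega
    · rw [insPerm_out h1 _ _ ht hy]
      have ht' : (t : ℕ) ≠ p := fun e => ht (Fin.ext e)
      have hθ1 : (θ t : ℕ) ≠ θ p := fun e => ht (θ.injective (Fin.ext e))
      have htq : t ≠ q := fun e => hl' (by rw [hy, hr, e])
      have htq' : (t : ℕ) ≠ q := fun e => htq (Fin.ext e)
      have hθ2 : (θ t : ℕ) ≠ θ q := fun e => htq (θ.injective (Fin.ext e))
      have f := insPerm_out h1' (x := ⟨outv k q t, outv_lt h1' htq⟩) θ ζ htq rfl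
      rw [insPerm_out h2' (l := ⟨outv k q t, outv_lt h1' htq⟩) _ _
        (by rw [Ne, Fin.ext_iff, hr']; unfold outv; simp only; split_ifs <;> omega)
        (by rw [hx, hr, hy, hr']; unfold outv; simp only; split_ifs <;> omega), f, e']
      unfold outv; split_ifs <;> omega

theorem insPerm_unit_right {n : ℕ} (h : n + 1 = n + 1) (i : Fin n) (θ : Equiv.Perm (Fin n))
    (η : Equiv.Perm (Fin 1)) : insPerm h i θ η = θ := by
  ext x
  rcases ins_cases h i x with ⟨j, hj⟩ | ⟨l, hl, hx⟩
  · obtain rfl : x = i := Fin.ext (by omega)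
    rw [insPerm_inn h _ _ hj]; omega
  · have hl' : (l : ℕ) ≠ i := fun e => hl (Fin.ext e)
    have : x = l := Fin.ext (by rw [hx]; unfold outv; split_ifs <;> omega)
    rw [insPerm_out h _ _ hl hx, this]; unfold outv; split_ifs <;> omega

theorem insPerm_unit_left {m : ℕ} (h : 1 + m = m + 1) (i : Fin 1) (θ : Equiv.Perm (Fin 1))
    (η : Equiv.Perm (Fin m)) : insPerm h i θ η = η := by
  ext x
  rw [insPerm_inn h (j := x) _ _ (by omega)]; omega

/-! ## Compatibility of cabling and juxtaposition -/

theorem rho_blockL {N i : ℕ} (l : ℕ) (h : i + l < N) (x : Fin N) :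
    (rho N (blockL N i l) x : ℕ) =
      if (x : ℕ) < i ∨ i + l < x then (x : ℕ) else if (x : ℕ) = i + l then i else x + 1 := by
  induction l generalizing x with
  | zero =>
    simp only [blockL, map_one, Equiv.Perm.one_apply]
    split_ifs <;> omega
  | succ l ih =>
    rw [blockL, map_mul, Equiv.Perm.mul_apply, ih (by omega), rho_s (by omega),
      tr_val (by omega)]
    split_ifs <;> omega

theorem rho_blockR {N i : ℕ} (l : ℕ) (h : i + l < N) (x : Fin N) :
    (rho N (blockR N i l) x : ℕ) =
      if (x : ℕ) < i ∨ i + l < x then (x : ℕ) else if (x : ℕ) = i then i + l else x - 1 := by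
  induction l generalizing x with
  | zero =>
    simp only [blockR, map_one, Equiv.Perm.one_apply]
    split_ifs <;> omega
  | succ l ih =>
    rw [blockR, map_mul, Equiv.Perm.mul_apply, rho_s (by omega), tr_val (by omega),
      ih (by omega)]
    split_ifs <;> omega

theorem rho_thick {n m k : ℕ} (h : n + m = k + 1) (p : Fin n) {i : ℕ} (hi : i + 1 < n) :
    rho k (thick k m i p) = insPerm h p (tr n i) 1 := by
  ext x
  have e := tr_val hi p
  rcases ins_cases h p x with ⟨j, hj⟩ | ⟨l, hl, hx⟩
  · rw [insPerm_inn h _ _ hj, e, Equiv.Perm.one_apply]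
    unfold thick
    split_ifs <;> first
      | omega
      | (rw [rho_s (by omega), tr_val (by omega)]; split_ifs <;> omega)
      | (rw [rho_blockL _ (by omega)]; split_ifs <;> omega)
      | (rw [rho_blockR _ (by omega)]; split_ifs <;> omega)
  · have hl' : (l : ℕ) ≠ p := fun e => hl (Fin.ext e)
    rw [insPerm_out h _ _ hl hx, e, tr_val hi]
    unfold outv at hx
    unfold thick outv
    split_ifs at hx <;> split_ifs <;> first
      | omega
      | (rw [rho_s (by omega), tr_val (by omega)]; split_ifs <;> omega)
      | (rw [rho_blockL _ (by omega)]; split_ifs <;> omega)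
      | (rw [rho_blockR _ (by omega)]; split_ifs <;> omega)

theorem rho_cable {n m k : ℕ} (h : n + m = k + 1) (p : Fin n) (g : B n) :
    rho k (cable h p g) = insPerm h p (rho n g) 1 := by
  induction g using B_induction generalizing p with
  | one => rw [cable_one, map_one, map_one, insPerm_one]
  | gen i hi => rw [cable_s h p hi, rho_thick h p hi, rho_s hi]
  | mul a b ha hb =>
    rw [cable_mul, map_mul, ha, hb, insPerm_mul, map_mul, one_mul]
  | inv a ha =>
    rw [cable_inv, map_inv, ha, insPerm_inv, map_inv, inv_one]
    simp

theorem rho_shift {n m k : ℕ} (h : n + m = k + 1) (p : Fin n) (hp : p + m ≤ k) (g : B m) :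
    rho k (shift p hp g) = insPerm h p 1 (rho m g) := by
  induction g using B_induction with
  | one => rw [map_one, map_one, map_one, insPerm_one]
  | gen i hi =>
    rw [shift_s hp hi, rho_s (by omega), rho_s hi]
    ext x
    rw [tr_val (by omega)]
    rcases ins_cases h p x with ⟨j, hj⟩ | ⟨l, hl, hx⟩
    · rw [insPerm_inn h _ _ hj, tr_val hi, Equiv.Perm.one_apply]; split_ifs <;> omega
    · have hl' : (l : ℕ) ≠ p := fun e => hl (Fin.ext e)
      rw [insPerm_out h _ _ hl hx, Equiv.Perm.one_apply, Equiv.Perm.one_apply, ← hx]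
      unfold outv at hx
      split_ifs at hx ⊢ <;> omega
  | mul a b ha hb =>
    have := insPerm_mul h p 1 1 (rho m b) (rho m a)
    rw [map_mul, map_mul, ha, hb, map_mul, ← one_mul (1 : Equiv.Perm (Fin n)), ← this]
    simp
  | inv a ha =>
    rw [map_inv, map_inv, ha, insPerm_inv, map_inv, inv_one, Equiv.Perm.one_apply]

theorem rho_cable_shift {n m k : ℕ} (h : n + m = k + 1) (p : Fin n) (hp : p + m ≤ k) (g : B n)
    (g' : B m) :
    rho k (cable h p g * shift p hp g') = insPerm h p (rho n g) (rho m g') := by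
  have := insPerm_mul h p 1 (rho n g) (rho m g') 1
  rw [map_mul, rho_cable, rho_shift h]
  simpa using this

theorem thick_shift {n m k : ℕ} (h : n + m = k + 1) (p q : Fin n) (hp : p + m ≤ k)
    (hq : q + m ≤ k) {i : ℕ} (hi : i + 1 < n) (hpq : q = tr n i p) (g : B m) :
    thick k m i p * shift p hp g = shift q hq g * thick k m i p := by
  have e := tr_val hi p
  rw [← hpq] at e
  induction g using B_induction with
  | one => simp
  | gen j hj =>
    rw [shift_s _ hj, shift_s _ hj]
    unfold thick
    split_ifs with c1 c2 c3
    · rw [if_neg (by omega), if_neg (by omega)] at e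
      rw [e]; exact s_comm_of k (by omega)
    · rw [if_pos c2] at e
      rw [blockL_slide (by omega) (by omega) (by omega), e]; congr 2; omega
    · rw [if_neg c2, if_pos c3] at e
      rw [e, blockR_slide (by omega) (by omega) (by omega), c3]; congr 2; omega
    · rw [if_neg c2, if_neg c3] at e
      rw [e]; exact s_comm_of k (by omega)
  | mul a b ha hb => rw [map_mul, ← mul_assoc, ha, mul_assoc, hb, map_mul, mul_assoc]
  | inv a ha =>
    rw [map_inv, map_inv, eq_inv_mul_iff_mul_eq, ← mul_assoc, ← ha, mul_inv_cancel_right]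

theorem cable_shift_comm {n m k : ℕ} (h : n + m = k + 1) (p q : Fin n) (hp : p + m ≤ k)
    (hq : q + m ≤ k) (g : B n) (hpq : q = rho n g p) (g' : B m) :
    cable h p g * shift p hp g' = shift q hq g' * cable h p g := by
  induction g using B_induction generalizing p q with
  | one =>
    rw [map_one, Equiv.Perm.one_apply] at hpq
    subst hpq
    rw [cable_one, one_mul, mul_one]
  | gen i hi =>
    rw [cable_s h p hi]
    rw [rho_s hi] at hpq
    exact thick_shift h p q hp hq hi hpq g'
  | mul a b ha hb =>
    rw [map_mul, Equiv.Perm.mul_apply] at hpq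
    rw [cable_mul, mul_assoc, hb p (rho n b p) hp (by omega) rfl, ← mul_assoc,
      ha _ q (by omega) hq hpq, mul_assoc]
  | inv a ha =>
    rw [map_inv] at hpq
    have e : p = rho n a q := by rw [hpq]; exact (Equiv.apply_symm_apply _ _).symm
    have := ha q p hq hp e
    rw [cable_inv, ← hpq, inv_mul_eq_iff_eq_mul, ← mul_assoc, this, mul_inv_cancel_right]

theorem B_one_eq (g : B 1) : g = 1 := by
  induction g using B_induction with
  | one => rfl
  | gen i hi => omega
  | mul a b ha hb => rw [ha, hb, one_mul]
  | inv a ha => rw [ha, inv_one]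

theorem cable_unit {n : ℕ} (h : n + 1 = n + 1) (p : Fin n) (g : B n) : cable h p g = g := by
  induction g using B_induction generalizing p with
  | one => rw [cable_one]
  | gen i hi =>
    rw [cable_s h p hi]
    unfold thick
    split_ifs <;> simp [blockL, blockR]
  | mul a b ha hb => rw [cable_mul, ha, hb]
  | inv a ha => rw [cable_inv, ha]

theorem shift_zero {m p : ℕ} (h : p + m ≤ m) (g : B m) : shift p h g = g := by
  obtain rfl : p = 0 := by omega
  induction g using B_induction with
  | one => rw [map_one]
  | gen i hi => rw [shift_s h hi, zero_add]
  | mul a b ha hb => rw [map_mul, ha, hb]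
  | inv a ha => rw [map_inv, ha]

theorem shift_shift {a b c p q r : ℕ} (h1 : q + a ≤ b) (h2 : p + b ≤ c) (h3 : r + a ≤ c)
    (hr : r = p + q) (g : B a) : shift p h2 (shift q h1 g) = shift r h3 g := by
  induction g using B_induction with
  | one => rw [map_one, map_one, map_one]
  | gen i hi =>
    rw [shift_s h1 hi, shift_s h2 (by omega), shift_s h3 hi]; congr 1; omega
  | mul a b ha hb => rw [map_mul, map_mul, ha, hb, map_mul]
  | inv a ha => rw [map_inv, map_inv, ha, map_inv]

theorem shift_blockL {b c p j : ℕ} (h : p + b ≤ c) (l : ℕ) (hj : j + l < b) :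
    shift p h (blockL b j l) = blockL c (p + j) l := by
  induction l with
  | zero => rw [blockL, blockL, map_one]
  | succ l ih =>
    rw [blockL, map_mul, ih (by omega), shift_s h (by omega), blockL, add_assoc]

theorem shift_blockR {b c p j : ℕ} (h : p + b ≤ c) (l : ℕ) (hj : j + l < b) :
    shift p h (blockR b j l) = blockR c (p + j) l := by
  induction l with
  | zero => rw [blockR, blockR, map_one]
  | succ l ih =>
    rw [blockR, map_mul, ih (by omega), shift_s h (by omega), blockR, add_assoc]

/-- Cabling a strand inside a juxtaposed braid. -/
theorem cable_shift_inner {n m k a b c : ℕ} (h1 : n + m = a + 1) (h2 : a + k = b + 1)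
    (h3 : m + k = c + 1) (p : Fin n) (q : Fin m) (r : Fin a) (hr : (r : ℕ) = p + q)
    (hpa : p + m ≤ a) (hpb : p + c ≤ b) (g : B m) :
    cable h2 r (shift p hpa g) = shift p hpb (cable h3 q g) := by
  have pos : ∀ (g : B m) (q : Fin m) (r : Fin a), (r : ℕ) = p + q →
      (rho a (shift p hpa g) r : ℕ) = p + rho m g q := fun g q r hr => by
    rw [rho_shift h1, insPerm_inn h1 _ _ hr, Equiv.Perm.one_apply]
  induction g using B_induction generalizing q r with
  | one => rw [map_one, cable_one, cable_one, map_one]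
  | gen i hi =>
    rw [shift_s hpa hi, cable_s h2 r (by omega), cable_s h3 q hi, hr]
    unfold thick
    have c1 : (p : ℕ) + q < p + i ↔ (q : ℕ) < i := by omega
    have c2 : (p : ℕ) + q = p + i ↔ (q : ℕ) = i := by omega
    have c3 : (p : ℕ) + q = p + i + 1 ↔ (q : ℕ) = i + 1 := by omega
    simp only [c1, c2, c3]
    split_ifs
    · rw [shift_s hpb (by omega)]; congr 1; omega
    · rw [shift_blockL hpb _ (by omega)]
    · rw [shift_blockR hpb _ (by omega)]
    · rw [shift_s hpb (by omega)]
  | mul x y hx hy =>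
    rw [map_mul, cable_mul, hx (rho m y q) _ (pos y q r hr), hy q r hr, cable_mul, map_mul]
  | inv x hx =>
    rw [map_inv, cable_inv, cable_inv, map_inv, hx ((rho m x)⁻¹ q) _ ?_]
    rw [← map_inv, ← map_inv, ← map_inv]
    exact pos x⁻¹ q r hr

/-- Cabling a vertical strand next to a juxtaposed braid. -/
theorem cable_shift_outer {n m k a b : ℕ} (h1 : n + m = a + 1) (h2 : a + k = b + 1)
    (p q : Fin n) (hpq : q ≠ p) (r : Fin a) (hr : (r : ℕ) = outv m p q) (hpa : p + m ≤ a)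
    (hpb : outv k q p + m ≤ b) (g : B m) :
    cable h2 r (shift p hpa g) = shift (outv k q p) hpb g := by
  have pos : ∀ (g : B m), rho a (shift p hpa g) r = r := fun g => Fin.ext <| by
    rw [rho_shift h1, insPerm_out h1 _ _ hpq hr, hr]; rfl
  have hpq' : (q : ℕ) ≠ p := fun e => hpq (Fin.ext e)
  induction g using B_induction with
  | one => rw [map_one, cable_one, map_one]
  | gen i hi =>
    rw [shift_s hpa hi, cable_s h2 r (by omega), shift_s hpb hi]
    unfold outv at hr ⊢
    rcases lt_or_gt_of_ne hpq' with c | c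
    · rw [if_pos c] at hr
      rw [if_neg (by omega), thick_below (by omega)]; congr 1; omega
    · rw [if_neg (by omega)] at hr
      rw [if_pos c, thick_above (by omega)]
  | mul x y hx hy => rw [map_mul, cable_mul, pos, hx, hy, map_mul]
  | inv x hx => rw [map_inv, cable_inv, ← map_inv, ← map_inv, pos, hx, map_inv]

theorem cable_blockL_below {n m k : ℕ} (h : n + m = k + 1) (p : Fin n) {i : ℕ} (l : ℕ)
    (hl : i + l < n) (hp : (p : ℕ) < i) :
    cable h p (blockL n i l) = blockL k (i + m - 1) l := by
  induction l with
  | zero => rw [blockL, blockL, cable_one]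
  | succ l ih =>
    have : rho n (s n (i + l)) p = p := Fin.ext (by
      rw [rho_s (by omega), tr_val (by omega), if_neg (by omega), if_neg (by omega)])
    rw [blockL, cable_mul, this, ih (by omega), cable_s h p (by omega), thick_below (by omega),
      blockL]
    congr 2; omega

theorem cable_blockR_below {n m k : ℕ} (h : n + m = k + 1) (p : Fin n) {i : ℕ} (l : ℕ)
    (hl : i + l < n) (hp : (p : ℕ) < i) :
    cable h p (blockR n i l) = blockR k (i + m - 1) l := by
  induction l with
  | zero => rw [blockR, blockR, cable_one]
  | succ l ih =>
    have : rho n (blockR n i l) p = p := Fin.ext (by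
      rw [rho_blockR _ (by omega), if_pos (Or.inl hp)])
    rw [blockR, cable_mul, this, ih (by omega), cable_s h p (by omega), thick_below (by omega),
      blockR]
    congr 2; omega

theorem cable_blockL_above {n m k : ℕ} (h : n + m = k + 1) (p : Fin n) {i : ℕ} (l : ℕ)
    (hp : i + l < p) : cable h p (blockL n i l) = blockL k i l := by
  induction l with
  | zero => rw [blockL, blockL, cable_one]
  | succ l ih =>
    have : rho n (s n (i + l)) p = p := Fin.ext (by
      rw [rho_s (by omega), tr_val (by omega), if_neg (by omega), if_neg (by omega)])
    rw [blockL, cable_mul, this, ih (by omega), cable_s h p (by omega), thick_above (by omega),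
      blockL]

theorem cable_blockR_above {n m k : ℕ} (h : n + m = k + 1) (p : Fin n) {i : ℕ} (l : ℕ)
    (hp : i + l < p) : cable h p (blockR n i l) = blockR k i l := by
  induction l with
  | zero => rw [blockR, blockR, cable_one]
  | succ l ih =>
    have : rho n (blockR n i l) p = p := Fin.ext (by
      rw [rho_blockR _ (by omega), if_pos (Or.inr (by omega))])
    rw [blockR, cable_mul, this, ih (by omega), cable_s h p (by omega), thick_above (by omega),
      blockR]

theorem blockL_add (n i a b : ℕ) : blockL n i (a + b) = blockL n i a * blockL n (i + a) b := by
  induction b with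
  | zero => simp [blockL]
  | succ b ih => rw [← add_assoc, blockL, ih, blockL, mul_assoc, add_assoc i]

theorem blockR_add (n i a b : ℕ) : blockR n i (a + b) = blockR n (i + a) b * blockR n i a := by
  induction b with
  | zero => simp [blockR]
  | succ b ih => rw [← add_assoc, blockR, ih, blockR, mul_assoc, add_assoc i]

theorem cable_blockL_mid {n m k : ℕ} (h : n + m = k + 1) (p : Fin n) {i : ℕ} (q l : ℕ)
    (hl : i + (q + 1 + l) < n) (hp : (p : ℕ) = i + q) :
    cable h p (blockL n i (q + 1 + l)) = blockL k i (q + m + l) := by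
  have e1 : rho n (blockL n (i + (q + 1)) l) p = p := Fin.ext (by
    rw [rho_blockL _ (by omega), if_pos (Or.inl (by omega))])
  have e2 : (rho n (s n (i + q)) p : ℕ) = i + q + 1 := by
    rw [rho_s (by omega), tr_val (by omega), if_pos (by omega)]
  rw [blockL_add, blockL, cable_mul, cable_mul, e1, cable_blockL_below h p l (by omega) (by omega),
    cable_s h p (by omega), hp, thick_self, cable_blockL_above h _ q (by omega), ← blockL_add,
    blockL_add k i (q + m) l]
  congr 2; omega

theorem cable_blockR_mid {n m k : ℕ} (h : n + m = k + 1) (p : Fin n) {i : ℕ} (q l : ℕ)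
    (hl : i + (q + 1 + l) < n) (hp : (p : ℕ) = i + q + 1) :
    cable h p (blockR n i (q + 1 + l)) = blockR k i (q + m + l) := by
  have e1 : rho n (blockR n i q) p = p := Fin.ext (by
    rw [rho_blockR _ (by omega), if_pos (Or.inr (by omega))])
  have e2 : (rho n (s n (i + q) * blockR n i q) p : ℕ) = i + q := by
    rw [map_mul, Equiv.Perm.mul_apply, e1, rho_s (by omega), tr_val (by omega), if_neg (by omega),
      if_pos (by omega)]
  rw [blockR_add, blockR, cable_mul, cable_mul, e1, cable_blockR_below h _ l (by omega) (by omega),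
    cable_s h p (by omega), hp, thick_succ, cable_blockR_above h _ q (by omega), ← blockR_add,
    blockR_add k i (q + m) l]
  congr 2; omega

/-- Cabling one of the strands produced by cabling. -/
theorem cable_cable {n m k a b c : ℕ} (h1 : n + m = a + 1) (h2 : a + k = b + 1)
    (h3 : m + k = c + 1) (h4 : n + c = b + 1) (p : Fin n) (q : Fin m) (r : Fin a)
    (hr : (r : ℕ) = p + q) (g : B n) : cable h2 r (cable h1 p g) = cable h4 p g := by
  have pos : ∀ (g : B n) (p : Fin n) (r : Fin a), (r : ℕ) = p + q →
      (rho a (cable h1 p g) r : ℕ) = rho n g p + q := fun g p r hr => by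
    rw [rho_cable h1, insPerm_inn h1 _ _ hr, Equiv.Perm.one_apply]
  induction g using B_induction generalizing p r with
  | one => rw [cable_one, cable_one, cable_one]
  | gen i hi =>
    rw [cable_s h1 p hi, cable_s h4 p hi]
    obtain ⟨l, hl⟩ : ∃ l, m = q + 1 + l := ⟨m - q - 1, by omega⟩
    rcases lt_trichotomy (p : ℕ) i with d | d | d
    · rw [thick_below d, thick_below d, cable_s h2 r (by omega), thick_below (by omega)]
      congr 1; omega
    · rw [d, thick_self, thick_self, show c = q + k + l by omega,
        show blockL a i m = blockL a i (q + 1 + l) from congrArg _ hl]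
      exact cable_blockL_mid h2 r q l (by omega) (by omega)
    · rcases Nat.lt_or_ge (i + 1) p with d' | d'
      · rw [thick_above d', thick_above d', cable_s h2 r (by omega), thick_above (by omega)]
      · obtain d'' : (p : ℕ) = i + 1 := by omega
        rw [d'', thick_succ, thick_succ, show c = q + k + l by omega,
          show blockR a i m = blockR a i (q + 1 + l) from congrArg _ hl]
        exact cable_blockR_mid h2 r q l (by omega) (by omega)
  | mul x y hx hy =>
    rw [cable_mul, cable_mul, hx (rho n y p) _ (pos y p r hr), hy p r hr, cable_mul]
  | inv x hx =>
    have e := pos x⁻¹ p r hr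
    rw [cable_inv h1, map_inv, map_inv] at e
    rw [cable_inv, cable_inv, cable_inv, hx ((rho n x)⁻¹ p) _ e]

/-- The crossing of a block of `m` strands with a block of `k` strands. -/
def grid (N i k : ℕ) : ℕ → B N
  | 0 => 1
  | m + 1 => grid N i k m * blockR N (i + m) k

theorem grid_comm (N i k j : ℕ) (m : ℕ) (h : i + m + k ≤ j) : Commute (grid N i k m) (s N j) := by
  induction m with
  | zero => exact Commute.one_left _
  | succ m ih => exact Commute.mul_left (ih (by omega)) (blockR_comm N _ _ _ (by omega))

theorem grid_zero (N i m : ℕ) : grid N i 0 m = 1 := by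
  induction m with
  | zero => rfl
  | succ m ih => rw [grid, ih, blockR, one_mul]

theorem grid_succ (N i k m : ℕ) : grid N i (k + 1) m = blockL N (i + k) m * grid N i k m := by
  induction m with
  | zero => simp [grid, blockL]
  | succ m ih =>
    have c := (grid_comm N i k (i + m + k) m le_rfl).eq
    rw [grid, ih, blockR, grid, blockL, mul_assoc, ← mul_assoc (grid N i k m), c]
    simp only [mul_assoc, show i + m + k = i + k + m by omega]

theorem cable_blockL_last {n m k : ℕ} (h : n + m = k + 1) (p : Fin n) {i : ℕ} (l : ℕ)
    (hp : (p : ℕ) = i + l) : cable h p (blockL n i l) = grid k i m l := by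
  induction l generalizing p with
  | zero => rw [blockL, grid, cable_one]
  | succ l ih =>
    have e : (rho n (s n (i + l)) p : ℕ) = i + l := by
      rw [rho_s (by omega), tr_val (by omega), if_neg (by omega), if_pos (by omega)]
    rw [blockL, cable_mul, ih _ e, cable_s h p (by omega), hp, ← add_assoc, thick_succ, grid]

theorem cable_blockR_first {n m k : ℕ} (h : n + m = k + 1) (p : Fin n) {i : ℕ} (l : ℕ)
    (hl : i + l < n) (hp : (p : ℕ) = i) : cable h p (blockR n i l) = grid k i l m := by
  induction l with
  | zero => rw [blockR, cable_one, grid_zero]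
  | succ l ih =>
    have e : (rho n (blockR n i l) p : ℕ) = i + l := by
      rw [rho_blockR _ (by omega), if_neg (by omega), if_pos hp]
    rw [blockR, cable_mul, ih (by omega), cable_s h _ (by omega), e, thick_self, grid_succ]

theorem cable_thick_par {n m k a a' b : ℕ} (h1 : n + m = a + 1) (h2 : a + k = b + 1)
    (h1' : n + k = a' + 1) (h2' : a' + m = b + 1) (p q : Fin n) (hpq : (p : ℕ) < q) (r : Fin a)
    (r' : Fin a') (hr : (r : ℕ) = q + m - 1) (hr' : (r' : ℕ) = p) {i : ℕ} (hi : i + 1 < n) :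
    cable h2 r (thick a m i p) = cable h2' r' (thick a' k i q) := by
  rcases lt_trichotomy (q : ℕ) i with d | d | d
  · rw [thick_below (by omega), thick_below d, cable_s h2 r (by omega), cable_s h2' r' (by omega),
      thick_below (by omega), thick_below (by omega)]
    congr 1; omega
  · rw [thick_below (by omega), d, thick_self, cable_s h2 r (by omega),
      cable_blockL_below h2' r' _ (by omega) (by omega), hr, d, thick_self]
  · rcases Nat.lt_or_ge (i + 1) q with d' | d'
    · rw [thick_above d', cable_s h2' r' (by omega), hr']
      unfold thick
      split_ifs
      · rw [cable_s h2 r (by omega), thick_above (by omega)]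
      · rw [cable_blockL_above h2 r _ (by omega)]
      · rw [cable_blockR_above h2 r _ (by omega)]
      · rw [cable_s h2 r (by omega), thick_above (by omega)]
    · obtain d'' : (q : ℕ) = i + 1 := by omega
      rw [d'', thick_succ]
      rcases Nat.lt_or_ge p i with c | c
      · rw [thick_below c, cable_blockR_below h2' r' _ (by omega) (by omega),
          cable_s h2 r (by omega), show (r : ℕ) = i + m - 1 + 1 by omega, thick_succ]
      · obtain c' : (p : ℕ) = i := by omega
        rw [c', thick_self, cable_blockL_last h2 r _ (by omega),
          cable_blockR_first h2' r' _ (by omega) (by omega)]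

/-- Cabling two different strands. -/
theorem cable_par {n m k a a' b : ℕ} (h1 : n + m = a + 1) (h2 : a + k = b + 1)
    (h1' : n + k = a' + 1) (h2' : a' + m = b + 1) (p q : Fin n) (hpq : p ≠ q) (r : Fin a)
    (r' : Fin a') (hr : (r : ℕ) = outv m p q) (hr' : (r' : ℕ) = outv k q p) (g : B n) :
    cable h2 r (cable h1 p g) = cable h2' r' (cable h1' q g) := by
  have pos : ∀ {m a : ℕ} (h1 : n + m = a + 1) (g : B n) (p q : Fin n), q ≠ p → ∀ (r : Fin a),
      (r : ℕ) = outv m p q →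
      (rho a (cable h1 p g) r : ℕ) = outv m (rho n g p) (rho n g q) :=
    fun h1 g p q hpq r hr => by rw [rho_cable h1, insPerm_out h1 _ _ hpq hr]
  induction g using B_induction generalizing p q r r' with
  | one => rw [cable_one, cable_one, cable_one, cable_one]
  | gen i hi =>
    rw [cable_s h1 p hi, cable_s h1' q hi]
    have hpq' : (p : ℕ) ≠ q := fun e => hpq (Fin.ext e)
    unfold outv at hr hr'
    rcases lt_or_gt_of_ne hpq' with c | c
    · exact cable_thick_par h1 h2 h1' h2' p q c r r' (by rw [hr, if_neg (by omega)])
        (by rw [hr', if_pos c]) hi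
    · exact (cable_thick_par h1' h2' h1 h2 q p c r' r (by rw [hr', if_neg (by omega)])
        (by rw [hr, if_pos c]) hi).symm
  | mul x y hx hy =>
    have e1 := pos h1 y p q hpq.symm r hr
    have e2 := pos h1' y q p hpq r' hr'
    rw [cable_mul, cable_mul, hx _ _ (fun e => hpq ((rho n y).injective e)) _ _ e1 e2,
      hy p q hpq r r' hr hr', cable_mul, cable_mul]
  | inv x hx =>
    have e1 := pos h1 x⁻¹ p q hpq.symm r hr
    have e2 := pos h1' x⁻¹ q p hpq r' hr'
    rw [cable_inv h1, map_inv, map_inv] at e1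
    rw [cable_inv h1', map_inv, map_inv] at e2
    rw [cable_inv h1, cable_inv h1', cable_inv h2, cable_inv h2',
      hx _ _ (fun e => hpq ((rho n x)⁻¹.injective e)) _ _ e1 e2]

/-! ## Truncated operads in the category of groupoids -/

/-- The arities `1, 2, 3, 4`. -/
abbrev Arity : Type := {n : ℕ // 1 ≤ n ∧ n ≤ 4}

/-- The arity `1`. -/
abbrev ar1 : Arity := ⟨1, by decide⟩

/-- The arity `2`. -/
abbrev ar2 : Arity := ⟨2, by decide⟩

/-- The arity `3`. -/
abbrev ar3 : Arity := ⟨3, by decide⟩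

/-- The arity `4`. -/
abbrev ar4 : Arity := ⟨4, by decide⟩

/-- A (4-)truncated operad in the category of groupoids. The groupoid of arity `n` is given by its
set `Ob n` of objects and its set `Mor n` of all morphisms, with source and target maps, and
`comp γ η` is the composite `γ · η` (first `η`, then `γ`). The symmetric groups act from the left by
functors, and the elementary insertions `∘ᵢ` are functors. Labels are numbered from `0`. The operad
axioms are stated for morphisms; those for objects are the special case of identity morphisms. -/
structure TruncatedOperad where
  Ob : Arity → Type
  Mor : Arity → Type
  src : ∀ {n}, Mor n → Ob n
  tgt : ∀ {n}, Mor n → Ob n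
  ident : ∀ {n}, Ob n → Mor n
  comp : ∀ {n} (γ η : Mor n), src γ = tgt η → Mor n
  inv : ∀ {n}, Mor n → Mor n
  actOb : ∀ {n : Arity}, Equiv.Perm (Fin n) → Ob n → Ob n
  act : ∀ {n : Arity}, Equiv.Perm (Fin n) → Mor n → Mor n
  insOb : ∀ {n m k : Arity}, (n : ℕ) + m = k + 1 → Fin n → Ob n → Ob m → Ob k
  ins : ∀ {n m k : Arity}, (n : ℕ) + m = k + 1 → Fin n → Mor n → Mor m → Mor k
  unit : Ob ar1
  src_ident : ∀ {n} (x : Ob n), src (ident x) = x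
  tgt_ident : ∀ {n} (x : Ob n), tgt (ident x) = x
  src_comp : ∀ {n} (γ η : Mor n) (e : src γ = tgt η), src (comp γ η e) = src η
  tgt_comp : ∀ {n} (γ η : Mor n) (e : src γ = tgt η), tgt (comp γ η e) = tgt γ
  src_inv : ∀ {n} (γ : Mor n), src (inv γ) = tgt γ
  tgt_inv : ∀ {n} (γ : Mor n), tgt (inv γ) = src γ
  comp_ident : ∀ {n} (γ : Mor n), comp γ (ident (src γ)) (tgt_ident _).symm = γ
  ident_comp : ∀ {n} (γ : Mor n), comp (ident (tgt γ)) γ (src_ident _) = γ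
  comp_assoc : ∀ {n} (γ₁ γ₂ γ₃ : Mor n) (e : src γ₁ = tgt γ₂) (e' : src γ₂ = tgt γ₃),
    comp (comp γ₁ γ₂ e) γ₃ ((src_comp _ _ e).trans e') =
      comp γ₁ (comp γ₂ γ₃ e') (e.trans (tgt_comp _ _ e').symm)
  inv_comp : ∀ {n} (γ : Mor n), comp (inv γ) γ (src_inv γ) = ident (src γ)
  comp_inv : ∀ {n} (γ : Mor n), comp γ (inv γ) (tgt_inv γ).symm = ident (tgt γ)
  src_act : ∀ {n : Arity} (θ : Equiv.Perm (Fin n)) (γ : Mor n), src (act θ γ) = actOb θ (src γ)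
  tgt_act : ∀ {n : Arity} (θ : Equiv.Perm (Fin n)) (γ : Mor n), tgt (act θ γ) = actOb θ (tgt γ)
  act_ident : ∀ {n : Arity} (θ : Equiv.Perm (Fin n)) (x : Ob n),
    act θ (ident x) = ident (actOb θ x)
  act_comp : ∀ {n : Arity} (θ : Equiv.Perm (Fin n)) (γ η : Mor n) (e : src γ = tgt η)
    (e' : src (act θ γ) = tgt (act θ η)), act θ (comp γ η e) = comp (act θ γ) (act θ η) e'
  act_one : ∀ {n : Arity} (γ : Mor n), act (1 : Equiv.Perm (Fin n)) γ = γ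
  act_mul : ∀ {n : Arity} (θ η : Equiv.Perm (Fin n)) (γ : Mor n),
    act (θ * η) γ = act θ (act η γ)
  src_ins : ∀ {n m k : Arity} (h : (n : ℕ) + m = k + 1) (i : Fin n) (γ : Mor n) (γ' : Mor m),
    src (ins h i γ γ') = insOb h i (src γ) (src γ')
  tgt_ins : ∀ {n m k : Arity} (h : (n : ℕ) + m = k + 1) (i : Fin n) (γ : Mor n) (γ' : Mor m),
    tgt (ins h i γ γ') = insOb h i (tgt γ) (tgt γ')
  ins_ident : ∀ {n m k : Arity} (h : (n : ℕ) + m = k + 1) (i : Fin n) (x : Ob n) (y : Ob m),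
    ins h i (ident x) (ident y) = ident (insOb h i x y)
  ins_comp : ∀ {n m k : Arity} (h : (n : ℕ) + m = k + 1) (i : Fin n) (γ η : Mor n)
    (γ' η' : Mor m) (e : src γ = tgt η) (e' : src γ' = tgt η')
    (e'' : src (ins h i γ γ') = tgt (ins h i η η')),
    ins h i (comp γ η e) (comp γ' η' e') = comp (ins h i γ γ') (ins h i η η') e''
  ins_act : ∀ {n m k : Arity} (h : (n : ℕ) + m = k + 1) (i : Fin n) (θ : Equiv.Perm (Fin n))
    (η : Equiv.Perm (Fin m)) (γ : Mor n) (γ' : Mor m),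
    ins h (θ i) (act θ γ) (act η γ') = act (insPerm h i θ η) (ins h i γ γ')
  ins_seq : ∀ {n m k a b c : Arity} (h₁ : (n : ℕ) + m = a + 1) (h₂ : (a : ℕ) + k = b + 1)
    (h₃ : (m : ℕ) + k = c + 1) (h₄ : (n : ℕ) + c = b + 1) (i : Fin n) (j : Fin m) (r : Fin a),
    (r : ℕ) = i + j → ∀ (γ₁ : Mor n) (γ₂ : Mor m) (γ₃ : Mor k),
    ins h₂ r (ins h₁ i γ₁ γ₂) γ₃ = ins h₄ i γ₁ (ins h₃ j γ₂ γ₃)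
  ins_par : ∀ {n m k a a' b : Arity} (h₁ : (n : ℕ) + m = a + 1) (h₂ : (a : ℕ) + k = b + 1)
    (h₁' : (n : ℕ) + k = a' + 1) (h₂' : (a' : ℕ) + m = b + 1) (i j : Fin n) (r : Fin a)
    (r' : Fin a'), (i : ℕ) < j → (r : ℕ) = j + m - 1 → (r' : ℕ) = i →
    ∀ (γ₁ : Mor n) (γ₂ : Mor m) (γ₃ : Mor k),
    ins h₂ r (ins h₁ i γ₁ γ₂) γ₃ = ins h₂' r' (ins h₁' j γ₁ γ₃) γ₂
  unit_ins : ∀ {m : Arity} (h : ((ar1 : Arity) : ℕ) + m = m + 1) (i : Fin ar1) (γ : Mor m),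
    ins h i (ident unit) γ = γ
  ins_unit : ∀ {n : Arity} (h : (n : ℕ) + (ar1 : Arity) = n + 1) (i : Fin n) (γ : Mor n),
    ins h i γ (ident unit) = γ

namespace TruncatedOperad

/-- Morphisms of truncated operads: functors in each arity that respect the actions of the symmetric
groups, the elementary insertions and the operadic unit. -/
@[ext]
structure Hom (O P : TruncatedOperad) where
  ob : ∀ {n}, O.Ob n → P.Ob n
  mor : ∀ {n}, O.Mor n → P.Mor n
  map_src : ∀ {n} (γ : O.Mor n), P.src (mor γ) = ob (O.src γ)
  map_tgt : ∀ {n} (γ : O.Mor n), P.tgt (mor γ) = ob (O.tgt γ)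
  map_ident : ∀ {n} (x : O.Ob n), mor (O.ident x) = P.ident (ob x)
  map_comp : ∀ {n} (γ η : O.Mor n) (e : O.src γ = O.tgt η)
    (e' : P.src (mor γ) = P.tgt (mor η)), mor (O.comp γ η e) = P.comp (mor γ) (mor η) e'
  map_act : ∀ {n : Arity} (θ : Equiv.Perm (Fin n)) (γ : O.Mor n),
    mor (O.act θ γ) = P.act θ (mor γ)
  map_ins : ∀ {n m k : Arity} (h : (n : ℕ) + m = k + 1) (i : Fin n) (γ : O.Mor n) (γ' : O.Mor m),
    mor (O.ins h i γ γ') = P.ins h i (mor γ) (mor γ')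
  map_unit : ob O.unit = P.unit

instance : CategoryTheory.Category TruncatedOperad where
  Hom := Hom
  id O :=
    { ob := id
      mor := id
      map_src := fun _ => rfl
      map_tgt := fun _ => rfl
      map_ident := fun _ => rfl
      map_comp := fun _ _ _ _ => rfl
      map_act := fun _ _ => rfl
      map_ins := fun _ _ _ _ => rfl
      map_unit := rfl }
  comp {O P Q} F G :=
    { ob := fun x => G.ob (F.ob x)
      mor := fun γ => G.mor (F.mor γ)
      map_src := fun γ => by rw [G.map_src, F.map_src]
      map_tgt := fun γ => by rw [G.map_tgt, F.map_tgt]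
      map_ident := fun x => by rw [F.map_ident, G.map_ident]
      map_comp := fun γ η e e' => by
        rw [F.map_comp γ η e (by rw [F.map_src, F.map_tgt, e]), G.map_comp]
      map_act := fun θ γ => by rw [F.map_act, G.map_act]
      map_ins := fun h i γ γ' => by rw [F.map_ins, G.map_ins]
      map_unit := by rw [F.map_unit, G.map_unit] }

/-- Compatible equivalence relations on a truncated operad. -/
structure CompatibleEquiv (O : TruncatedOperad) where
  rel : ∀ n, Setoid (O.Mor n)
  src_eq : ∀ {n} {γ γ' : O.Mor n}, (rel n).r γ γ' → O.src γ = O.src γ'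
  tgt_eq : ∀ {n} {γ γ' : O.Mor n}, (rel n).r γ γ' → O.tgt γ = O.tgt γ'
  comp : ∀ {n} {γ γ' η η' : O.Mor n} (e : O.src γ = O.tgt η) (e' : O.src γ' = O.tgt η'),
    (rel n).r γ γ' → (rel n).r η η' → (rel n).r (O.comp γ η e) (O.comp γ' η' e')
  act : ∀ {n : Arity} (θ : Equiv.Perm (Fin n)) {γ γ' : O.Mor n},
    (rel n).r γ γ' ↔ (rel n).r (O.act θ γ) (O.act θ γ')
  ins_left : ∀ {n m k : Arity} (h : (n : ℕ) + m = k + 1) (i : Fin n) {γ γ' : O.Mor n}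
    (η : O.Mor m), (rel n).r γ γ' → (rel k).r (O.ins h i γ η) (O.ins h i γ' η)
  ins_right : ∀ {n m k : Arity} (h : (n : ℕ) + m = k + 1) (i : Fin n) (γ : O.Mor n)
    {η η' : O.Mor m}, (rel m).r η η' → (rel k).r (O.ins h i γ η) (O.ins h i γ η')

theorem CompatibleEquiv.inv {O : TruncatedOperad} (R : O.CompatibleEquiv) {n : Arity}
    {γ γ' : O.Mor n} (h : (R.rel n).r γ γ') : (R.rel n).r (O.inv γ) (O.inv γ') := by
  have es := R.src_eq h
  have et := R.tgt_eq h
  have e1 : O.src (O.inv γ) = O.tgt γ' := by rw [O.src_inv, et]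
  have e2 : O.src γ' = O.tgt (O.inv γ') := (O.tgt_inv γ').symm
  have e3 : O.src (O.comp (O.inv γ) γ' e1) = O.tgt (O.inv γ') := (O.src_comp _ _ _).trans e2
  have k1 : O.comp (O.comp (O.inv γ) γ' e1) (O.inv γ') e3 = O.inv γ := by
    rw [O.comp_assoc _ _ _ e1 e2]
    have : ∀ (x : O.Mor n) (e), x = O.ident (O.src (O.inv γ)) → O.comp (O.inv γ) x e = O.inv γ := by
      rintro x e rfl; exact O.comp_ident _
    exact this _ _ (by rw [O.comp_inv, O.src_inv, et])
  have k2 : O.comp (O.comp (O.inv γ) γ (O.src_inv γ)) (O.inv γ')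
      ((O.src_comp _ _ _).trans (es.trans e2)) = O.inv γ' := by
    have : ∀ (x : O.Mor n) (e), x = O.ident (O.tgt (O.inv γ')) →
        O.comp x (O.inv γ') e = O.inv γ' := by
      rintro x e rfl; exact O.ident_comp _
    exact this _ _ (by rw [O.inv_comp, O.tgt_inv, es])
  have hh := R.comp (O.src_comp _ _ (O.src_inv γ) |>.trans (es.trans e2)) e3
    (R.comp (O.src_inv γ) e1 ((R.rel n).refl (O.inv γ)) h) ((R.rel n).refl (O.inv γ'))
  rw [k1, k2] at hh
  exact (R.rel n).symm hh

/-- The quotient of a truncated operad by a compatible equivalence relation: it has the same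
objects, its morphisms are the equivalence classes of morphisms, and all operations are computed on
representatives. -/
def quotient (O : TruncatedOperad) (R : O.CompatibleEquiv) : TruncatedOperad where
  Ob := O.Ob
  Mor n := Quotient (R.rel n)
  src := Quotient.lift O.src fun _ _ h => R.src_eq h
  tgt := Quotient.lift O.tgt fun _ _ h => R.tgt_eq h
  ident x := Quotient.mk _ (O.ident x)
  comp {n} γ η := Quotient.hrecOn₂
    (φ := fun γ η => Quotient.lift O.src (fun _ _ h => R.src_eq h) γ =
      Quotient.lift O.tgt (fun _ _ h => R.tgt_eq h) η → Quotient (R.rel n))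
    γ η (fun γ η e => Quotient.mk _ (O.comp γ η e)) (fun γ η γ' η' h h' =>
      Function.hfunext (by
        change (O.src γ = O.tgt η) = (O.src γ' = O.tgt η')
        rw [R.src_eq h, R.tgt_eq h']) fun e e' _ =>
        heq_of_eq (Quotient.sound (R.comp e e' h h')))
  inv := Quotient.map O.inv fun _ _ h => R.inv h
  actOb := O.actOb
  act θ := Quotient.map (O.act θ) fun _ _ h => (R.act θ).1 h
  insOb := O.insOb
  ins h i := Quotient.map₂ (O.ins h i) fun _ _ h₁ _ _ h₂ =>
    (R.rel _).trans (R.ins_left h i _ h₁) (R.ins_right h i _ h₂)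
  unit := O.unit
  src_ident := O.src_ident
  tgt_ident := O.tgt_ident
  src_comp := by rintro n ⟨γ⟩ ⟨η⟩ e; exact O.src_comp γ η e
  tgt_comp := by rintro n ⟨γ⟩ ⟨η⟩ e; exact O.tgt_comp γ η e
  src_inv := by rintro n ⟨γ⟩; exact O.src_inv γ
  tgt_inv := by rintro n ⟨γ⟩; exact O.tgt_inv γ
  comp_ident := by rintro n ⟨γ⟩; exact congrArg (Quotient.mk _) (O.comp_ident γ)
  ident_comp := by rintro n ⟨γ⟩; exact congrArg (Quotient.mk _) (O.ident_comp γ)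
  comp_assoc := by
    rintro n ⟨γ₁⟩ ⟨γ₂⟩ ⟨γ₃⟩ e e'
    exact congrArg (Quotient.mk _) (O.comp_assoc γ₁ γ₂ γ₃ e e')
  inv_comp := by rintro n ⟨γ⟩; exact congrArg (Quotient.mk _) (O.inv_comp γ)
  comp_inv := by rintro n ⟨γ⟩; exact congrArg (Quotient.mk _) (O.comp_inv γ)
  src_act := by rintro n θ ⟨γ⟩; exact O.src_act θ γ
  tgt_act := by rintro n θ ⟨γ⟩; exact O.tgt_act θ γ
  act_ident θ x := congrArg (Quotient.mk _) (O.act_ident θ x)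
  act_comp := by
    rintro n θ ⟨γ⟩ ⟨η⟩ e e'; exact congrArg (Quotient.mk _) (O.act_comp θ γ η e e')
  act_one := by rintro n ⟨γ⟩; exact congrArg (Quotient.mk _) (O.act_one γ)
  act_mul := by rintro n θ η ⟨γ⟩; exact congrArg (Quotient.mk _) (O.act_mul θ η γ)
  src_ins := by rintro n m k h i ⟨γ⟩ ⟨γ'⟩; exact O.src_ins h i γ γ'
  tgt_ins := by rintro n m k h i ⟨γ⟩ ⟨γ'⟩; exact O.tgt_ins h i γ γ'
  ins_ident h i x y := congrArg (Quotient.mk _) (O.ins_ident h i x y)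
  ins_comp := by
    rintro n m k h i ⟨γ⟩ ⟨η⟩ ⟨γ'⟩ ⟨η'⟩ e e' e''
    exact congrArg (Quotient.mk _) (O.ins_comp h i γ η γ' η' e e' e'')
  ins_act := by
    rintro n m k h i θ η ⟨γ⟩ ⟨γ'⟩; exact congrArg (Quotient.mk _) (O.ins_act h i θ η γ γ')
  ins_seq := by
    rintro n m k a b c h₁ h₂ h₃ h₄ i j r hr ⟨γ₁⟩ ⟨γ₂⟩ ⟨γ₃⟩
    exact congrArg (Quotient.mk _) (O.ins_seq h₁ h₂ h₃ h₄ i j r hr γ₁ γ₂ γ₃)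
  ins_par := by
    rintro n m k a a' b h₁ h₂ h₁' h₂' i j r r' hij hr hr' ⟨γ₁⟩ ⟨γ₂⟩ ⟨γ₃⟩
    exact congrArg (Quotient.mk _) (O.ins_par h₁ h₂ h₁' h₂' i j r r' hij hr hr' γ₁ γ₂ γ₃)
  unit_ins := by rintro m h i ⟨γ⟩; exact congrArg (Quotient.mk _) (O.unit_ins h i γ)
  ins_unit := by rintro n h i ⟨γ⟩; exact congrArg (Quotient.mk _) (O.ins_unit h i γ)

/-- The canonical projection onto the quotient. -/
def proj (O : TruncatedOperad) (R : O.CompatibleEquiv) : O ⟶ O.quotient R :=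
  Hom.mk (P := O.quotient R)
    (ob := fun x => x)
    (mor := fun γ => Quotient.mk _ γ)
    (map_src := fun _ => rfl)
    (map_tgt := fun _ => rfl)
    (map_ident := fun _ => rfl)
    (map_comp := fun _ _ _ _ => rfl)
    (map_act := fun _ _ => rfl)
    (map_ins := fun _ _ _ _ => rfl)
    (map_unit := rfl)

end TruncatedOperad

/-! ## Parenthesized braids -/

/-- Replacing the leaf number `p` of the planar binary tree `x` by the tree `t`. -/
def graft : FreeMagma Unit → ℕ → FreeMagma Unit → FreeMagma Unit
  | .of _, _, t => t
  | .mul x y, p, t =>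
    if p < x.length then .mul (graft x p t) y else .mul x (graft y (p - x.length) t)

theorem graft_length (x : FreeMagma Unit) (p : ℕ) (t : FreeMagma Unit) (hp : p < x.length) :
    (graft x p t).length + 1 = x.length + t.length := by
  induction x generalizing p with
  | ih1 => simp [graft, FreeMagma.length, add_comm]
  | ih2 x y hx hy =>
    change (graft (FreeMagma.mul x y) p t).length + 1 = (FreeMagma.mul x y).length + t.length
    change p < x.length + y.length at hp
    change _ = x.length + y.length + t.length
    rw [graft]
    split_ifs with c
    · have := hx p c
      change (graft x p t).length + y.length + 1 = _
      omega
    · have := hy (p - x.length) (by omega)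
      change x.length + (graft y (p - x.length) t).length + 1 = _
      omega

theorem graft_leaf (x : FreeMagma Unit) (p : ℕ) (hp : p < x.length) :
    graft x p (.of ()) = x := by
  induction x generalizing p with
  | ih1 => rfl
  | ih2 x y hx hy =>
    change p < x.length + y.length at hp
    change graft (FreeMagma.mul x y) p _ = FreeMagma.mul x y
    rw [graft]
    split_ifs with c
    · rw [hx p c]
    · rw [hy (p - x.length) (by omega)]

theorem graft_seq (x y z : FreeMagma Unit) (p q : ℕ) (hp : p < x.length) (hq : q < y.length) :
    graft (graft x p y) (p + q) z = graft x p (graft y q z) := by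
  induction x generalizing p with
  | ih1 =>
    change p < 1 at hp
    obtain rfl : p = 0 := by omega
    rw [zero_add]; rfl
  | ih2 x x' hx hx' =>
    change p < x.length + x'.length at hp
    change graft (graft (FreeMagma.mul x x') p y) (p + q) z = graft (FreeMagma.mul x x') p _
    rw [graft, graft]
    split_ifs with c
    · have := graft_length x p y c
      rw [graft, if_pos (by omega), hx p c]
    · rw [graft, if_neg (by omega), show p + q - x.length = p - x.length + q by omega,
        hx' _ (by omega)]

theorem graft_par (x y z : FreeMagma Unit) (p q : ℕ) (hpq : p < q) (hq : q < x.length) :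
    graft (graft x p y) (q + y.length - 1) z = graft (graft x q z) p y := by
  induction x generalizing p q with
  | ih1 =>
    change q < 1 at hq
    omega
  | ih2 x x' hx hx' =>
    change q < x.length + x'.length at hq
    change graft (graft (FreeMagma.mul x x') p y) _ z = graft (graft (FreeMagma.mul x x') q z) p y
    have hy := y.length_pos
    rw [graft, graft]
    by_cases c : p < x.length
    · have l1 := graft_length x p y c
      rw [if_pos c]
      by_cases d : q < x.length
      · have l2 := graft_length x q z d
        have hz := z.length_pos
        rw [if_pos d, graft, if_pos (by omega), graft, if_pos (by omega), hx p q hpq d]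
      · rw [if_neg d, graft, if_neg (by omega), graft, if_pos c,
          show q + y.length - 1 - (graft x p y).length = q - x.length by omega]
    · rw [if_neg c, if_neg (by omega), graft, if_neg (by omega), graft, if_neg c,
        show q + y.length - 1 - x.length = (q - x.length) + y.length - 1 by omega,
        hx' (p - x.length) (q - x.length) (by omega) (by omega)]

/-- An object of `PaB(n)`: a parenthesization of the sequence `τ(1), …, τ(n)` for a permutation `τ`.
The parenthesization is a planar binary tree with `n` leaves; `perm` sends a position to the label
at this position. -/
@[ext]
structure PaBOb (n : ℕ) where
  shape : FreeMagma Unit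
  len : shape.length = n
  perm : Equiv.Perm (Fin n)

/-- A morphism of `PaB(n)`: the morphisms from `τ₁` to `τ₂` are the braids `g` such that
`ρ(g) = 𝔭(τ₂)⁻¹ ∘ 𝔭(τ₁)`. -/
@[ext]
structure PaBMor (n : ℕ) where
  src : PaBOb n
  tgt : PaBOb n
  braid : B n
  rho_braid : rho n braid = tgt.perm⁻¹ * src.perm

/-- Insertion of objects: the label `i` of `x` is replaced by `y`, whose labels are increased by `i`,
and the labels of `x` above `i` are increased by `m - 1`. -/
def PaBOb.ins {n m k : ℕ} (h : n + m = k + 1) (i : Fin n) (x : PaBOb n) (y : PaBOb m) :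
    PaBOb k where
  shape := graft x.shape (x.perm⁻¹ i : Fin n) y.shape
  len := by
    have := graft_length x.shape (x.perm⁻¹ i : Fin n) y.shape (by rw [x.len]; exact Fin.is_lt _)
    rw [x.len, y.len] at this
    omega
  perm := insPerm h (x.perm⁻¹ i) x.perm y.perm

theorem ins_bound {n m k : ℕ} (h : n + m = k + 1) (p : Fin n) : (p : ℕ) + m ≤ k := by omega

theorem PaBMor.pos_tgt {n : ℕ} (γ : PaBMor n) (i : Fin n) :
    rho n γ.braid (γ.src.perm⁻¹ i) = γ.tgt.perm⁻¹ i := by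
  rw [γ.rho_braid, Equiv.Perm.mul_apply]
  exact congrArg _ (Equiv.apply_symm_apply _ _)

/-- Insertion of morphisms: the strand of `γ` that originates at the position labeled by `i` is
replaced by a thin version of `γ'`. -/
def PaBMor.ins {n m k : ℕ} (h : n + m = k + 1) (i : Fin n) (γ : PaBMor n) (γ' : PaBMor m) :
    PaBMor k where
  src := γ.src.ins h i γ'.src
  tgt := γ.tgt.ins h i γ'.tgt
  braid := cable h (γ.src.perm⁻¹ i) γ.braid *
    shift (γ.src.perm⁻¹ i : Fin n) (ins_bound h _) γ'.braid
  rho_braid := by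
    rw [rho_cable_shift, eq_inv_mul_iff_mul_eq]
    change insPerm h (γ.tgt.perm⁻¹ i) γ.tgt.perm γ'.tgt.perm * _ = insPerm h _ _ _
    rw [← γ.pos_tgt, insPerm_mul, γ.rho_braid, γ'.rho_braid, mul_inv_cancel_left,
      mul_inv_cancel_left]

theorem pos_seq {n m a : ℕ} (h : n + m = a + 1) {i : Fin n} {j : Fin m} {r : Fin a}
    (hr : (r : ℕ) = i + j) (x : PaBOb n) (y : PaBOb m) :
    (((x.ins h i y).perm⁻¹ r : Fin a) : ℕ) = (x.perm⁻¹ i : Fin n) + (y.perm⁻¹ j : Fin m) := by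
  have e : x.perm (x.perm⁻¹ i) = i := Equiv.apply_symm_apply _ _
  change (((insPerm h (x.perm⁻¹ i) x.perm y.perm)⁻¹ r : Fin a) : ℕ) = _
  rw [insPerm_inv, e, insPerm_inn h _ _ hr]

theorem pos_par {n m a : ℕ} (h : n + m = a + 1) {i j : Fin n} (hij : j ≠ i) {r : Fin a}
    (hr : (r : ℕ) = outv m i j) (x : PaBOb n) (y : PaBOb m) :
    (((x.ins h i y).perm⁻¹ r : Fin a) : ℕ) =
      outv m (x.perm⁻¹ i : Fin n) (x.perm⁻¹ j : Fin n) := by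
  have e : x.perm (x.perm⁻¹ i) = i := Equiv.apply_symm_apply _ _
  change (((insPerm h (x.perm⁻¹ i) x.perm y.perm)⁻¹ r : Fin a) : ℕ) = _
  rw [insPerm_inv, e, insPerm_out h _ _ hij hr]

theorem PaBOb.ins_seq {n m k a b c : ℕ} (h₁ : n + m = a + 1) (h₂ : a + k = b + 1)
    (h₃ : m + k = c + 1) (h₄ : n + c = b + 1) (i : Fin n) (j : Fin m) (r : Fin a)
    (hr : (r : ℕ) = i + j) (x : PaBOb n) (y : PaBOb m) (z : PaBOb k) :
    (x.ins h₁ i y).ins h₂ r z = x.ins h₄ i (y.ins h₃ j z) := by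
  have e := pos_seq h₁ hr x y
  refine PaBOb.ext ?_ (insPerm_seq h₁ h₂ h₃ h₄ _ _ _ e _ _ _)
  change graft (graft _ _ _) (((x.ins h₁ i y).perm⁻¹ r : Fin a) : ℕ) _ = graft _ _ (graft _ _ _)
  rw [e, graft_seq]
  · rw [x.len]; exact Fin.is_lt _
  · rw [y.len]; exact Fin.is_lt _

theorem PaBOb.ins_par {n m k a a' b : ℕ} (h₁ : n + m = a + 1) (h₂ : a + k = b + 1)
    (h₁' : n + k = a' + 1) (h₂' : a' + m = b + 1) (i j : Fin n) (hij : i ≠ j) (r : Fin a)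
    (r' : Fin a') (hr : (r : ℕ) = outv m i j) (hr' : (r' : ℕ) = outv k j i)
    (x : PaBOb n) (y : PaBOb m) (z : PaBOb k) :
    (x.ins h₁ i y).ins h₂ r z = (x.ins h₁' j z).ins h₂' r' y := by
  have e := pos_par h₁ hij.symm hr x y
  have e' := pos_par h₁' hij hr' x z
  have hpq : x.perm⁻¹ i ≠ x.perm⁻¹ j := fun e => hij (x.perm⁻¹.injective e)
  have hpq' : ((x.perm⁻¹ i : Fin n) : ℕ) ≠ (x.perm⁻¹ j : Fin n) := fun e => hpq (Fin.ext e)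
  refine PaBOb.ext ?_ (insPerm_par h₁ h₂ h₁' h₂' _ _ hpq _ _ e e' _ _ _)
  change graft (graft _ _ _) (((x.ins h₁ i y).perm⁻¹ r : Fin a) : ℕ) _ =
    graft (graft _ _ _) (((x.ins h₁' j z).perm⁻¹ r' : Fin a') : ℕ) _
  rw [e, e']
  unfold outv
  rcases lt_or_gt_of_ne hpq' with c | c
  · rw [if_neg (by omega), if_pos c]
    have := graft_par x.shape y.shape z.shape _ _ c (by rw [x.len]; exact Fin.is_lt _)
    rw [y.len] at this
    exact this
  · rw [if_pos c, if_neg (by omega)]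
    have := graft_par x.shape z.shape y.shape _ _ c (by rw [x.len]; exact Fin.is_lt _)
    rw [z.len] at this
    exact this.symm

theorem PaBMor.ins_seq {n m k a b c : ℕ} (h₁ : n + m = a + 1) (h₂ : a + k = b + 1)
    (h₃ : m + k = c + 1) (h₄ : n + c = b + 1) (i : Fin n) (j : Fin m) (r : Fin a)
    (hr : (r : ℕ) = i + j) (x : PaBMor n) (y : PaBMor m) (z : PaBMor k) :
    (x.ins h₁ i y).ins h₂ r z = x.ins h₄ i (y.ins h₃ j z) := by
  refine PaBMor.ext (PaBOb.ins_seq h₁ h₂ h₃ h₄ i j r hr _ _ _)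
    (PaBOb.ins_seq h₁ h₂ h₃ h₄ i j r hr _ _ _) ?_
  have e := pos_seq h₁ hr x.src y.src
  change cable h₂ ((x.src.ins h₁ i y.src).perm⁻¹ r)
      (cable h₁ _ x.braid * shift _ (ins_bound h₁ _) y.braid) *
      shift ((x.src.ins h₁ i y.src).perm⁻¹ r : Fin a) (ins_bound h₂ _) z.braid =
    cable h₄ _ x.braid * shift _ (ins_bound h₄ _)
      (cable h₃ _ y.braid * shift _ (ins_bound h₃ _) z.braid)
  have e' : (rho a (shift _ (ins_bound h₁ (x.src.perm⁻¹ i)) y.braid)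
      ((x.src.ins h₁ i y.src).perm⁻¹ r) : ℕ) =
      (x.src.perm⁻¹ i : Fin n) + (rho m y.braid (y.src.perm⁻¹ j) : Fin m) := by
    rw [rho_shift h₁, insPerm_inn h₁ _ _ e, Equiv.Perm.one_apply]
  rw [cable_mul, cable_cable h₁ h₂ h₃ h₄ _ _ _ e',
    cable_shift_inner h₁ h₂ h₃ _ _ _ e _ (ins_bound h₄ _), map_mul, mul_assoc,
    shift_shift (ins_bound h₃ _) (ins_bound h₄ _) (ins_bound h₂ _) e]

theorem PaBMor.ins_par {n m k a a' b : ℕ} (h₁ : n + m = a + 1) (h₂ : a + k = b + 1)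
    (h₁' : n + k = a' + 1) (h₂' : a' + m = b + 1) (i j : Fin n) (hij : i ≠ j) (r : Fin a)
    (r' : Fin a') (hr : (r : ℕ) = outv m i j) (hr' : (r' : ℕ) = outv k j i)
    (x : PaBMor n) (y : PaBMor m) (z : PaBMor k) :
    (x.ins h₁ i y).ins h₂ r z = (x.ins h₁' j z).ins h₂' r' y := by
  refine PaBMor.ext (PaBOb.ins_par h₁ h₂ h₁' h₂' i j hij r r' hr hr' _ _ _)
    (PaBOb.ins_par h₁ h₂ h₁' h₂' i j hij r r' hr hr' _ _ _) ?_
  have e := pos_par h₁ hij.symm hr x.src y.src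
  have e' := pos_par h₁' hij hr' x.src z.src
  have hpq : x.src.perm⁻¹ i ≠ x.src.perm⁻¹ j := fun e => hij (x.src.perm⁻¹.injective e)
  change cable h₂ ((x.src.ins h₁ i y.src).perm⁻¹ r)
      (cable h₁ _ x.braid * shift _ (ins_bound h₁ _) y.braid) *
      shift ((x.src.ins h₁ i y.src).perm⁻¹ r : Fin a) (ins_bound h₂ _) z.braid =
    cable h₂' ((x.src.ins h₁' j z.src).perm⁻¹ r')
      (cable h₁' _ x.braid * shift _ (ins_bound h₁' _) z.braid) *
      shift ((x.src.ins h₁' j z.src).perm⁻¹ r' : Fin a') (ins_bound h₂' _) y.braid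
  generalize (x.src.ins h₁ i y.src).perm⁻¹ r = R at *
  generalize (x.src.ins h₁' j z.src).perm⁻¹ r' = R' at *
  generalize x.src.perm⁻¹ i = p at *
  generalize x.src.perm⁻¹ j = q at *
  have f : rho a (shift p (ins_bound h₁ p) y.braid) R = R := Fin.ext (by
    rw [rho_shift h₁, insPerm_out h₁ _ _ hpq.symm e, e]; rfl)
  have f' : rho a' (shift q (ins_bound h₁' q) z.braid) R' = R' := Fin.ext (by
    rw [rho_shift h₁', insPerm_out h₁' _ _ hpq e', e']; rfl)
  have b1 : outv k q p + m ≤ b := by rw [← e']; exact ins_bound h₂' R'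
  have b2 : outv m p q + k ≤ b := by rw [← e]; exact ins_bound h₂ R
  have g1 := cable_shift_outer h₁ h₂ p q hpq.symm R e (ins_bound h₁ p) b1 y.braid
  have g2 := cable_shift_outer h₁' h₂' q p hpq R' e' (ins_bound h₁' q) b2 z.braid
  rw [cable_mul, cable_mul, f, f', g1, g2, cable_par h₁ h₂ h₁' h₂' p q hpq R R' e e', mul_assoc,
    mul_assoc]
  congr 1
  have t1 : ∀ (u v : ℕ) (hu : u + m ≤ b) (hv : v + m ≤ b), u = v →
      shift u hu y.braid = shift v hv y.braid := by rintro u v hu hv rfl; rfl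
  have t2 : ∀ (u v : ℕ) (hu : u + k ≤ b) (hv : v + k ≤ b), u = v →
      shift u hu z.braid = shift v hv z.braid := by rintro u v hu hv rfl; rfl
  have c := cable_shift_comm h₂ R R (ins_bound h₂ R) (ins_bound h₂ R) _ f.symm z.braid
  rw [g1, t1 (outv k q p) R' b1 (ins_bound h₂' R') e'.symm] at c
  rw [t1 (outv k q p) R' b1 (ins_bound h₂' R') e'.symm,
    t2 (outv m p q) R b2 (ins_bound h₂ R) e.symm, c]

theorem ins_braid_mul {n m k : ℕ} (h : n + m = k + 1) (p q : Fin n) (x y : B n) (x' y' : B m)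
    (hq : q = rho n y p) :
    cable h p (x * y) * shift p (ins_bound h p) (x' * y') =
      (cable h q x * shift q (ins_bound h q) x') * (cable h p y * shift p (ins_bound h p) y') := by
  have c := cable_shift_comm h p q (ins_bound h p) (ins_bound h q) y hq x'
  rw [cable_mul, ← hq, map_mul, mul_assoc, mul_assoc, ← mul_assoc (cable h p y), c, mul_assoc]

theorem PaBOb.len_lt {n : ℕ} (x : PaBOb n) (p : Fin n) : (p : ℕ) < x.shape.length := by
  rw [x.len]; exact p.2

/-- The truncated operad `PaB^{≤4}` of parenthesized braids. -/
def PaB : TruncatedOperad where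
  Ob n := PaBOb n
  Mor n := PaBMor n
  src γ := γ.src
  tgt γ := γ.tgt
  ident x := ⟨x, x, 1, by rw [map_one, inv_mul_cancel]⟩
  comp γ η e := ⟨η.src, γ.tgt, γ.braid * η.braid, by
    rw [map_mul, γ.rho_braid, η.rho_braid, e, mul_assoc, mul_inv_cancel_left]⟩
  inv γ := ⟨γ.tgt, γ.src, γ.braid⁻¹, by rw [map_inv, γ.rho_braid, mul_inv_rev, inv_inv]⟩
  actOb θ x := ⟨x.shape, x.len, θ * x.perm⟩
  act θ γ := ⟨⟨γ.src.shape, γ.src.len, θ * γ.src.perm⟩, ⟨γ.tgt.shape, γ.tgt.len, θ * γ.tgt.perm⟩,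
    γ.braid, by
      change _ = (θ * γ.tgt.perm)⁻¹ * (θ * γ.src.perm)
      rw [γ.rho_braid, mul_inv_rev, mul_assoc, inv_mul_cancel_left]⟩
  insOb h i x y := x.ins h i y
  ins h i γ γ' := γ.ins h i γ'
  unit := ⟨.of (), rfl, 1⟩
  src_ident _ := rfl
  tgt_ident _ := rfl
  src_comp _ _ _ := rfl
  tgt_comp _ _ _ := rfl
  src_inv _ := rfl
  tgt_inv _ := rfl
  comp_ident γ := PaBMor.ext rfl rfl (mul_one _)
  ident_comp γ := PaBMor.ext rfl rfl (one_mul _)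
  comp_assoc _ _ _ _ _ := PaBMor.ext rfl rfl (mul_assoc _ _ _)
  inv_comp γ := PaBMor.ext rfl rfl (inv_mul_cancel _)
  comp_inv γ := PaBMor.ext rfl rfl (mul_inv_cancel _)
  src_act _ _ := rfl
  tgt_act _ _ := rfl
  act_ident _ _ := rfl
  act_comp _ _ _ _ _ := rfl
  act_one γ := PaBMor.ext (PaBOb.ext rfl (one_mul _)) (PaBOb.ext rfl (one_mul _)) rfl
  act_mul _ _ γ := PaBMor.ext (PaBOb.ext rfl (mul_assoc _ _ _)) (PaBOb.ext rfl (mul_assoc _ _ _))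
    rfl
  src_ins _ _ _ _ := rfl
  tgt_ins _ _ _ _ := rfl
  ins_ident h i x y := PaBMor.ext rfl rfl (by
    change cable h _ 1 * shift _ _ 1 = 1
    rw [cable_one, map_one, one_mul])
  ins_comp h i γ η γ' η' e e' e'' := PaBMor.ext rfl rfl (by
    have hpos := η.pos_tgt i
    rw [← show γ.src = η.tgt from e] at hpos
    exact ins_braid_mul h (η.src.perm⁻¹ i) (γ.src.perm⁻¹ i) γ.braid η.braid γ'.braid η'.braid
      hpos.symm)
  ins_act h i θ η γ γ' := by
    have e : ∀ π : Equiv.Perm (Fin _), (θ * π)⁻¹ (θ i) = π⁻¹ i := fun π => by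
      rw [mul_inv_rev, Equiv.Perm.mul_apply]
      exact congrArg _ (Equiv.symm_apply_apply _ _)
    have hob : ∀ (x : PaBOb _) (y : PaBOb _),
        PaBOb.ins h (θ i) ⟨x.shape, x.len, θ * x.perm⟩ ⟨y.shape, y.len, η * y.perm⟩ =
        ⟨(x.ins h i y).shape, (x.ins h i y).len, insPerm h i θ η * (x.ins h i y).perm⟩ := by
      intro x y
      refine PaBOb.ext ?_ ?_
      · change graft x.shape (((θ * x.perm)⁻¹ (θ i) : Fin _) : ℕ) y.shape = graft _ _ _
        rw [e]
      · change insPerm h ((θ * x.perm)⁻¹ (θ i)) (θ * x.perm) (η * y.perm) =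
          insPerm h i θ η * insPerm h (x.perm⁻¹ i) x.perm y.perm
        have := insPerm_mul h (x.perm⁻¹ i) x.perm θ y.perm η
        rw [show x.perm (x.perm⁻¹ i) = i from Equiv.apply_symm_apply _ _] at this
        rw [e, this]
    refine PaBMor.ext (hob _ _) (hob _ _) ?_
    change cable h ((θ * γ.src.perm)⁻¹ (θ i)) γ.braid *
        shift (((θ * γ.src.perm)⁻¹ (θ i) : Fin _) : ℕ) (ins_bound h _) γ'.braid =
      cable h _ γ.braid * shift _ (ins_bound h _) γ'.braid
    rw [e]
  ins_seq := fun h₁ h₂ h₃ h₄ i j r hr x y z => PaBMor.ins_seq h₁ h₂ h₃ h₄ i j r hr x y z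
  ins_par := fun h₁ h₂ h₁' h₂' i j r r' hij hr hr' x y z =>
    PaBMor.ins_par h₁ h₂ h₁' h₂' i j (fun e => by rw [e] at hij; omega) r r'
      (by unfold outv; rw [if_neg (by omega)]; exact hr)
      (by unfold outv; rw [if_pos hij]; exact hr') x y z
  unit_ins := fun {m} h i γ => by
    have hob : ∀ y : PaBOb m, PaBOb.ins (n := 1) h i ⟨.of (), rfl, 1⟩ y = y := fun y =>
      PaBOb.ext rfl (insPerm_unit_left h _ _ _)
    refine PaBMor.ext (hob _) (hob _) ?_
    change cable (n := 1) h _ 1 * shift _ _ γ.braid = γ.braid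
    rw [cable_one, one_mul, shift_zero]
  ins_unit := fun {n} h i γ => by
    have hob : ∀ x : PaBOb n, PaBOb.ins (m := 1) h i x ⟨.of (), rfl, 1⟩ = x := fun x =>
      PaBOb.ext (graft_leaf _ _ (x.len_lt _)) (insPerm_unit_right h _ _ _)
    refine PaBMor.ext (hob _) (hob _) ?_
    change cable (m := 1) h _ γ.braid * shift _ _ 1 = γ.braid
    rw [cable_unit, map_one, mul_one]

open CategoryTheory

/-- The left-normed tree with `n + 1` leaves. -/
def leftComb : ℕ → FreeMagma Unit
  | 0 => .of ()
  | n + 1 => .mul (leftComb n) (.of ())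

theorem leftComb_length (n : ℕ) : (leftComb n).length = n + 1 := by
  induction n with
  | zero => rfl
  | succ n ih => exact congrArg (· + 1) ih

/-- The object `(..(π(1) π(2)) π(3)) … π(n))`. -/
def stdOb (n : Arity) (π : Equiv.Perm (Fin n)) : PaB.Ob n :=
  ⟨leftComb (n - 1), by have := n.2.1; rw [leftComb_length]; omega, π⟩

/-- The map `𝔪 : B_n → PaB(n)`: the morphism with underlying braid `g` whose source is
`(..(1 2) 3) … n)` and whose target is `(..(i₁ i₂) i₃) … iₙ)`, where `iₖ = ρ(g)⁻¹(k)`. -/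
def mm (n : Arity) (g : B n) : PaB.Mor n :=
  ⟨stdOb n 1, stdOb n (rho n g)⁻¹, g, by simp [stdOb]⟩

/-- The associator: the identity braid viewed as a morphism from `(12)3` to `1(23)`. -/
def alpha : PaB.Mor ar3 :=
  ⟨stdOb ar3 1, ⟨.mul (.of ()) (.mul (.of ()) (.of ())), rfl, 1⟩, 1, by simp [stdOb]⟩

/-- The braiding: the generator of the braid group on two strands, viewed as a morphism from `12`
to `21`. -/
def beta : PaB.Mor ar2 := mm ar2 (s 2 0)

/-! ## From normal subgroups to compatible equivalence relations -/

/-- Cabling of pure braids: `h ↦ 𝔬𝔲(𝔪(h) ∘ id)`, with the identity morphism of arity `m` inserted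
in the strand at position `p`. -/
def cablePB {n m k : ℕ} (h : n + m = k + 1) (p : Fin n) : PB n →* PB k where
  toFun g := ⟨cable h p g, by rw [mem_PB, rho_cable, mem_PB.1 g.2, insPerm_one]⟩
  map_one' := Subtype.ext (cable_one h p)
  map_mul' g g' := Subtype.ext (by
    change cable h p (g * g' : B n) = cable h p g * cable h p g'
    rw [cable_mul, mem_PB.1 g'.2, Equiv.Perm.one_apply])

/-- Juxtaposition with vertical strands: `h ↦ 𝔬𝔲(id ∘ 𝔪(h))`, where the identity morphism has
arity `n` and the insertion is at position `p`. -/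
def shiftPB {n m k : ℕ} (h : n + m = k + 1) (p : Fin n) : PB m →* PB k where
  toFun g := ⟨shift p (ins_bound h p) g, by rw [mem_PB, rho_shift h, mem_PB.1 g.2, insPerm_one]⟩
  map_one' := Subtype.ext (map_one _)
  map_mul' g g' := Subtype.ext (map_mul _ _ _)

/-- `φ₁₂₃ : PB₃ → PB₄`. -/
def phi123 : PB 3 →* PB 4 := shiftPB (show 2 + 3 = 4 + 1 from rfl) 0

/-- `φ₂₃₄ : PB₃ → PB₄`. -/
def phi234 : PB 3 →* PB 4 := shiftPB (show 2 + 3 = 4 + 1 from rfl) 1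

/-- `φ₁₂,₃,₄ : PB₃ → PB₄`. -/
def phi12_3_4 : PB 3 →* PB 4 := cablePB (show 3 + 2 = 4 + 1 from rfl) 0

/-- `φ₁,₂₃,₄ : PB₃ → PB₄`. -/
def phi1_23_4 : PB 3 →* PB 4 := cablePB (show 3 + 2 = 4 + 1 from rfl) 1

/-- `φ₁,₂,₃₄ : PB₃ → PB₄`. -/
def phi1_2_34 : PB 3 →* PB 4 := cablePB (show 3 + 2 = 4 + 1 from rfl) 2

/-- `φ₁₂ : PB₂ → PB₃`. -/
def phi12 : PB 2 →* PB 3 := shiftPB (show 2 + 2 = 3 + 1 from rfl) 0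

/-- `φ₂₃ : PB₂ → PB₃`. -/
def phi23 : PB 2 →* PB 3 := shiftPB (show 2 + 2 = 3 + 1 from rfl) 1

/-- `φ₁₂,₃ : PB₂ → PB₃`. -/
def phi12_3 : PB 2 →* PB 3 := cablePB (show 2 + 2 = 3 + 1 from rfl) 0

/-- `φ₁,₂₃ : PB₂ → PB₃`. -/
def phi1_23 : PB 2 →* PB 3 := cablePB (show 2 + 2 = 3 + 1 from rfl) 1

/-- The preimage of a subgroup under a homomorphism of pure braid groups. -/
def pull {n k : ℕ} (φ : PB n →* PB k) (N : Subgroup (B k)) : Subgroup (PB n) :=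
  (N.subgroupOf (PB k)).comap φ

/-- The subgroup `N_{PB₃}`, as a subgroup of the braid group. -/
def NPB3 (N : Subgroup (B 4)) : Subgroup (B 3) :=
  (pull phi123 N ⊓ pull phi12_3_4 N ⊓ pull phi1_23_4 N ⊓ pull phi1_2_34 N ⊓ pull phi234 N).map
    (PB 3).subtype

/-- The subgroup `N_{PB₂}`, as a subgroup of the braid group. -/
def NPB2 (N : Subgroup (B 4)) : Subgroup (B 2) :=
  (pull phi12 (NPB3 N) ⊓ pull phi12_3 (NPB3 N) ⊓ pull phi1_23 (NPB3 N) ⊓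
    pull phi23 (NPB3 N)).map (PB 2).subtype

/-- The subgroups `N_{PBₙ}`; here `N_{PB₄} = N`, and `N_{PB₁}` is trivial like the group `B₁`. -/
def NPB (N : Subgroup (B 4)) : (n : ℕ) → Subgroup (B n)
  | 2 => NPB2 N
  | 3 => NPB3 N
  | 4 => N
  | _ => ⊥

/-- Normal subgroups of finite index of `B₄` that are contained in `PB₄`. -/
def IsNFI (N : Subgroup (B 4)) : Prop := N.Normal ∧ N.FiniteIndex ∧ N ≤ PB 4

/-- The set `NFI_{PB₄}(B₄)`. -/
def NFI : Type := {N : Subgroup (B 4) // IsNFI N}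

theorem mem_NPB3 {N : Subgroup (B 4)} {g : B 3} : g ∈ NPB3 N ↔ g ∈ PB 3 ∧
    (∀ p : Fin 2, shift p (ins_bound (show 2 + 3 = 4 + 1 from rfl) p) g ∈ N) ∧
    ∀ p : Fin 3, cable (show 3 + 2 = 4 + 1 from rfl) p g ∈ N := by
  constructor
  · rintro ⟨x, ⟨⟨⟨⟨h1, h2⟩, h3⟩, h4⟩, h5⟩, rfl⟩
    exact ⟨x.2, fun p => by fin_cases p; exacts [h1, h5],
      fun p => by fin_cases p; exacts [h2, h3, h4]⟩
  · rintro ⟨h, h1, h2⟩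
    exact ⟨⟨g, h⟩, ⟨⟨⟨⟨h1 0, h2 0⟩, h2 1⟩, h2 2⟩, h1 1⟩, rfl⟩

theorem mem_NPB2 {N : Subgroup (B 4)} {g : B 2} : g ∈ NPB2 N ↔ g ∈ PB 2 ∧
    (∀ p : Fin 2, shift p (ins_bound (show 2 + 2 = 3 + 1 from rfl) p) g ∈ NPB3 N) ∧
    ∀ p : Fin 2, cable (show 2 + 2 = 3 + 1 from rfl) p g ∈ NPB3 N := by
  constructor
  · rintro ⟨x, ⟨⟨⟨h1, h2⟩, h3⟩, h4⟩, rfl⟩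
    exact ⟨x.2, fun p => by fin_cases p; exacts [h1, h4],
      fun p => by fin_cases p; exacts [h2, h3]⟩
  · rintro ⟨h, h1, h2⟩
    exact ⟨⟨g, h⟩, ⟨⟨⟨h1 0, h2 0⟩, h2 1⟩, h1 1⟩, rfl⟩

theorem cable_conj {n m k : ℕ} (h : n + m = k + 1) (p : Fin n) (g x : B n) (hx : rho n x = 1) :
    cable h p (g * x * g⁻¹) =
      cable h ((rho n g)⁻¹ p) g * cable h ((rho n g)⁻¹ p) x * (cable h ((rho n g)⁻¹ p) g)⁻¹ := by
  rw [cable_mul, cable_mul, cable_inv, map_inv, hx, Equiv.Perm.one_apply]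

theorem NPB_le {N : Subgroup (B 4)} (hN : IsNFI N) (n : ℕ) : NPB N n ≤ PB n := by
  match n with
  | 0 | 1 | _ + 5 => exact bot_le
  | 2 => exact fun _ h => (mem_NPB2.1 h).1
  | 3 => exact fun _ h => (mem_NPB3.1 h).1
  | 4 => exact hN.2.2

theorem NPB3_normal {N : Subgroup (B 4)} (hN : IsNFI N) : (NPB3 N).Normal := ⟨fun x hx g => by
  rw [mem_NPB3] at hx ⊢
  have hP : (PB 3).Normal := MonoidHom.normal_ker _
  refine ⟨hP.conj_mem x hx.1 g, fun p => ?_, fun p => ?_⟩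
  · rw [map_mul, map_mul, map_inv]; exact hN.1.conj_mem _ (hx.2.1 p) _
  · rw [cable_conj _ _ _ _ (mem_PB.1 hx.1)]; exact hN.1.conj_mem _ (hx.2.2 _) _⟩

theorem NPB2_normal {N : Subgroup (B 4)} (hN : IsNFI N) : (NPB2 N).Normal := ⟨fun x hx g => by
  rw [mem_NPB2] at hx ⊢
  have hP : (PB 2).Normal := MonoidHom.normal_ker _
  have hN3 := NPB3_normal hN
  refine ⟨hP.conj_mem x hx.1 g, fun p => ?_, fun p => ?_⟩
  · rw [map_mul, map_mul, map_inv]; exact hN3.conj_mem _ (hx.2.1 p) _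
  · rw [cable_conj _ _ _ _ (mem_PB.1 hx.1)]; exact hN3.conj_mem _ (hx.2.2 _) _⟩

instance NPB_normal (N : NFI) (n : ℕ) : (NPB N.1 n).Normal := by
  match n with
  | 0 | 1 | _ + 5 => exact (inferInstance : (⊥ : Subgroup (B _)).Normal)
  | 2 => exact NPB2_normal N.2
  | 3 => exact NPB3_normal N.2
  | 4 => exact N.2.1

theorem cable_mem (N : NFI) {n m k : Arity} (h : (n : ℕ) + m = k + 1) (p : Fin n) {x : B n}
    (hx : x ∈ NPB N.1 n) : cable h p x ∈ NPB N.1 k := by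
  obtain ⟨n, hn⟩ := n
  obtain ⟨m, hm⟩ := m
  obtain ⟨k, hk⟩ := k
  simp only at h p x hx ⊢
  rcases Nat.eq_or_lt_of_le hm.1 with rfl | hm1
  · obtain rfl : n = k := by omega
    rwa [cable_unit]
  rcases Nat.eq_or_lt_of_le hn.1 with rfl | hn1
  · rw [B_one_eq x, cable_one]; exact one_mem _
  obtain ⟨rfl, rfl, rfl⟩ | ⟨rfl, rfl, rfl⟩ | ⟨rfl, rfl, rfl⟩ :
    (n = 2 ∧ m = 2 ∧ k = 3) ∨ (n = 3 ∧ m = 2 ∧ k = 4) ∨ (n = 2 ∧ m = 3 ∧ k = 4) := by omega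
  · exact (mem_NPB2.1 hx).2.2 p
  · exact (mem_NPB3.1 hx).2.2 p
  · have := (mem_NPB3.1 ((mem_NPB2.1 hx).2.2 p)).2.2 ⟨p, by omega⟩
    rwa [cable_cable (show 2 + 2 = 3 + 1 from rfl) (show 3 + 2 = 4 + 1 from rfl)
      (show 2 + 2 = 3 + 1 from rfl) h p 0 ⟨p, by omega⟩ rfl] at this

theorem shift_mem (N : NFI) {n m k : Arity} (h : (n : ℕ) + m = k + 1) (p : Fin n) {x : B m}
    (hx : x ∈ NPB N.1 m) : shift p (ins_bound h p) x ∈ NPB N.1 k := by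
  obtain ⟨n, hn⟩ := n
  obtain ⟨m, hm⟩ := m
  obtain ⟨k, hk⟩ := k
  simp only at h p x hx ⊢
  rcases Nat.eq_or_lt_of_le hn.1 with rfl | hn1
  · obtain rfl : m = k := by omega
    rwa [shift_zero]
  rcases Nat.eq_or_lt_of_le hm.1 with rfl | hm1
  · rw [B_one_eq x, map_one]; exact one_mem _
  obtain ⟨rfl, rfl, rfl⟩ | ⟨rfl, rfl, rfl⟩ | ⟨rfl, rfl, rfl⟩ :
    (n = 2 ∧ m = 2 ∧ k = 3) ∨ (n = 2 ∧ m = 3 ∧ k = 4) ∨ (n = 3 ∧ m = 2 ∧ k = 4) := by omega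
  · exact (mem_NPB2.1 hx).2.1 p
  · exact (mem_NPB3.1 hx).2.1 p
  · have key : ∀ q q' : Fin 2, (p : ℕ) = q + q' →
        shift p (ins_bound h p) x ∈ NPB N.1 4 := fun q q' e => by
      have := (mem_NPB3.1 ((mem_NPB2.1 hx).2.1 q')).2.1 q
      rwa [shift_shift _ _ (ins_bound h p) e] at this
    rcases (show (p : ℕ) = 0 ∨ (p : ℕ) = 1 ∨ (p : ℕ) = 2 by omega) with e | e | e
    · exact key 0 0 e
    · exact key 0 1 e
    · exact key 1 1 e

/-- The equivalence relation `∼_N`: two morphisms `γ, γ'` of `PaB(n)` are equivalent if they have the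
same source and target and `𝔬𝔲(γ⁻¹ · γ') ∈ N_{PBₙ}`. -/
def simN (N : NFI) : PaB.CompatibleEquiv where
  rel n :=
    { r := fun γ γ' : PaBMor n =>
        γ.src = γ'.src ∧ γ.tgt = γ'.tgt ∧ γ.braid⁻¹ * γ'.braid ∈ NPB N.1 n
      iseqv :=
        { refl := fun γ => ⟨rfl, rfl, by rw [inv_mul_cancel]; exact one_mem _⟩
          symm := fun h => ⟨h.1.symm, h.2.1.symm, by
            have := inv_mem h.2.2
            rwa [mul_inv_rev, inv_inv] at this⟩
          trans := fun h h' => ⟨h.1.trans h'.1, h.2.1.trans h'.2.1, by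
            have := mul_mem h.2.2 h'.2.2
            rwa [mul_assoc, mul_inv_cancel_left] at this⟩ } }
  src_eq h := h.1
  tgt_eq h := h.2.1
  comp {n} γ γ' η η' e e' h h' := ⟨h'.1, h.2.1, by
    change (γ.braid * η.braid)⁻¹ * (γ'.braid * η'.braid) ∈ NPB N.1 n
    have := mul_mem ((NPB_normal N n).conj_mem _ h.2.2 η.braid⁻¹) h'.2.2
    rw [inv_inv] at this
    convert this using 1
    group⟩
  act {n} θ γ γ' := by
    have hob : ∀ x y : PaBOb n, PaB.actOb θ x = PaB.actOb θ y ↔ x = y := fun x y =>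
      ⟨fun e => by
        have e₁ := congrArg (fun z : PaBOb n => z.shape) e
        have e₂ := congrArg (fun z : PaBOb n => z.perm) e
        exact PaBOb.ext e₁ (mul_left_cancel (a := θ) e₂), fun e => by rw [e]⟩
    change _ ↔ PaB.actOb θ _ = PaB.actOb θ _ ∧ PaB.actOb θ _ = PaB.actOb θ _ ∧ _
    rw [hob, hob]
    rfl
  ins_left {n m k} h i γ γ' η r := by
    refine ⟨congrArg (fun x => PaBOb.ins h i x η.src) r.1,
      congrArg (fun x => PaBOb.ins h i x η.tgt) r.2.1, ?_⟩
    change (cable h (γ.src.perm⁻¹ i) γ.braid * shift _ (ins_bound h _) η.braid)⁻¹ *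
      (cable h (γ'.src.perm⁻¹ i) γ'.braid * shift _ (ins_bound h _) η.braid) ∈ NPB N.1 k
    rw [← r.1]
    generalize γ.src.perm⁻¹ i = p
    have hp := mem_PB.1 (NPB_le N.2 n r.2.2)
    have e : cable h p γ'.braid = cable h p γ.braid * cable h p (γ.braid⁻¹ * γ'.braid) := by
      conv_lhs => rw [← mul_inv_cancel_left γ.braid γ'.braid, cable_mul, hp]
      rfl
    have := (NPB_normal N k).conj_mem _ (cable_mem N h p r.2.2)
      (shift p (ins_bound h p) η.braid)⁻¹
    rw [e]
    convert this using 1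
    group
  ins_right {n m k} h i γ η η' r := by
    refine ⟨congrArg (fun x => PaBOb.ins h i γ.src x) r.1,
      congrArg (fun x => PaBOb.ins h i γ.tgt x) r.2.1, ?_⟩
    change (cable h (γ.src.perm⁻¹ i) γ.braid * shift _ (ins_bound h _) η.braid)⁻¹ *
      (cable h (γ.src.perm⁻¹ i) γ.braid * shift _ (ins_bound h _) η'.braid) ∈ NPB N.1 k
    have := shift_mem N h (γ.src.perm⁻¹ i) r.2.2
    rw [map_mul, map_inv] at this
    convert this using 1
    group

/-- The truncated operad `PaB^{≤4}/∼_N`. -/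
def Quo (N : NFI) : TruncatedOperad := PaB.quotient (simN N)

/-- The canonical projection `PaB^{≤4} → PaB^{≤4}/∼_N`. -/
def projN (N : NFI) : PaB ⟶ Quo N := PaB.proj (simN N)

/-! ## GT-pairs and GT-shadows -/

/-- The map `𝔬𝔲 : PaB(n)/∼_N → B_n/N_{PBₙ}`. -/
def ouQ (N : NFI) {n : Arity} : (Quo N).Mor n → B n ⧸ NPB N.1 n :=
  Quotient.lift (fun γ : PaBMor n => (QuotientGroup.mk γ.braid : B n ⧸ NPB N.1 n))
    fun _ _ h => QuotientGroup.eq.2 h.2.2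

theorem mm_mul (n : Arity) (g g' : B n) (e) :
    mm n (g * g') = PaB.comp (PaB.act (rho n g')⁻¹ (mm n g)) (mm n g') e := by
  refine PaBMor.ext rfl (PaBOb.ext rfl ?_) rfl
  change (rho n (g * g'))⁻¹ = (rho n g')⁻¹ * (rho n g)⁻¹
  rw [map_mul, mul_inv_rev]

theorem ouQ_comp (N : NFI) {n : Arity} : ∀ (a b : (Quo N).Mor n) (e),
    ouQ N ((Quo N).comp a b e) = ouQ N a * ouQ N b := by
  rintro ⟨γ⟩ ⟨η⟩ e; rfl

theorem ouQ_act (N : NFI) {n : Arity} (θ : Equiv.Perm (Fin n)) : ∀ a : (Quo N).Mor n,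
    ouQ N ((Quo N).act θ a) = ouQ N a := by
  rintro ⟨γ⟩; rfl

/-- The homomorphism `T^{Bₙ} = 𝔬𝔲 ∘ T ∘ 𝔪` induced by a morphism of truncated operads. -/
def TB {N : NFI} (T : PaB ⟶ Quo N) (n : Arity) : B n →* B n ⧸ NPB N.1 n :=
  MonoidHom.mk' (fun g => ouQ N (T.mor (mm n g))) fun g g' => by
    have e : PaB.src (PaB.act (rho n g')⁻¹ (mm n g)) = PaB.tgt (mm n g') :=
      PaBOb.ext rfl (mul_one _)
    have e' : (Quo N).src (T.mor (PaB.act (rho n g')⁻¹ (mm n g))) =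
        (Quo N).tgt (T.mor (mm n g')) := by rw [T.map_src, T.map_tgt, e]
    rw [mm_mul n g g' e, T.map_comp _ _ e e', ouQ_comp, T.map_act, ouQ_act]

/-- The group `PB_n/N_{PBₙ}`, as a subgroup of `B_n/N_{PBₙ}`. -/
def PBq (N : NFI) (n : ℕ) : Subgroup (B n ⧸ NPB N.1 n) :=
  (PB n).map (QuotientGroup.mk' (NPB N.1 n))

theorem ouQ_mem (N : NFI) {n : Arity} : ∀ a : (Quo N).Mor n, (Quo N).src a = (Quo N).tgt a →
    ouQ N a ∈ PBq N n := by
  rintro ⟨γ⟩ e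
  change γ.src = γ.tgt at e
  exact ⟨γ.braid, mem_PB.2 (by rw [γ.rho_braid, e, inv_mul_cancel]), rfl⟩

/-- The homomorphism `T^{PBₙ} : PB_n → PB_n/N_{PBₙ}`, the restriction of `T^{Bₙ}`. -/
def TPB {N : NFI} (T : PaB ⟶ Quo N) (n : Arity) : PB n →* PBq N n :=
  ((TB T n).comp (PB n).subtype).codRestrict (PBq N n) fun g => ouQ_mem N _ (by
    rw [T.map_src, T.map_tgt]
    refine congrArg _ (PaBOb.ext rfl ?_)
    change 1 = (rho n g)⁻¹
    rw [mem_PB.1 g.2, inv_one])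

/-- The index `N_ord` of `N_{PB₂}` in `PB₂`. -/
noncomputable def Nord (N : NFI) : ℕ := (NPB N.1 2).relIndex (PB 2)

/-- The set `ℤ/N_ord × PB₃/N_{PB₃}`. -/
abbrev Pair (N : NFI) : Type := ZMod (Nord N) × (PB 3 ⧸ (NPB N.1 3).subgroupOf (PB 3))

/-- The element of `ℤ/N_ord × PB₃/N_{PB₃}` represented by `(m, f)`. -/
noncomputable def pairMk (N : NFI) (m : ℤ) (f : PB 3) : Pair N := ((m : ZMod (Nord N)), QuotientGroup.mk f)

/-- The hexagon relations and the pentagon relation for `(m, f)`. Here `σ₁ = s 3 0`, `σ₂ = s 3 1`,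
`x₁₂ = σ₁²`, `x₂₃ = σ₂²` and `x₁₃ = σ₂ σ₁² σ₂⁻¹`. -/
def IsGTPair (N : NFI) (m : ℤ) (f : PB 3) : Prop :=
  let σ₁ : B 3 := s 3 0
  let σ₂ : B 3 := s 3 1
  let x₁₂ : B 3 := σ₁ ^ 2
  let x₂₃ : B 3 := σ₂ ^ 2
  let x₁₃ : B 3 := σ₂ * σ₁ ^ 2 * σ₂⁻¹
  (QuotientGroup.mk (σ₁ * x₁₂ ^ m * (f : B 3)⁻¹ * (σ₂ * x₂₃ ^ m) * f) : B 3 ⧸ NPB N.1 3) =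
      QuotientGroup.mk ((f : B 3)⁻¹ * (σ₁ * σ₂) * (x₁₃ * x₂₃) ^ m) ∧
  (QuotientGroup.mk ((f : B 3)⁻¹ * (σ₂ * x₂₃ ^ m) * f * (σ₁ * x₁₂ ^ m)) : B 3 ⧸ NPB N.1 3) =
      QuotientGroup.mk (σ₂ * σ₁ * (x₁₂ * x₁₃) ^ m * f) ∧
  (QuotientGroup.mk ((phi234 f * phi1_23_4 f * phi123 f : PB 4) : B 4) : B 4 ⧸ NPB N.1 4) =
      QuotientGroup.mk ((phi1_2_34 f * phi12_3_4 f : PB 4) : B 4)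

/-- The set `GT_pr(N)` of GT-pairs. -/
def GTpr (N : NFI) : Set (Pair N) := {p | ∃ (m : ℤ) (f : PB 3), pairMk N m f = p ∧ IsGTPair N m f}

/-- The generator `x₁₂` of `PB₂`. -/
def x12 : PB 2 := ⟨s 2 0 ^ 2, by
  rw [mem_PB, map_pow, rho_s (by omega)]
  decide⟩

/-- The morphism `α · 𝔪(f)` for a pure braid `f`. -/
def alphaMul (f : PB 3) : PaB.Mor ar3 :=
  PaB.comp alpha (mm ar3 f) (PaBOb.ext rfl (by
    change 1 = (rho 3 f)⁻¹
    rw [mem_PB.1 f.2, inv_one]))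

/-- The morphism `β · 𝔪(g)` for a pure braid `g`. -/
def betaMul (g : PB 2) : PaB.Mor ar2 :=
  PaB.comp beta (mm ar2 g) (PaBOb.ext rfl (by
    change 1 = (rho 2 g)⁻¹
    rw [mem_PB.1 g.2, inv_one]))

/-- The morphism `T` of truncated operads satisfies `T(α) = [α · 𝔪(f)]` and
`T(β) = [β · 𝔪(x₁₂^m)]`, where `(m, f)` represents `p`. -/
def Realizes (N : NFI) (p : Pair N) (T : PaB ⟶ Quo N) : Prop :=
  ∃ (m : ℤ) (f : PB 3), pairMk N m f = p ∧
    T.mor alpha = (projN N).mor (alphaMul f) ∧ T.mor beta = (projN N).mor (betaMul (x12 ^ m))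

instance (N : NFI) : Nonempty (PaB ⟶ Quo N) := ⟨projN N⟩

/-- The morphism `T_{m,f}` of truncated operads determined by a GT-pair `p = [(m, f)]`. -/
noncomputable def Tmf (N : NFI) (p : Pair N) : PaB ⟶ Quo N := Classical.epsilon (Realizes N p)

/-- The set `GT(N)` of GT-shadows. -/
def GT (N : NFI) : Set (Pair N) := {p | p ∈ GTpr N ∧
  Function.Surjective (TPB (Tmf N p) ar4) ∧ Function.Surjective (TPB (Tmf N p) ar3) ∧
  Function.Surjective (TPB (Tmf N p) ar2)}

/-- The kernel of `T^{PB₄}_{m,f}`, as a subgroup of `B₄`. -/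
noncomputable def sourceOf (N : NFI) (p : Pair N) : Subgroup (B 4) :=
  (TPB (Tmf N p) ar4).ker.map (PB 4).subtype

/-- The set of GT-shadows in `GT(N)` with source `N'`. -/
abbrev ShadowHom (N' N : NFI) : Type := {p : Pair N // p ∈ GT N ∧ sourceOf N p = N'.1}

/-- The set of isomorphisms of truncated operads `PaB^{≤4}/∼_{N'} → PaB^{≤4}/∼_N` that act as the
identity on objects. -/
abbrev Isom (N' N : NFI) : Type :=
  {e : Quo N' ≅ Quo N // ∀ (n : Arity) (x : PaB.Ob n), e.hom.ob x = x}

end GTShadows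

open GTShadows CategoryTheory

namespace GTShadows

/-! ## Cabling and juxtaposition modulo `N` -/

/-! A morphism `T` from `PaB` to its quotient that fixes objects is described by two families: the
homomorphisms it induces on the groups `B n`, and the images of the trivial braids from the
left-normed tree to the other trees, the associators of `T`. Up to relabelling, every morphism of
`PaB` is an associator times `mm n g` times an inverse associator, so its image has the underlying
class asc · hom · asc⁻¹ (`ouQ_mor`). Compatibility with insertion becomes three laws, for grafting
of trees, for cabling and for juxtaposition. These are the axioms of `CoherentData`;
`CoherentData.toHom` and `CoherentData.ofHom` pass between data and morphisms.

Coherent data amount in turn to a solution of `HexPent`: a class `a` (the image of the braiding) and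
a class `f` (the image of the associator). The laws for σ₁ in arity three are the hexagons, and
building the tree 1(2(34)) in two ways gives the pentagon (`CoherentData.hexPent`). Conversely,
Artin's presentation allows homomorphisms to be defined on generators: each σᵢ is carried to a tree
in which its two strands share a vertex, `a` is inserted there, and the move is undone. The braid
relations follow from the first hexagon, from sliding a braid along a cable, and from the pentagon.
The laws need checking only on generators and on the few trees with at most four leaves, so no
general coherence theorem enters (`HexPent.coherentData`).

`isGTPair_iff` identifies GT-pairs with such solutions having `a` the class of σ₁x₁₂^m. The group `B
2` is cyclic and `a` lies over the transposition, so every solution has this form, with `m`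
determined modulo `Nord N`. Thus GT-pairs correspond to the morphisms that fix objects
(`exists_realizes`, `exists_pair`, `realizes_unique`, `pair_unique`), which contains (0).

For (1), the laws show that on pure braids an insertion of an image is conjugate to the image of the
insertion. Since `NPB3` and `NPB2` are defined by insertions, the kernels in arities three and two
arise from the kernel in arity four by the same recipe (`CoherentData.mem_NPB_ker`). For (2),
surjectivity on pure braids extends to all braids because `T` covers the map to the symmetric group,
hence to all morphisms, and `T` descends to a bijection (`exists_isom`). For (3), an isomorphism
preceded by the projection is a surjective morphism fixing objects; it therefore comes from a
GT-shadow, whose source is read off from the morphisms that are identified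
(`shadowIsom_surjective`). The groupoid in (4) is transported along this bijection. -/

/-- The homomorphism from `B_n/N_{PBₙ}` to the symmetric group induced by `rho`. -/
def rhoQ (N : NFI) (n : ℕ) : B n ⧸ NPB N.1 n →* Equiv.Perm (Fin n) :=
  QuotientGroup.lift _ (rho n) fun _ h => mem_PB.1 (NPB_le N.2 n h)

@[simp]
theorem rhoQ_mk (N : NFI) {n : ℕ} (g : B n) : rhoQ N n (QuotientGroup.mk g) = rho n g := rfl

/-- The map `B_n/N_{PBₙ} → B_k/N_{PBₖ}` induced by cabling the strand that originates at `p`. -/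
def cableQ (N : NFI) {n m k : ℕ} (h : n + m = k + 1) (hm : 1 ≤ m) (hk : k ≤ 4) (p : Fin n) :
    B n ⧸ NPB N.1 n → B k ⧸ NPB N.1 k :=
  Quotient.map' (cable h p) fun a b hab => by
    rw [QuotientGroup.leftRel_apply] at hab ⊢
    have hp := mem_PB.1 (NPB_le N.2 n hab)
    -- The difference of two representatives is pure, so it returns the cabled strand to its
    -- position and can be split off without changing `p`.
    have e : cable h p b = cable h p a * cable h p (a⁻¹ * b) := by
      conv_lhs => rw [← mul_inv_cancel_left a b, cable_mul, hp]
      rfl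
    rw [e, inv_mul_cancel_left]
    exact cable_mem N (n := ⟨n, by have := p.2; omega⟩) (m := ⟨m, by have := p.2; omega⟩)
      (k := ⟨k, by have := p.2; omega⟩) h p hab

/-- The homomorphism `B_m/N_{PBₘ} → B_k/N_{PBₖ}` induced by juxtaposition with vertical strands. -/
def shiftQ (N : NFI) {n m k : ℕ} (h : n + m = k + 1) (hm : 1 ≤ m) (hk : k ≤ 4) (p : Fin n) :
    B m ⧸ NPB N.1 m →* B k ⧸ NPB N.1 k :=
  QuotientGroup.map _ _ (shift p (ins_bound h p)) fun _ hx =>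
    shift_mem N (n := ⟨n, by have := p.2; omega⟩) (m := ⟨m, by have := p.2; omega⟩)
      (k := ⟨k, by have := p.2; omega⟩) h p hx

section

variable {N : NFI} {n m k : ℕ} {h : n + m = k + 1} {hm : 1 ≤ m} {hk : k ≤ 4}

theorem cableQ_mk (p : Fin n) (g : B n) :
    cableQ N h hm hk p (QuotientGroup.mk g) = QuotientGroup.mk (cable h p g) := rfl

theorem shiftQ_mk (p : Fin n) (g : B m) :
    shiftQ N h hm hk p (QuotientGroup.mk g) = QuotientGroup.mk (shift p (ins_bound h p) g) := rfl

/-- Cabling is only a crossed homomorphism: the braid `b` acts first and carries the thickened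
strand to a new position, where `a` meets it. On pure braids it becomes multiplicative. -/
theorem cableQ_mul (p : Fin n) (a b : B n ⧸ NPB N.1 n) :
    cableQ N h hm hk p (a * b) = cableQ N h hm hk (rhoQ N n b p) a * cableQ N h hm hk p b := by
  obtain ⟨a, rfl⟩ := QuotientGroup.mk_surjective a
  obtain ⟨b, rfl⟩ := QuotientGroup.mk_surjective b
  exact congrArg QuotientGroup.mk (cable_mul h p a b)

@[simp]
theorem cableQ_one (p : Fin n) : cableQ N h hm hk p 1 = 1 :=
  congrArg QuotientGroup.mk (cable_one h p)

theorem cableQ_mul_of_pure (p : Fin n) (a : B n ⧸ NPB N.1 n) {b : B n ⧸ NPB N.1 n}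
    (hb : rhoQ N n b = 1) :
    cableQ N h hm hk p (a * b) = cableQ N h hm hk p a * cableQ N h hm hk p b := by
  rw [cableQ_mul, hb]; rfl

theorem cableQ_inv_of_pure (p : Fin n) {a : B n ⧸ NPB N.1 n} (ha : rhoQ N n a = 1) :
    cableQ N h hm hk p a⁻¹ = (cableQ N h hm hk p a)⁻¹ := by
  refine eq_inv_of_mul_eq_one_left ?_
  rw [← cableQ_mul_of_pure p _ ha, inv_mul_cancel, cableQ_one]

/-- A small braid inside the thick strand slides along that strand from its beginning to its end. -/
theorem cableQ_shiftQ_comm (p : Fin n) (a : B n ⧸ NPB N.1 n) (b : B m ⧸ NPB N.1 m) :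
    cableQ N h hm hk p a * shiftQ N h hm hk p b =
      shiftQ N h hm hk (rhoQ N n a p) b * cableQ N h hm hk p a := by
  obtain ⟨a, rfl⟩ := QuotientGroup.mk_surjective a
  obtain ⟨b, rfl⟩ := QuotientGroup.mk_surjective b
  exact congrArg QuotientGroup.mk
    (cable_shift_comm h p (rho n a p) (ins_bound h _) (ins_bound h _) a rfl b)

theorem cableQ_shiftQ_commute (p : Fin n) {a : B n ⧸ NPB N.1 n} (ha : rhoQ N n a = 1)
    (b : B m ⧸ NPB N.1 m) :
    Commute (cableQ N h hm hk p a) (shiftQ N h hm hk p b) := by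
  have := cableQ_shiftQ_comm (h := h) (hm := hm) (hk := hk) p a b
  rwa [ha] at this

theorem rhoQ_cableQ (p : Fin n) (a : B n ⧸ NPB N.1 n) :
    rhoQ N k (cableQ N h hm hk p a) = insPerm h p (rhoQ N n a) 1 := by
  obtain ⟨a, rfl⟩ := QuotientGroup.mk_surjective a
  exact rho_cable h p a

theorem rhoQ_shiftQ (p : Fin n) (a : B m ⧸ NPB N.1 m) :
    rhoQ N k (shiftQ N h hm hk p a) = insPerm h p 1 (rhoQ N m a) := by
  obtain ⟨a, rfl⟩ := QuotientGroup.mk_surjective a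
  exact rho_shift h p _ a

theorem rhoQ_cableQ_of_pure (p : Fin n) {a : B n ⧸ NPB N.1 n} (ha : rhoQ N n a = 1) :
    rhoQ N k (cableQ N h hm hk p a) = 1 := by
  rw [rhoQ_cableQ, ha, insPerm_one]

theorem rhoQ_shiftQ_of_pure (p : Fin n) {a : B m ⧸ NPB N.1 m} (ha : rhoQ N m a = 1) :
    rhoQ N k (shiftQ N h hm hk p a) = 1 := by
  rw [rhoQ_shiftQ, ha, insPerm_one]

theorem cableQ_unit {h : n + 1 = n + 1} {hm : 1 ≤ 1} {hk : n ≤ 4} (p : Fin n)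
    (a : B n ⧸ NPB N.1 n) : cableQ N h hm hk p a = a := by
  obtain ⟨a, rfl⟩ := QuotientGroup.mk_surjective a
  exact congrArg QuotientGroup.mk (cable_unit h p a)

theorem shiftQ_unit {h : 1 + m = m + 1} {hm : 1 ≤ m} {hk : m ≤ 4} (p : Fin 1)
    (a : B m ⧸ NPB N.1 m) : shiftQ N h hm hk p a = a := by
  obtain ⟨a, rfl⟩ := QuotientGroup.mk_surjective a
  exact congrArg QuotientGroup.mk (shift_zero _ a)

theorem quo_one_eq (a : B 1 ⧸ NPB N.1 1) : a = 1 := by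
  obtain ⟨a, rfl⟩ := QuotientGroup.mk_surjective a
  rw [B_one_eq a]; rfl

end

theorem cableQ_shiftQ_inner {N : NFI} {n m k a b c : ℕ} {h₁ : n + m = a + 1} {h₂ : a + k = b + 1}
    {h₃ : m + k = c + 1} {h₄ : n + c = b + 1} {hm : 1 ≤ m} {hk : 1 ≤ k} {hc : 1 ≤ c} {ha : a ≤ 4}
    {hb : b ≤ 4} {hc' : c ≤ 4} (p : Fin n) (q : Fin m) (r : Fin a) (hr : (r : ℕ) = p + q)
    (x : B m ⧸ NPB N.1 m) :
    cableQ N h₂ hk hb r (shiftQ N h₁ hm ha p x) =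
      shiftQ N h₄ hc hb p (cableQ N h₃ hk hc' q x) := by
  obtain ⟨x, rfl⟩ := QuotientGroup.mk_surjective x
  exact congrArg QuotientGroup.mk
    (cable_shift_inner h₁ h₂ h₃ p q r hr (ins_bound h₁ p) (ins_bound h₄ p) x)

theorem cableQ_shiftQ_outer {N : NFI} {n m k a a' b : ℕ} {h₁ : n + m = a + 1}
    {h₂ : a + k = b + 1} {h₂' : a' + m = b + 1} {hm : 1 ≤ m} {hk : 1 ≤ k} {ha : a ≤ 4}
    {hb : b ≤ 4} (p q : Fin n) (hpq : q ≠ p) (r : Fin a) (r' : Fin a')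
    (hr : (r : ℕ) = outv m p q) (hr' : (r' : ℕ) = outv k q p) (x : B m ⧸ NPB N.1 m) :
    cableQ N h₂ hk hb r (shiftQ N h₁ hm ha p x) = shiftQ N h₂' hm hb r' x := by
  obtain ⟨x, rfl⟩ := QuotientGroup.mk_surjective x
  refine congrArg QuotientGroup.mk ((cable_shift_outer h₁ h₂ p q hpq r hr (ins_bound h₁ p)
    (by rw [← hr']; exact ins_bound h₂' r') x).trans ?_)
  congr 1
  simp only [hr']

theorem shiftQ_shiftQ {N : NFI} {n m k a b c : ℕ} {h₁ : n + m = a + 1} {h₂ : k + a = b + 1}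
    {h₃ : c + m = b + 1} {hm : 1 ≤ m} {ha : 1 ≤ a} {ha' : a ≤ 4} {hb : b ≤ 4} (q : Fin n)
    (p : Fin k) (r : Fin c) (hr : (r : ℕ) = p + q) (x : B m ⧸ NPB N.1 m) :
    shiftQ N h₂ ha hb p (shiftQ N h₁ hm ha' q x) = shiftQ N h₃ hm hb r x := by
  obtain ⟨x, rfl⟩ := QuotientGroup.mk_surjective x
  exact congrArg QuotientGroup.mk
    (shift_shift (ins_bound h₁ q) (ins_bound h₂ p) (ins_bound h₃ r) hr x)

theorem cableQ_cableQ {N : NFI} {n m k a b c : ℕ} {h₁ : n + m = a + 1} {h₂ : a + k = b + 1}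
    {h₄ : n + c = b + 1} {hm : 1 ≤ m} {hk : 1 ≤ k} {hc : 1 ≤ c} {ha : a ≤ 4}
    {hb : b ≤ 4} (h₃ : m + k = c + 1) (p : Fin n) (q : Fin m) (r : Fin a)
    (hr : (r : ℕ) = p + q) (x : B n ⧸ NPB N.1 n) :
    cableQ N h₂ hk hb r (cableQ N h₁ hm ha p x) = cableQ N h₄ hc hb p x := by
  obtain ⟨x, rfl⟩ := QuotientGroup.mk_surjective x
  exact congrArg QuotientGroup.mk (cable_cable h₁ h₂ h₃ h₄ p q r hr x)

/-- The two blocks of strands are disjoint, so any generator of one has index at least two away from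
any generator of the other. -/
theorem shift_commute {a b k p q : ℕ} (hp : p + a ≤ k) (hq : q + b ≤ k) (hpq : p + a ≤ q)
    (x : B a) (y : B b) : Commute (shift p hp x) (shift q hq y) := by
  induction x using B_induction with
  | one => rw [map_one]; exact Commute.one_left _
  | gen i hi =>
    induction y using B_induction with
    | one => rw [map_one]; exact Commute.one_right _
    | gen j hj => rw [shift_s _ hi, shift_s _ hj]; exact s_comm k (by omega)
    | mul u v hu hv => rw [map_mul]; exact hu.mul_right hv
    | inv u hu => rw [map_inv]; exact hu.inv_right
  | mul u v hu hv => rw [map_mul]; exact hu.mul_left hv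
  | inv u hu => rw [map_inv]; exact hu.inv_left

theorem shiftQ_commute {N : NFI} {n n' m m' k : ℕ} {h : n + m = k + 1} {h' : n' + m' = k + 1}
    {hm : 1 ≤ m} {hm' : 1 ≤ m'} {hk : k ≤ 4} (p : Fin n) (q : Fin n') (hpq : (p : ℕ) + m ≤ q)
    (x : B m ⧸ NPB N.1 m) (y : B m' ⧸ NPB N.1 m') :
    Commute (shiftQ N h hm hk p x) (shiftQ N h' hm' hk q y) := by
  obtain ⟨x, rfl⟩ := QuotientGroup.mk_surjective x
  obtain ⟨y, rfl⟩ := QuotientGroup.mk_surjective y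
  exact congrArg QuotientGroup.mk
    (shift_commute (ins_bound h p) (ins_bound h' q) hpq x y).eq

/-- This is the definition of `NPB3` as an intersection of preimages, restated as a detection
principle: classes in arity three are seen by their insertions into arity four. It lets kernels be
compared across arities. -/
theorem quo_three_eq_one_iff {N : NFI} (x : B 3 ⧸ NPB N.1 3) : x = 1 ↔ rhoQ N 3 x = 1 ∧
    (∀ p : Fin 2, shiftQ N (show 2 + 3 = 4 + 1 from rfl) (by omega) le_rfl p x = 1) ∧
    ∀ p : Fin 3, cableQ N (show 3 + 2 = 4 + 1 from rfl) (by omega) le_rfl p x = 1 := by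
  obtain ⟨x, rfl⟩ := QuotientGroup.mk_surjective x
  simp only [shiftQ_mk, cableQ_mk, QuotientGroup.eq_one_iff, rhoQ_mk]
  exact mem_NPB3

theorem quo_two_eq_one_iff {N : NFI} (x : B 2 ⧸ NPB N.1 2) : x = 1 ↔ rhoQ N 2 x = 1 ∧
    (∀ p : Fin 2, shiftQ N (show 2 + 2 = 3 + 1 from rfl) (by omega) (by omega) p x = 1) ∧
    ∀ p : Fin 2, cableQ N (show 2 + 2 = 3 + 1 from rfl) (by omega) (by omega) p x = 1 := by
  obtain ⟨x, rfl⟩ := QuotientGroup.mk_surjective x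
  simp only [shiftQ_mk, cableQ_mk, QuotientGroup.eq_one_iff, rhoQ_mk]
  exact mem_NPB2

/-! ## Morphisms of the quotient -/

/-- Equalities of morphisms in the quotient are reduced to equalities in the groups of braid
classes. -/
theorem quo_ext {N : NFI} {n : Arity} : ∀ {a b : (Quo N).Mor n}, (Quo N).src a = (Quo N).src b →
    (Quo N).tgt a = (Quo N).tgt b → ouQ N a = ouQ N b → a = b := by
  rintro ⟨a⟩ ⟨b⟩ h₁ h₂ h₃
  exact Quotient.sound ⟨h₁, h₂, QuotientGroup.eq.1 h₃⟩

/-- The permutation of an object of the quotient, sending positions to labels. -/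
def obPerm {N : NFI} {n : Arity} (x : (Quo N).Ob n) : Equiv.Perm (Fin n) := PaBOb.perm x

theorem rhoQ_ouQ (N : NFI) {n : Arity} : ∀ a : (Quo N).Mor n,
    rhoQ N n (ouQ N a) = (obPerm ((Quo N).tgt a))⁻¹ * obPerm ((Quo N).src a) := by
  rintro ⟨a⟩; exact a.rho_braid

theorem ouQ_ident (N : NFI) {n : Arity} (x : (Quo N).Ob n) : ouQ N ((Quo N).ident x) = 1 := rfl

theorem ouQ_ins (N : NFI) {n m k : Arity} (h : (n : ℕ) + m = k + 1) (i : Fin n) :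
    ∀ (a : (Quo N).Mor n) (b : (Quo N).Mor m), ouQ N ((Quo N).ins h i a b) =
      cableQ N h m.2.1 k.2.2 ((obPerm ((Quo N).src a))⁻¹ i) (ouQ N a) *
        shiftQ N h m.2.1 k.2.2 ((obPerm ((Quo N).src a))⁻¹ i) (ouQ N b) := by
  rintro ⟨a⟩ ⟨b⟩; rfl

/-- The morphism of the quotient with given source, target and class of braids. -/
noncomputable def quoMk (N : NFI) {n : Arity} (x y : PaBOb n) (c : B n ⧸ NPB N.1 n)
    (hc : rhoQ N n c = y.perm⁻¹ * x.perm) : (Quo N).Mor n :=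
  (projN N).mor (n := n) (⟨x, y, c.out, by
    rw [← rhoQ_mk N, QuotientGroup.out_eq', hc]⟩ : PaBMor n)

theorem ouQ_quoMk (N : NFI) {n : Arity} (x y : PaBOb n) (c : B n ⧸ NPB N.1 n) (hc) :
    ouQ N (quoMk N x y c hc) = c := QuotientGroup.out_eq' c

/-! ## Morphisms `PaB → PaB/∼_N` in terms of braids -/

/-- The data that determine a morphism `PaB → PaB/∼_N` acting as the identity on objects: `hom n`
is the induced homomorphism on braids, and `asc n x` is the image of the trivial braid, viewed as a
morphism from the left-normed tree to the tree `x`. -/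
structure CoherentData (N : NFI) where
  hom : ∀ n : ℕ, B n →* B n ⧸ NPB N.1 n
  asc : ∀ n : ℕ, FreeMagma Unit → B n ⧸ NPB N.1 n
  rho_hom : ∀ {n : ℕ}, 1 ≤ n → n ≤ 4 → ∀ g, rhoQ N n (hom n g) = rho n g
  rho_asc : ∀ {n : ℕ}, 1 ≤ n → n ≤ 4 → ∀ x : FreeMagma Unit, x.length = n →
    rhoQ N n (asc n x) = 1
  asc_leftComb : ∀ {n : ℕ}, n + 1 ≤ 4 → asc (n + 1) (leftComb n) = 1
  asc_graft : ∀ {n m k : ℕ} (h : n + m = k + 1) (hm : 1 ≤ m) (hk : k ≤ 4) (p : Fin n)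
    (x y : FreeMagma Unit), x.length = n → y.length = m → asc k (graft x p y) =
      cableQ N h hm hk p (asc n x) * shiftQ N h hm hk p (asc m y) *
        asc k (graft (leftComb (n - 1)) p (leftComb (m - 1)))
  hom_cable : ∀ {n m k : ℕ} (h : n + m = k + 1) (hm : 1 ≤ m) (hk : k ≤ 4) (p : Fin n) (g : B n),
    asc k (graft (leftComb (n - 1)) (rho n g p : Fin n) (leftComb (m - 1))) *
        hom k (cable h p g) =
      cableQ N h hm hk p (hom n g) * asc k (graft (leftComb (n - 1)) p (leftComb (m - 1)))
  hom_shift : ∀ {n m k : ℕ} (h : n + m = k + 1) (hm : 1 ≤ m) (hk : k ≤ 4) (p : Fin n) (g : B m),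
    asc k (graft (leftComb (n - 1)) p (leftComb (m - 1))) * hom k (shift p (ins_bound h p) g) =
      shiftQ N h hm hk p (hom m g) * asc k (graft (leftComb (n - 1)) p (leftComb (m - 1)))

namespace CoherentData

variable {N : NFI} (D : CoherentData N)

/-- The class of braids assigned to a morphism of `PaB`. -/
def val {n : ℕ} (γ : PaBMor n) : B n ⧸ NPB N.1 n :=
  D.asc n γ.tgt.shape * D.hom n γ.braid * (D.asc n γ.src.shape)⁻¹

theorem rho_val {n : ℕ} (h₁ : 1 ≤ n) (h₂ : n ≤ 4) (γ : PaBMor n) :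
    rhoQ N n (D.val γ) = γ.tgt.perm⁻¹ * γ.src.perm := by
  rw [val, map_mul, map_mul, map_inv, D.rho_asc h₁ h₂ _ γ.tgt.len, D.rho_asc h₁ h₂ _ γ.src.len,
    D.rho_hom h₁ h₂, inv_one, mul_one, one_mul, γ.rho_braid]

/-- The three laws in `CoherentData` are what this identity requires: grafting splits the outer
associators, and the laws for cabling and juxtaposition rewrite the two factors of the inserted
braid. The comparison associators between grafted left-normed trees then cancel, and sliding braids
along the cable puts the factors in order. -/
theorem val_ins {n m k : ℕ} (h : n + m = k + 1) (hm : 1 ≤ m) (hk : k ≤ 4) (i : Fin n)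
    (γ : PaBMor n) (γ' : PaBMor m) :
    D.val (γ.ins h i γ') = cableQ N h hm hk (γ.src.perm⁻¹ i) (D.val γ) *
      shiftQ N h hm hk (γ.src.perm⁻¹ i) (D.val γ') := by
  have hpos := γ.pos_tgt i
  have A₁ := D.asc_graft h hm hk (γ.tgt.perm⁻¹ i) _ _ γ.tgt.len γ'.tgt.len
  have A₂ := D.asc_graft h hm hk (γ.src.perm⁻¹ i) _ _ γ.src.len γ'.src.len
  have e : D.val (γ.ins h i γ') =
      D.asc k (graft γ.tgt.shape (γ.tgt.perm⁻¹ i : Fin n) γ'.tgt.shape) *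
        D.hom k (cable h (γ.src.perm⁻¹ i) γ.braid *
          shift (γ.src.perm⁻¹ i : Fin n) (ins_bound h _) γ'.braid) *
        (D.asc k (graft γ.src.shape (γ.src.perm⁻¹ i : Fin n) γ'.src.shape))⁻¹ := rfl
  rw [e, A₁, A₂, map_mul, val, val]
  clear e A₁ A₂
  rw [← hpos]
  generalize γ.src.perm⁻¹ i = p
  have hn : 1 ≤ n := by have := p.2; omega
  have hn4 : n ≤ 4 := by omega
  have Bc := D.hom_cable h hm hk p γ.braid
  have Cs := D.hom_shift h hm hk p γ'.braid
  have ps := D.rho_asc hn hn4 _ γ.src.len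
  have pt := D.rho_asc hn hn4 _ γ.tgt.len
  have psi : rhoQ N n (D.asc n γ.src.shape)⁻¹ = 1 := by rw [map_inv, ps, inv_one]
  have c₁ := cableQ_shiftQ_comm (N := N) (h := h) (hm := hm) (hk := hk) p (D.hom n γ.braid)
    (D.asc m γ'.tgt.shape)
  rw [D.rho_hom hn hn4] at c₁
  have c₂ := fun z => (cableQ_shiftQ_commute (N := N) (h := h) (hm := hm) (hk := hk) p ps z).eq
  rw [cableQ_mul_of_pure p _ psi, cableQ_mul, cableQ_inv_of_pure p ps, D.rho_hom hn hn4,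
    map_mul, map_mul, map_inv]
  generalize cableQ N h hm hk p (D.asc n γ.src.shape) = X at *
  generalize cableQ N h hm hk (rho n γ.braid p) (D.asc n γ.tgt.shape) = Y at *
  generalize D.asc k (graft (leftComb (n - 1)) p (leftComb (m - 1))) = G at *
  generalize D.asc k (graft (leftComb (n - 1)) (rho n γ.braid p : Fin n) (leftComb (m - 1))) = G'
    at *
  generalize D.hom k (cable h p γ.braid) = u at *
  generalize D.hom k (shift p (ins_bound h p) γ'.braid) = v at *
  generalize cableQ N h hm hk p (D.hom n γ.braid) = w at *
  have c₃ := c₂ (D.asc m γ'.src.shape)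
  have c₄ := c₂ (D.hom m γ'.braid)
  have c₅ := c₂ (D.asc m γ'.tgt.shape)
  generalize shiftQ N h hm hk p (D.asc m γ'.tgt.shape) = y at *
  generalize shiftQ N h hm hk p (D.asc m γ'.src.shape) = x at *
  generalize shiftQ N h hm hk (rho n γ.braid p) (D.asc m γ'.tgt.shape) = y' at *
  generalize shiftQ N h hm hk p (D.hom m γ'.braid) = v' at *
  -- The source associator of `γ` is pure, so its cable commutes with everything placed inside the
  -- thick strand.
  have c₆ : X⁻¹ * (y * v' * x⁻¹) = y * v' * x⁻¹ * X⁻¹ :=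
    (((show Commute X y from c₅).mul_right c₄).mul_right
      (show Commute X x from c₃).inv_right).inv_left.eq
  -- Cabling first moves the comparison associator from `p` to the final position of the strand;
  -- this is why `G'` stands on the left and `G` on the right.
  have c₇ : u * v = G'⁻¹ * (w * v' * G) := by
    rw [mul_assoc w, ← Cs, ← mul_assoc w, ← Bc]; group
  rw [mul_assoc (Y * w), c₆, c₇, ← mul_assoc (Y * w), ← mul_assoc (Y * w), ← mul_assoc (Y * w),
    mul_assoc Y w, c₁]
  group

/-- The morphism of truncated operads defined by coherent data. -/
noncomputable def toHom : PaB ⟶ Quo N :=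
  TruncatedOperad.Hom.mk (O := PaB) (P := Quo N)
    (ob := fun x => x)
    (mor := fun {n} γ => quoMk N (PaBMor.src γ) (PaBMor.tgt γ) (D.val γ)
      (D.rho_val n.2.1 n.2.2 γ))
    (map_src := fun _ => rfl)
    (map_tgt := fun _ => rfl)
    (map_ident := fun {n} x => quo_ext rfl rfl (by
      refine (ouQ_quoMk N _ _ _ _).trans ?_
      change D.asc n _ * D.hom n 1 * (D.asc n _)⁻¹ = 1
      rw [map_one, mul_one]; exact mul_inv_cancel _))
    (map_comp := fun {n} γ η e e' => quo_ext rfl rfl (by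
      rw [ouQ_quoMk, ouQ_comp, ouQ_quoMk, ouQ_quoMk]
      change D.asc n γ.tgt.shape * D.hom n (γ.braid * η.braid) * (D.asc n η.src.shape)⁻¹ =
        D.asc n γ.tgt.shape * D.hom n γ.braid * (D.asc n γ.src.shape)⁻¹ *
          (D.asc n η.tgt.shape * D.hom n η.braid * (D.asc n η.src.shape)⁻¹)
      -- The middle object is shared, so its associator cancels against its inverse.
      rw [show γ.src = η.tgt from e, map_mul]
      group))
    (map_act := fun {n} θ γ => quo_ext rfl rfl (by
      rw [ouQ_act, ouQ_quoMk, ouQ_quoMk]; rfl))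
    (map_ins := fun {n m k} h i γ γ' => quo_ext rfl rfl (by
      rw [ouQ_ins, ouQ_quoMk, ouQ_quoMk, ouQ_quoMk]
      exact D.val_ins h m.2.1 k.2.2 i γ γ'))
    (map_unit := rfl)

theorem ouQ_toHom {n : Arity} (γ : PaB.Mor n) : ouQ N (D.toHom.mor γ) = D.val γ :=
  ouQ_quoMk N _ _ _ (D.rho_val n.2.1 n.2.2 γ)

end CoherentData

/-! ### Extracting coherent data from a morphism -/

/-- The trivial braid from the left-normed tree to the tree `x`. -/
def canon (n : Arity) (x : FreeMagma Unit) (hx : x.length = n) : PaB.Mor n :=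
  ⟨stdOb n 1, ⟨x, hx, 1⟩, 1, by simp [stdOb]⟩

section

variable {N : NFI} (T : PaB ⟶ Quo N)

/-- The class of braids assigned by `T` to the trivial braid from the left-normed tree to `x`. -/
def ascOf (n : ℕ) (x : FreeMagma Unit) : B n ⧸ NPB N.1 n :=
  if h : (1 ≤ n ∧ n ≤ 4) ∧ x.length = n then ouQ N (T.mor (canon ⟨n, h.1⟩ x h.2)) else 1

/-- The homomorphism `T^{Bₙ}`, extended by the trivial homomorphism to all `n`. -/
def homOf (n : ℕ) : B n →* B n ⧸ NPB N.1 n :=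
  if h : 1 ≤ n ∧ n ≤ 4 then TB T ⟨n, h⟩ else 1

theorem ascOf_eq (n : Arity) (x : FreeMagma Unit) (hx : x.length = n) :
    ascOf T n x = ouQ N (T.mor (canon n x hx)) := dif_pos ⟨n.2, hx⟩

theorem homOf_eq (n : Arity) : homOf T n = TB T n := dif_pos n.2

theorem ascOf_leftComb {n : ℕ} (hn : n + 1 ≤ 4) : ascOf T (n + 1) (leftComb n) = 1 := by
  rw [ascOf_eq T ⟨n + 1, by omega, hn⟩ (leftComb n) (leftComb_length n)]
  have : canon ⟨n + 1, by omega, hn⟩ (leftComb n) (leftComb_length n) =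
    PaB.ident (stdOb ⟨n + 1, by omega, hn⟩ 1) := rfl
  rw [this, T.map_ident, ouQ_ident]

/-- The class of braids of `T(γ)` in terms of the induced homomorphisms and associators. -/
theorem ouQ_mor {n : Arity} (γ : PaBMor n) : ouQ N (T.mor (n := n) γ) =
    ascOf T n γ.tgt.shape * homOf T n γ.braid * (ascOf T n γ.src.shape)⁻¹ := by
  rw [ascOf_eq T n _ γ.tgt.len, ascOf_eq T n _ γ.src.len, homOf_eq, eq_mul_inv_iff_mul_eq]
  have e₁ : PaB.src (n := n) γ =
      PaB.tgt (PaB.act γ.src.perm (canon n γ.src.shape γ.src.len)) :=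
    PaBOb.ext rfl (mul_one γ.src.perm).symm
  have e₂ : PaB.src (PaB.act γ.tgt.perm (canon n γ.tgt.shape γ.tgt.len)) =
      PaB.tgt (PaB.act γ.src.perm (mm n γ.braid)) := PaBOb.ext rfl (by
    change γ.tgt.perm * 1 = γ.src.perm * (rho n γ.braid)⁻¹
    rw [γ.rho_braid]; group)
  -- Both composites run from the left-normed source tree to the target tree and have the same
  -- underlying braid. The relabellings serve only to make the composites defined; they leave braids
  -- unchanged and disappear under `ouQ`.
  have key : PaB.comp (n := n) γ (PaB.act γ.src.perm (canon n γ.src.shape γ.src.len)) e₁ =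
      PaB.comp (PaB.act γ.tgt.perm (canon n γ.tgt.shape γ.tgt.len))
        (PaB.act γ.src.perm (mm n γ.braid)) e₂ := by
    refine PaBMor.ext rfl (PaBOb.ext rfl (mul_one γ.tgt.perm).symm) ?_
    change γ.braid * 1 = 1 * γ.braid
    rw [mul_one, one_mul]
  have := congrArg (fun a => ouQ N (T.mor a)) key
  change ouQ N (T.mor _) = ouQ N (T.mor _) at this
  rw [T.map_comp _ _ e₁ 
      ((T.map_src _).trans ((congrArg T.ob e₁).trans (T.map_tgt _).symm)),
    T.map_comp _ _ e₂ 
      ((T.map_src _).trans ((congrArg T.ob e₂).trans (T.map_tgt _).symm)), ouQ_comp, ouQ_comp, T.map_act, T.map_act,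
    T.map_act, ouQ_act, ouQ_act, ouQ_act] at this
  exact this

/-- `T` acts as the identity on objects. -/
def IdOnOb : Prop := ∀ (n : Arity) (x : PaB.Ob n), T.ob x = x

variable {T}

theorem src_mor (hT : IdOnOb T) {n : Arity} (γ : PaB.Mor n) :
    (Quo N).src (T.mor γ) = PaB.src γ := (T.map_src γ).trans (hT n _)

theorem tgt_mor (hT : IdOnOb T) {n : Arity} (γ : PaB.Mor n) :
    (Quo N).tgt (T.mor γ) = PaB.tgt γ := (T.map_tgt γ).trans (hT n _)

theorem rhoQ_mor (hT : IdOnOb T) {n : Arity} (γ : PaB.Mor n) :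
    rhoQ N n (ouQ N (T.mor γ)) = (PaBMor.tgt γ).perm⁻¹ * (PaBMor.src γ).perm := by
  rw [rhoQ_ouQ, src_mor hT, tgt_mor hT]; rfl

theorem ouQ_mor_ins (hT : IdOnOb T) {n m k : Arity} (h : (n : ℕ) + m = k + 1) (i : Fin n)
    (γ : PaB.Mor n) (γ' : PaB.Mor m) : ouQ N (T.mor (PaB.ins h i γ γ')) =
      cableQ N h m.2.1 k.2.2 ((PaBMor.src γ).perm⁻¹ i) (ouQ N (T.mor γ)) *
        shiftQ N h m.2.1 k.2.2 ((PaBMor.src γ).perm⁻¹ i) (ouQ N (T.mor γ')) := by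
  rw [T.map_ins, ouQ_ins, src_mor hT]
  rfl

/-- Inserting the trivial braid to `y` into the trivial braid to `x` gives a trivial braid whose
source is a graft of two left-normed trees rather than a left-normed tree. The last factor corrects
for this source. -/
theorem ascOf_graft (hT : IdOnOb T) {n m k : Arity} (h : (n : ℕ) + m = k + 1) (p : Fin n)
    (x y : FreeMagma Unit) (hx : x.length = n) (hy : y.length = m) : ascOf T k (graft x p y) =
      cableQ N h m.2.1 k.2.2 p (ascOf T n x) * shiftQ N h m.2.1 k.2.2 p (ascOf T m y) *
        ascOf T k (graft (leftComb (n - 1)) p (leftComb (m - 1))) := by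
  have e := ouQ_mor_ins hT h p (canon n x hx) (canon m y hy)
  rw [← ascOf_eq, ← ascOf_eq] at e
  have e' : ascOf T k (graft x p y) * homOf T k (cable h p 1 * shift p (ins_bound h p) 1) *
      (ascOf T k (graft (leftComb (n - 1)) p (leftComb (m - 1))))⁻¹ =
      cableQ N h m.2.1 k.2.2 p (ascOf T n x) * shiftQ N h m.2.1 k.2.2 p (ascOf T m y) :=
    (ouQ_mor T _).symm.trans e
  rw [cable_one, map_one, mul_one, map_one, mul_one, mul_inv_eq_iff_eq_mul] at e'
  exact e'

/-- Apply `T` to `mm n g` with an identity inserted. The label `p` sits at position `p` in the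
source but at `rho n g p` in the target, so the two associators may differ. -/
theorem homOf_cable (hT : IdOnOb T) {n m k : Arity} (h : (n : ℕ) + m = k + 1) (p : Fin n)
    (g : B n) : ascOf T k (graft (leftComb (n - 1)) (rho n g p : Fin n) (leftComb (m - 1))) *
        homOf T k (cable h p g) =
      cableQ N h m.2.1 k.2.2 p (homOf T n g) *
        ascOf T k (graft (leftComb (n - 1)) p (leftComb (m - 1))) := by
  have e := ouQ_mor_ins hT h p (mm n g) (PaB.ident (stdOb m 1))
  rw [T.map_ident, ouQ_ident, map_one, mul_one] at e
  have e' : ascOf T k (graft (leftComb (n - 1)) (((rho n g)⁻¹)⁻¹ p : Fin n) (leftComb (m - 1))) *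
      homOf T k (cable h p g * shift p (ins_bound h p) 1) *
      (ascOf T k (graft (leftComb (n - 1)) p (leftComb (m - 1))))⁻¹ =
      cableQ N h m.2.1 k.2.2 p (TB T n g) := (ouQ_mor T _).symm.trans e
  rw [map_one, mul_one, mul_inv_eq_iff_eq_mul, inv_inv, ← homOf_eq] at e'
  exact e'

theorem homOf_shift (hT : IdOnOb T) {n m k : Arity} (h : (n : ℕ) + m = k + 1) (p : Fin n)
    (g : B m) : ascOf T k (graft (leftComb (n - 1)) p (leftComb (m - 1))) *
        homOf T k (shift p (ins_bound h p) g) =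
      shiftQ N h m.2.1 k.2.2 p (homOf T m g) *
        ascOf T k (graft (leftComb (n - 1)) p (leftComb (m - 1))) := by
  have e := ouQ_mor_ins hT h p (PaB.ident (stdOb n 1)) (mm m g)
  rw [T.map_ident, ouQ_ident, cableQ_one, one_mul] at e
  have e' : ascOf T k (graft (leftComb (n - 1)) p (leftComb (m - 1))) *
      homOf T k (cable h p 1 * shift p (ins_bound h p) g) *
      (ascOf T k (graft (leftComb (n - 1)) p (leftComb (m - 1))))⁻¹ =
      shiftQ N h m.2.1 k.2.2 p (TB T m g) := (ouQ_mor T _).symm.trans e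
  rw [cable_one, one_mul, mul_inv_eq_iff_eq_mul, ← homOf_eq] at e'
  exact e'

/-- The coherent data of a morphism that acts as the identity on objects. -/
def CoherentData.ofHom (hT : IdOnOb T) : CoherentData N where
  hom := homOf T
  asc := ascOf T
  rho_hom {n} h₁ h₂ g := by
    rw [homOf_eq T ⟨n, h₁, h₂⟩]
    refine (rhoQ_mor hT (mm ⟨n, h₁, h₂⟩ g)).trans ?_
    change (rho n g)⁻¹⁻¹ * 1 = rho n g
    rw [inv_inv, mul_one]
  rho_asc {n} h₁ h₂ x hx := by
    rw [ascOf_eq T ⟨n, h₁, h₂⟩ x hx]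
    exact (rhoQ_mor hT (canon ⟨n, h₁, h₂⟩ x hx)).trans (inv_mul_cancel 1)
  asc_leftComb := ascOf_leftComb T
  asc_graft {n m k} h hm hk p := ascOf_graft hT (n := ⟨n, by have := p.2; omega⟩)
    (m := ⟨m, by have := p.2; omega⟩) (k := ⟨k, by have := p.2; omega⟩) h p
  hom_cable {n m k} h hm hk p := homOf_cable hT (n := ⟨n, by have := p.2; omega⟩)
    (m := ⟨m, by have := p.2; omega⟩) (k := ⟨k, by have := p.2; omega⟩) h p
  hom_shift {n m k} h hm hk p := homOf_shift hT (n := ⟨n, by have := p.2; omega⟩)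
    (m := ⟨m, by have := p.2; omega⟩) (k := ⟨k, by have := p.2; omega⟩) h p

theorem ouQ_mor_eq_val (hT : IdOnOb T) {n : Arity} (γ : PaB.Mor n) :
    ouQ N (T.mor γ) = (CoherentData.ofHom hT).val γ := ouQ_mor T γ

end

/-! ## Small trees -/

theorem tree_one {x : FreeMagma Unit} (hx : x.length = 1) : x = .of () := by
  cases x with
  | of => rfl
  | mul x y =>
    have := x.length_pos
    have := y.length_pos
    change x.length + y.length = 1 at hx
    omega

theorem tree_two {x : FreeMagma Unit} (hx : x.length = 2) : x = .mul (.of ()) (.of ()) := by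
  cases x with
  | of => exact absurd (show 1 = 2 from hx) (by decide)
  | mul x y =>
    have := x.length_pos
    have := y.length_pos
    change x.length + y.length = 2 at hx
    rw [tree_one (x := x) (by omega), tree_one (x := y) (by omega)]

/-- The right-normed tree with three leaves. -/
def rightTree : FreeMagma Unit := .mul (.of ()) (.mul (.of ()) (.of ()))

theorem tree_three {x : FreeMagma Unit} (hx : x.length = 3) : x = leftComb 2 ∨ x = rightTree := by
  cases x with
  | of => exact absurd (show 1 = 3 from hx) (by decide)
  | mul x y =>
    have := x.length_pos
    have := y.length_pos
    change x.length + y.length = 3 at hx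
    rcases (show x.length = 2 ∧ y.length = 1 ∨ x.length = 1 ∧ y.length = 2 by omega) with h | h
    · rw [tree_two h.1, tree_one h.2]; exact Or.inl rfl
    · rw [tree_one h.1, tree_two h.2]; exact Or.inr rfl

/-- Every tree with four leaves arises from one with three leaves by splitting a leaf. -/
theorem tree_four {x : FreeMagma Unit} (hx : x.length = 4) :
    ∃ (y : FreeMagma Unit) (p : Fin 3), y.length = 3 ∧ x = graft y p (leftComb 1) := by
  cases x with
  | of => exact absurd (show 1 = 4 from hx) (by decide)
  | mul x y =>
    have := x.length_pos
    have := y.length_pos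
    change x.length + y.length = 4 at hx
    rcases (show x.length = 3 ∧ y.length = 1 ∨ x.length = 2 ∧ y.length = 2 ∨
      x.length = 1 ∧ y.length = 3 by omega) with h | h | h
    · rw [tree_one h.2]
      rcases tree_three h.1 with e | e <;> rw [e]
      · exact ⟨leftComb 2, 0, rfl, rfl⟩
      · exact ⟨leftComb 2, 1, rfl, rfl⟩
    · rw [tree_two h.1, tree_two h.2]
      exact ⟨leftComb 2, 2, rfl, rfl⟩
    · rw [tree_one h.1]
      rcases tree_three h.2 with e | e <;> rw [e]
      · exact ⟨rightTree, 1, rfl, rfl⟩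
      · exact ⟨rightTree, 2, rfl, rfl⟩

/-- Apart from insertions of or into arity one, only three shapes of insertion stay within arity
four. Every law is verified by running through them. -/
theorem arity_cases {n m k : ℕ} (h : n + m = k + 1) (hn : 1 ≤ n) (hm : 1 ≤ m) (hk : k ≤ 4) :
    (m = 1 ∧ k = n) ∨ (n = 1 ∧ k = m) ∨ (n = 2 ∧ m = 2 ∧ k = 3) ∨ (n = 3 ∧ m = 2 ∧ k = 4) ∨
      (n = 2 ∧ m = 3 ∧ k = 4) := by
  omega

/-! ## Extending the laws from generators -/

theorem cableQ_inv {N : NFI} {n m k : ℕ} {h : n + m = k + 1} {hm : 1 ≤ m} {hk : k ≤ 4} (p : Fin n)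
    (a : B n ⧸ NPB N.1 n) :
    cableQ N h hm hk p a⁻¹ = (cableQ N h hm hk ((rhoQ N n a)⁻¹ p) a)⁻¹ := by
  obtain ⟨a, rfl⟩ := QuotientGroup.mk_surjective a
  exact congrArg QuotientGroup.mk (cable_inv h p a)

/-- Both `cable` and `cableQ` are crossed homomorphisms over the same permutations, because `φ`
covers `rho`. The law therefore passes from generators to products and inverses, provided the
position `p` varies in the induction. -/
theorem cable_law_of_gen {N : NFI} {n m k : ℕ} (h : n + m = k + 1) (hm : 1 ≤ m) (hk : k ≤ 4)
    (φ : B n →* B n ⧸ NPB N.1 n) (ψ : B k →* B k ⧸ NPB N.1 k) (G : Fin n → B k ⧸ NPB N.1 k)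
    (hφ : ∀ g, rhoQ N n (φ g) = rho n g)
    (gen : ∀ i, i + 1 < n → ∀ p, G (tr n i p) * ψ (thick k m i p) =
      cableQ N h hm hk p (φ (s n i)) * G p) (g : B n) (p : Fin n) :
    G (rho n g p) * ψ (cable h p g) = cableQ N h hm hk p (φ g) * G p := by
  induction g using B_induction generalizing p with
  | one => rw [cable_one]; simp
  | gen i hi => rw [rho_s hi, cable_s h p hi, gen i hi]
  | mul a b ha hb =>
    rw [map_mul, Equiv.Perm.mul_apply, cable_mul, map_mul, ← mul_assoc, ha, mul_assoc, hb, map_mul,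
      cableQ_mul, hφ, mul_assoc]
  | inv a ha =>
    have e := ha ((rho n a)⁻¹ p)
    rw [show rho n a ((rho n a)⁻¹ p) = p from Equiv.apply_symm_apply _ _] at e
    rw [map_inv, cable_inv, map_inv, map_inv, cableQ_inv, hφ, eq_inv_mul_iff_mul_eq, ← mul_assoc,
      ← e, mul_inv_cancel_right]

theorem shift_law_of_gen {N : NFI} {n m k : ℕ} (h : n + m = k + 1) (hm : 1 ≤ m) (hk : k ≤ 4)
    (φ : B m →* B m ⧸ NPB N.1 m) (ψ : B k →* B k ⧸ NPB N.1 k) (p : Fin n) (G : B k ⧸ NPB N.1 k)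
    (gen : ∀ i, i + 1 < m → G * ψ (s k (p + i)) = shiftQ N h hm hk p (φ (s m i)) * G) (g : B m) :
    G * ψ (shift p (ins_bound h p) g) = shiftQ N h hm hk p (φ g) * G := by
  induction g using B_induction with
  | one => simp
  | gen i hi => rw [shift_s _ hi, gen i hi]
  | mul a b ha hb => rw [map_mul, map_mul, ← mul_assoc, ha, mul_assoc, hb, map_mul, map_mul,
      mul_assoc]
  | inv a ha =>
    rw [map_inv, map_inv, map_inv, map_inv, eq_inv_mul_iff_mul_eq, ← mul_assoc, ← ha,
      mul_inv_cancel_right]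

theorem rhoQ_hom_of_gen {N : NFI} {n : ℕ} (φ : B n →* B n ⧸ NPB N.1 n)
    (gen : ∀ i, i + 1 < n → rhoQ N n (φ (s n i)) = tr n i) (g : B n) :
    rhoQ N n (φ g) = rho n g := by
  induction g using B_induction with
  | one => simp
  | gen i hi => rw [gen i hi, rho_s hi]
  | mul a b ha hb => rw [map_mul, map_mul, ha, hb, map_mul]
  | inv a ha => rw [map_inv, map_inv, ha, map_inv]

/-! ## Hexagons and pentagon -/

theorem split_two_two : 2 + 2 = 3 + 1 := rfl
theorem split_two_three : 2 + 3 = 4 + 1 := rfl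
theorem split_three_two : 3 + 2 = 4 + 1 := rfl
theorem one_le_two_nat : 1 ≤ 2 := by decide
theorem one_le_three : 1 ≤ 3 := by decide
theorem three_le_four : 3 ≤ 4 := by decide
theorem four_le_four : 4 ≤ 4 := le_rfl

section

variable {N : NFI}

-- Here `sh` stands for juxtaposition and `ca` for cabling; the digits are the numbers of strands
-- before and after, and the argument is the position counted from zero.
local notation "sh23" => shiftQ N split_two_two one_le_two_nat three_le_four
local notation "sh34" => shiftQ N split_two_three one_le_three four_le_four
local notation "sh24" => shiftQ N split_three_two one_le_two_nat four_le_four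
local notation "ca23" => cableQ N split_two_two one_le_two_nat three_le_four
local notation "ca34" => cableQ N split_three_two one_le_two_nat four_le_four
local notation "ca24" => cableQ N split_two_three one_le_three four_le_four

/-- The hexagon and pentagon relations for the images `a` of the braiding and `f` of the
associator. -/
structure HexPent (a : B 2 ⧸ NPB N.1 2) (f : B 3 ⧸ NPB N.1 3) : Prop where
  rho_a : rhoQ N 2 a = tr 2 0
  rho_f : rhoQ N 3 f = 1
  hex₁ : f * (sh23 0 a * (f⁻¹ * sh23 1 a * f)) = ca23 0 a
  hex₂ : f⁻¹ * sh23 1 a * f * sh23 0 a = ca23 1 a * f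
  pent : sh34 1 f * (ca34 1 f * sh34 0 f) = ca34 2 f * ca34 0 f

/-- The images of the generators of `B₃`. -/
def gen3 (a : B 2 ⧸ NPB N.1 2) (f : B 3 ⧸ NPB N.1 3) : ℕ → B 3 ⧸ NPB N.1 3
  | 0 => sh23 0 a
  | _ => f⁻¹ * sh23 1 a * f

/-- The images of the generators of `B₄`. -/
def gen4 (a : B 2 ⧸ NPB N.1 2) (f : B 3 ⧸ NPB N.1 3) : ℕ → B 4 ⧸ NPB N.1 4
  | 0 => sh34 0 (gen3 a f 0)
  | 1 => sh34 0 (gen3 a f 1)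
  | _ => (ca34 0 f)⁻¹ * sh24 2 a * ca34 0 f

theorem gen3_zero (a : B 2 ⧸ NPB N.1 2) (f : B 3 ⧸ NPB N.1 3) : gen3 a f 0 = sh23 0 a := rfl

/-- The conjugator `f` is the move from (12)3 to 1(23), the tree in which the strands crossed by σ₂
share a vertex. -/
theorem gen3_one (a : B 2 ⧸ NPB N.1 2) (f : B 3 ⧸ NPB N.1 3) :
    gen3 a f 1 = f⁻¹ * sh23 1 a * f := rfl

theorem gen4_zero (a : B 2 ⧸ NPB N.1 2) (f : B 3 ⧸ NPB N.1 3) :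
    gen4 a f 0 = sh34 0 (gen3 a f 0) := rfl

theorem gen4_one (a : B 2 ⧸ NPB N.1 2) (f : B 3 ⧸ NPB N.1 3) :
    gen4 a f 1 = sh34 0 (gen3 a f 1) := rfl

/-- The conjugator is the move from ((12)3)4 to (12)(34), where the last two strands share a vertex.
-/
theorem gen4_two (a : B 2 ⧸ NPB N.1 2) (f : B 3 ⧸ NPB N.1 3) :
    gen4 a f 2 = (ca34 0 f)⁻¹ * sh24 2 a * ca34 0 f := rfl

/-- The values of the associators on trees with three leaves. -/
def asc3 (f : B 3 ⧸ NPB N.1 3) : FreeMagma Unit → B 3 ⧸ NPB N.1 3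
  | .mul (.of _) (.mul _ _) => f
  | _ => 1

/-- The values of the associators on trees with four leaves. -/
def asc4 (f : B 3 ⧸ NPB N.1 3) : FreeMagma Unit → B 4 ⧸ NPB N.1 4
  | .mul (.mul (.of _) (.mul _ _)) _ => sh34 0 f
  | .mul (.mul (.of _) (.of _)) _ => ca34 0 f
  | .mul (.of _) (.mul (.mul _ _) _) => ca34 1 f * sh34 0 f
  | .mul (.of _) (.mul (.of _) _) => ca34 2 f * ca34 0 f
  | _ => 1

/-! ### The braid relations for the images of the generators -/

namespace HexPent

variable {a : B 2 ⧸ NPB N.1 2} {f : B 3 ⧸ NPB N.1 3}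

/-- By the first hexagon, the image of σ₁σ₂ is `f⁻¹` times the cable of `a` along its first strand.
A copy of `a` slides along this cable from position 0 to position 1, and this is the braid relation.
The second hexagon plays no part. -/
theorem gen3_braid (d : HexPent a f) :
    gen3 a f 0 * gen3 a f 1 * gen3 a f 0 = gen3 a f 1 * gen3 a f 0 * gen3 a f 1 := by
  have h₁ : gen3 a f 0 * gen3 a f 1 = f⁻¹ * ca23 0 a := by rw [← d.hex₁]; simp [gen3]
  have h₂ := cableQ_shiftQ_comm (N := N) (h := split_two_two)
    (hm := one_le_two_nat) (hk := three_le_four) 0 a a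
  rw [d.rho_a, show tr 2 0 0 = 1 by decide] at h₂
  rw [mul_assoc (gen3 a f 1), h₁, mul_assoc, show gen3 a f 0 = sh23 0 a from rfl, h₂]
  simp [gen3, mul_assoc]

theorem sh34_zero_gen3_one :
    sh34 0 (gen3 a f 1) = (sh34 0 f)⁻¹ * sh24 1 a * sh34 0 f := by
  have e : sh34 0 (sh23 1 a) = sh24 1 a := shiftQ_shiftQ 1 0 1 rfl a
  rw [gen3_one, map_mul, map_mul, map_inv, e]

theorem sh34_one_gen3_one :
    sh34 1 (gen3 a f 1) = (sh34 1 f)⁻¹ * sh24 2 a * sh34 1 f := by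
  have e : sh34 1 (sh23 1 a) = sh24 2 a := shiftQ_shiftQ 1 1 2 rfl a
  rw [gen3_one, map_mul, map_mul, map_inv, e]

/-- The conjugator is the move from ((12)3)4 to 1((23)4), along the path through (1(23))4. It turns
the images of σ₂ and σ₃ into a copy, on the last three strands, of the images of σ₁ and σ₂ in arity
three. For σ₂ this holds because the pure cable `ca34 1 f` commutes with a crossing inside its thick
strand. -/
theorem conj_gen4_one (d : HexPent a f) :
    (ca34 1 f * sh34 0 f) * gen4 a f 1 = sh34 1 (gen3 a f 0) * (ca34 1 f * sh34 0 f) := by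
  have c := (cableQ_shiftQ_commute (N := N) (h := split_three_two)
    (hm := one_le_two_nat) (hk := four_le_four) 1 d.rho_f a).eq
  have e : sh34 1 (sh23 0 a) = sh24 1 a := shiftQ_shiftQ 0 1 1 rfl a
  rw [gen4_one, sh34_zero_gen3_one, gen3_zero, e, ← mul_assoc, ← mul_assoc, ← mul_assoc,
    mul_inv_cancel_right, c]

/-- For σ₃ the pentagon is needed: it replaces the path through (1(23))4 by the one through (12)(34)
and 1(2(34)). On that path the crossing lies inside the thick strand of `ca34 2 f` and commutes with
it. -/
theorem conj_gen4_two (d : HexPent a f) :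
    (ca34 1 f * sh34 0 f) * gen4 a f 2 = sh34 1 (gen3 a f 1) * (ca34 1 f * sh34 0 f) := by
  have c := (cableQ_shiftQ_commute (N := N) (h := split_three_two)
    (hm := one_le_two_nat) (hk := four_le_four) 2 d.rho_f a).eq
  have e : ca34 1 f * sh34 0 f = (sh34 1 f)⁻¹ * (ca34 2 f * ca34 0 f) := by
    rw [← d.pent, inv_mul_cancel_left]
  rw [sh34_one_gen3_one, e, mul_assoc _ (sh34 1 f), mul_inv_cancel_left, gen4_two,
    mul_assoc _ (sh24 2 a) (_ * _), ← mul_assoc (sh24 2 a), ← c]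
  simp only [mul_assoc, mul_inv_cancel_left]

/-- The first crossing lies inside the thick strand of `ca34 0 f`, so it commutes with the
conjugator; it commutes with the crossing of the last two strands because the blocks are disjoint.
-/
theorem gen4_comm (d : HexPent a f) : gen4 a f 0 * gen4 a f 2 = gen4 a f 2 * gen4 a f 0 := by
  have c : Commute (ca34 0 f) (sh24 0 a) := cableQ_shiftQ_commute 0 d.rho_f a
  have c' : Commute (sh24 0 a) (sh24 2 a) := shiftQ_commute 0 2 (by decide) a a
  have e : sh34 0 (sh23 0 a) = sh24 0 a := shiftQ_shiftQ 0 0 0 rfl a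
  rw [gen4_zero, gen3_zero, e, gen4_two]
  exact ((c.symm.inv_right.mul_right c').mul_right c.symm).eq

theorem gen4_braid (d : HexPent a f) {i : ℕ} (hi : i < 2) : gen4 a f i * gen4 a f (i + 1) *
    gen4 a f i = gen4 a f (i + 1) * gen4 a f i * gen4 a f (i + 1) := by
  rcases (show i = 0 ∨ i = 1 by omega) with rfl | rfl
  · have := congrArg (sh34 0) d.gen3_braid
    simp only [map_mul] at this
    exact this
  -- The relation between σ₂ and σ₃ is the relation in arity three placed on the last three strands
  -- and conjugated by `E`.
  · have h₁ := d.conj_gen4_one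
    have h₂ := d.conj_gen4_two
    have h₃ := congrArg (sh34 1) d.gen3_braid
    simp only [map_mul] at h₃
    generalize ca34 1 f * sh34 0 f = E at h₁ h₂
    rw [← eq_inv_mul_iff_mul_eq] at h₁ h₂
    rw [h₁, h₂]
    generalize sh34 1 (gen3 a f 0) = u at h₃
    generalize sh34 1 (gen3 a f 1) = v at h₃
    have : E⁻¹ * (u * v * u) * E = E⁻¹ * (v * u * v) * E := by rw [h₃]
    simpa [mul_assoc] using this

/-! ### The induced homomorphisms and their laws -/

/-- The homomorphism on `B₂` with `σ₁ ↦ a`. -/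
def hom2 (a : B 2 ⧸ NPB N.1 2) : B 2 →* B 2 ⧸ NPB N.1 2 :=
  liftB 2 (fun _ => a) (fun _ _ _ _ => by omega) fun _ _ => by omega

/-- The homomorphism on `B₃` determined by a solution of the hexagon relations. -/
def hom3 (d : HexPent a f) : B 3 →* B 3 ⧸ NPB N.1 3 :=
  liftB 3 (gen3 a f) (fun _ _ _ _ => by omega) fun i hi => by
    obtain rfl : i = 0 := by omega
    exact d.gen3_braid

/-- The homomorphism on `B₄` determined by a solution of the hexagon and pentagon relations. -/
def hom4 (d : HexPent a f) : B 4 →* B 4 ⧸ NPB N.1 4 :=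
  liftB 4 (gen4 a f)
    (fun i j h h' => by
      obtain ⟨rfl, rfl⟩ : i = 0 ∧ j = 2 := by omega
      exact d.gen4_comm)
    fun i hi => d.gen4_braid (by omega)

theorem hom2_s (a : B 2 ⧸ NPB N.1 2) : hom2 a (s 2 0) = a := liftB_s _ _ _ _ (by omega)

theorem hom3_s (d : HexPent a f) {i : ℕ} (hi : i + 1 < 3) : d.hom3 (s 3 i) = gen3 a f i :=
  liftB_s _ _ _ _ hi

theorem hom4_s (d : HexPent a f) {i : ℕ} (hi : i + 1 < 4) : d.hom4 (s 4 i) = gen4 a f i :=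
  liftB_s _ _ _ _ hi

theorem rhoQ_sh23 (d : HexPent a f) (p : Fin 2) : rhoQ N 3 (sh23 p a) = tr 3 p := by
  rw [rhoQ_shiftQ, d.rho_a, ← rho_s (by omega), ← rho_shift split_two_two p (ins_bound split_two_two p),
    shift_s _ (by omega), rho_s (by omega)]
  rfl

theorem rhoQ_sh24 (d : HexPent a f) (p : Fin 3) : rhoQ N 4 (sh24 p a) = tr 4 p := by
  rw [rhoQ_shiftQ, d.rho_a, ← rho_s (by omega), ← rho_shift split_three_two p (ins_bound split_three_two p),
    shift_s _ (by omega), rho_s (by omega)]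
  rfl

theorem rho_hom2 (d : HexPent a f) (g : B 2) : rhoQ N 2 (hom2 a g) = rho 2 g := by
  refine rhoQ_hom_of_gen _ (fun i hi => ?_) g
  obtain rfl : i = 0 := by omega
  rw [hom2_s, d.rho_a]

theorem rho_hom3 (d : HexPent a f) (g : B 3) : rhoQ N 3 (d.hom3 g) = rho 3 g := by
  refine rhoQ_hom_of_gen _ (fun i hi => ?_) g
  rw [d.hom3_s hi]
  rcases (show i = 0 ∨ i = 1 by omega) with rfl | rfl
  · rw [gen3_zero, d.rhoQ_sh23]; rfl
  · rw [gen3_one, map_mul, map_mul, map_inv, d.rho_f, d.rhoQ_sh23, inv_one, one_mul, mul_one]; rfl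

theorem rho_hom4 (d : HexPent a f) (g : B 4) : rhoQ N 4 (d.hom4 g) = rho 4 g := by
  have pf : ∀ p, rhoQ N 4 (sh34 p f) = 1 := fun p => rhoQ_shiftQ_of_pure p d.rho_f
  have pc : ∀ p, rhoQ N 4 (ca34 p f) = 1 := fun p => rhoQ_cableQ_of_pure p d.rho_f
  refine rhoQ_hom_of_gen _ (fun i hi => ?_) g
  rw [d.hom4_s hi]
  rcases (show i = 0 ∨ i = 1 ∨ i = 2 by omega) with rfl | rfl | rfl
  · have e : sh34 0 (sh23 0 a) = sh24 0 a := shiftQ_shiftQ 0 0 0 rfl a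
    rw [gen4_zero, gen3_zero, e, d.rhoQ_sh24]; rfl
  · rw [gen4_one, sh34_zero_gen3_one, map_mul, map_mul, map_inv, pf, d.rhoQ_sh24, inv_one, one_mul,
      mul_one]; rfl
  · rw [gen4_two, map_mul, map_mul, map_inv, pc, d.rhoQ_sh24, inv_one, one_mul, mul_one]; rfl

theorem hom3_shift (d : HexPent a f) (p : Fin 2) (g : B 2) :
    asc3 f (graft (leftComb 1) p (leftComb 1)) * d.hom3 (shift p (ins_bound split_two_two p) g) =
      sh23 p (hom2 a g) * asc3 f (graft (leftComb 1) p (leftComb 1)) := by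
  refine shift_law_of_gen _ _ _ (hom2 a) d.hom3 p _ (fun i hi => ?_) g
  obtain rfl : i = 0 := by omega
  rw [hom2_s]
  fin_cases p
  · change 1 * d.hom3 (s 3 0) = sh23 0 a * 1
    rw [d.hom3_s (by omega), gen3_zero, one_mul, mul_one]
  · change f * d.hom3 (s 3 1) = sh23 1 a * f
    rw [d.hom3_s (by omega), gen3_one, mul_assoc, mul_inv_cancel_left]

/-- On the left block this holds by the choice of the first two generators. On the right block it is
the content of `conj_gen4_one` and `conj_gen4_two`. -/
theorem hom4_shift_three (d : HexPent a f) (p : Fin 2) (g : B 3) :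
    asc4 f (graft (leftComb 1) p (leftComb 2)) * d.hom4 (shift p (ins_bound split_two_three p) g) =
      sh34 p (d.hom3 g) * asc4 f (graft (leftComb 1) p (leftComb 2)) := by
  refine shift_law_of_gen _ _ _ d.hom3 d.hom4 p _ (fun i hi => ?_) g
  rw [d.hom3_s hi]
  fin_cases p
  · change 1 * d.hom4 (s 4 (0 + i)) = sh34 0 (gen3 a f i) * 1
    rw [d.hom4_s (by omega), one_mul, mul_one, zero_add]
    rcases (show i = 0 ∨ i = 1 by omega) with rfl | rfl <;> rfl
  · change ca34 1 f * sh34 0 f * d.hom4 (s 4 (1 + i)) =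
      sh34 1 (gen3 a f i) * (ca34 1 f * sh34 0 f)
    rw [d.hom4_s (by omega)]
    rcases (show i = 0 ∨ i = 1 by omega) with rfl | rfl
    · exact d.conj_gen4_one
    · exact d.conj_gen4_two

/-- The values of the generators were chosen so that this holds: each is the conjugate of `a` by the
associator on the left. -/
theorem hom4_shift_two (d : HexPent a f) (p : Fin 3) (g : B 2) :
    asc4 f (graft (leftComb 2) p (leftComb 1)) * d.hom4 (shift p (ins_bound split_three_two p) g) =
      sh24 p (hom2 a g) * asc4 f (graft (leftComb 2) p (leftComb 1)) := by
  refine shift_law_of_gen _ _ _ (hom2 a) d.hom4 p _ (fun i hi => ?_) g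
  obtain rfl : i = 0 := by omega
  rw [hom2_s]
  fin_cases p
  · change 1 * d.hom4 (s 4 0) = sh24 0 a * 1
    have e : sh34 0 (sh23 0 a) = sh24 0 a := shiftQ_shiftQ 0 0 0 rfl a
    rw [d.hom4_s (by omega), gen4_zero, gen3_zero, one_mul, mul_one, e]
  · change sh34 0 f * d.hom4 (s 4 1) = sh24 1 a * sh34 0 f
    rw [d.hom4_s (by omega), gen4_one, sh34_zero_gen3_one, mul_assoc, mul_inv_cancel_left]
  · change ca34 0 f * d.hom4 (s 4 2) = sh24 2 a * ca34 0 f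
    rw [d.hom4_s (by omega), gen4_two, mul_assoc, mul_inv_cancel_left]

theorem ca34_gen3_one (d : HexPent a f) (p : Fin 3) : ca34 p (gen3 a f 1) =
    (ca34 (tr 3 1 p) f)⁻¹ * ca34 p (sh23 1 a) * ca34 p f := by
  rw [gen3_one, cableQ_mul_of_pure _ _ d.rho_f, cableQ_mul, cableQ_inv_of_pure _ d.rho_f,
    d.rhoQ_sh23]
  rfl

/-- The law for σ₁ at its two positions is precisely the pair of hexagons. -/
theorem hom3_cable (d : HexPent a f) (g : B 2) (p : Fin 2) :
    asc3 f (graft (leftComb 1) (rho 2 g p : Fin 2) (leftComb 1)) *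
        d.hom3 (cable split_two_two p g) =
      ca23 p (hom2 a g) * asc3 f (graft (leftComb 1) p (leftComb 1)) := by
  refine cable_law_of_gen _ _ _ (hom2 a) d.hom3
    (fun p => asc3 f (graft (leftComb 1) p (leftComb 1))) d.rho_hom2 (fun i hi p => ?_) g p
  obtain rfl : i = 0 := by omega
  rw [hom2_s]
  fin_cases p
  · change f * d.hom3 (1 * s 3 0 * s 3 1) = ca23 0 a * 1
    rw [one_mul, mul_one, map_mul, d.hom3_s (by omega), d.hom3_s (by omega), gen3_zero, gen3_one,
      d.hex₁]
  · change 1 * d.hom3 (s 3 1 * (s 3 0 * 1)) = ca23 1 a * f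
    rw [one_mul, mul_one, map_mul, d.hom3_s (by omega), d.hom3_s (by omega), gen3_zero, gen3_one,
      d.hex₂]

/-- There are two generators and three strands. When the thickened strand takes no part in the
crossing, commutation or the definition of the generators suffices. Otherwise a hexagon is placed on
three consecutive strands: on the first three for σ₁, and on the last three for σ₂, where the
pentagon is also needed to reach that block. -/
theorem hom4_cable_two (d : HexPent a f) (g : B 3) (p : Fin 3) :
    asc4 f (graft (leftComb 2) (rho 3 g p : Fin 3) (leftComb 1)) *
        d.hom4 (cable split_three_two p g) =
      ca34 p (d.hom3 g) * asc4 f (graft (leftComb 2) p (leftComb 1)) := by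
  have h₁ : f * (gen3 a f 0 * gen3 a f 1) = ca23 0 a := d.hex₁
  have h₂ : gen3 a f 1 * gen3 a f 0 = ca23 1 a * f := d.hex₂
  refine cable_law_of_gen _ _ _ d.hom3 d.hom4
    (fun p => asc4 f (graft (leftComb 2) p (leftComb 1))) d.rho_hom3 (fun i hi p => ?_) g p
  rw [d.hom3_s hi]
  rcases (show i = 0 ∨ i = 1 by omega) with rfl | rfl
  · rw [gen3_zero]
    fin_cases p
    · change sh34 0 f * d.hom4 (1 * s 4 0 * s 4 1) = ca34 0 (sh23 0 a) * 1
      have e : ca34 0 (sh23 0 a) = sh34 0 (ca23 0 a) := cableQ_shiftQ_inner 0 0 0 rfl a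
      rw [one_mul, mul_one, map_mul, d.hom4_s (by omega), d.hom4_s (by omega), gen4_zero, gen4_one,
        e, ← map_mul, ← map_mul, h₁]
    · change 1 * d.hom4 (s 4 1 * (s 4 0 * 1)) = ca34 1 (sh23 0 a) * sh34 0 f
      have e : ca34 1 (sh23 0 a) = sh34 0 (ca23 1 a) := cableQ_shiftQ_inner 0 1 1 rfl a
      rw [one_mul, mul_one, map_mul, d.hom4_s (by omega), d.hom4_s (by omega), gen4_zero, gen4_one,
        e, ← map_mul, ← map_mul, h₂]
    · change ca34 0 f * d.hom4 (s 4 0) = ca34 2 (sh23 0 a) * ca34 0 f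
      have e : ca34 2 (sh23 0 a) = sh24 0 a :=
        cableQ_shiftQ_outer 0 1 (by decide) 2 0 rfl rfl a
      have e' : sh34 0 (sh23 0 a) = sh24 0 a := shiftQ_shiftQ 0 0 0 rfl a
      have c : Commute (ca34 0 f) (sh24 0 a) := cableQ_shiftQ_commute 0 d.rho_f a
      rw [d.hom4_s (by omega), gen4_zero, gen3_zero, e, e', c.eq]
  · have k₁ := d.conj_gen4_one
    have k₂ := d.conj_gen4_two
    rw [d.ca34_gen3_one]
    fin_cases p
    · change 1 * d.hom4 (s 4 2) = (ca34 0 f)⁻¹ * ca34 0 (sh23 1 a) * ca34 0 f * 1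
      have e : ca34 0 (sh23 1 a) = sh24 2 a :=
        cableQ_shiftQ_outer 1 0 (by decide) 0 2 rfl rfl a
      rw [d.hom4_s (by omega), gen4_two, one_mul, mul_one, e]
    · change ca34 0 f * d.hom4 (1 * s 4 1 * s 4 2) =
        (ca34 2 f)⁻¹ * ca34 1 (sh23 1 a) * ca34 1 f * sh34 0 f
      have e : ca34 1 (sh23 1 a) = sh34 1 (ca23 0 a) := cableQ_shiftQ_inner 1 0 1 rfl a
      -- The pentagon exposes the factor `E`, which carries the two generators to the last three
      -- strands, where the first hexagon applies.
      have e' : ca34 0 f = (ca34 2 f)⁻¹ * (sh34 1 f * (ca34 1 f * sh34 0 f)) := by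
        rw [d.pent, inv_mul_cancel_left]
      rw [one_mul, map_mul, d.hom4_s (by omega), d.hom4_s (by omega), e, e', ← h₁, map_mul, map_mul,
        mul_assoc (_ * _ : B 4 ⧸ NPB N.1 4) (ca34 1 f) (sh34 0 f)]
      generalize ca34 1 f * sh34 0 f = E at k₁ k₂ ⊢
      rw [mul_assoc, mul_assoc, ← mul_assoc E, k₁, mul_assoc _ E, k₂]
      simp only [mul_assoc]
    · change sh34 0 f * d.hom4 (s 4 2 * (s 4 1 * 1)) =
        (ca34 1 f)⁻¹ * ca34 2 (sh23 1 a) * ca34 2 f * ca34 0 f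
      have e : ca34 2 (sh23 1 a) = sh34 1 (ca23 1 a) := cableQ_shiftQ_inner 1 1 2 rfl a
      -- The pentagon rewrites the right side, and the inserted factor `ca34 1 f` with its inverse
      -- completes `E` on the left. The second hexagon on the last three strands then closes the
      -- case.
      rw [mul_one, map_mul, d.hom4_s (by omega), d.hom4_s (by omega), e,
        mul_assoc _ (ca34 2 f) (ca34 0 f), ← d.pent,
        ← inv_mul_cancel_left (ca34 1 f) (sh34 0 f * _), ← mul_assoc (ca34 1 f) (sh34 0 f)]
      generalize ca34 1 f * sh34 0 f = E at k₁ k₂ ⊢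
      rw [← mul_assoc E, k₂, mul_assoc _ E, k₁, ← mul_assoc (sh34 1 _), ← map_mul, h₂, map_mul]
      simp only [mul_assoc]

/-- Replacing a strand by three parallel strands can be done by doubling it and then doubling the
first of the two copies. This is the matching identity for associators. -/
theorem ca34_asc3 (p : Fin 2) :
    ca34 ⟨p, by omega⟩ (asc3 f (graft (leftComb 1) p (leftComb 1))) *
      asc4 f (graft (leftComb 2) p (leftComb 1)) = asc4 f (graft (leftComb 1) p (leftComb 2)) := by
  fin_cases p
  · change ca34 0 1 * 1 = 1
    rw [cableQ_one, one_mul]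
  · rfl

theorem rho_asc3 (d : HexPent a f) {x : FreeMagma Unit} (hx : x.length = 3) :
    rhoQ N 3 (asc3 f x) = 1 := by
  rcases tree_three hx with rfl | rfl
  · exact map_one _
  · exact d.rho_f

/-- A cable of three strands is a double cable of two strands, so the law follows by applying `ca34`
to the law in arity three and combining it with `hom4_cable_two`. -/
theorem hom4_cable_three (d : HexPent a f) (g : B 2) (p : Fin 2) :
    asc4 f (graft (leftComb 1) (rho 2 g p : Fin 2) (leftComb 2)) *
        d.hom4 (cable split_two_three p g) =
      ca24 p (hom2 a g) * asc4 f (graft (leftComb 1) p (leftComb 2)) := by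
  have hl : ∀ p : Fin 2, (graft (leftComb 1) p (leftComb 1)).length = 3 := fun p => by
    fin_cases p <;> rfl
  have e₁ := d.hom3_cable g p
  have e₂ := d.hom4_cable_two (cable split_two_two p g) ⟨p, by omega⟩
  have e₃ : rho 3 (cable split_two_two p g) ⟨p, by omega⟩ = ⟨rho 2 g p, by omega⟩ := Fin.ext (by
    rw [rho_cable, insPerm_inn split_two_two (j := 0) _ _ rfl]; rfl)
  have e₄ : cable split_three_two ⟨p, by omega⟩ (cable split_two_two p g) =
      cable split_two_three p g := cable_cable _ _ split_two_two _ p 0 ⟨p, by omega⟩ rfl g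
  have e₅ : ca34 ⟨p, by omega⟩ (ca23 p (hom2 a g)) = ca24 p (hom2 a g) :=
    cableQ_cableQ split_two_two p 0 ⟨p, by omega⟩ rfl _
  have e₆ := congrArg (ca34 ⟨p, by omega⟩) e₁
  rw [cableQ_mul_of_pure _ _ (d.rho_asc3 (hl p)), e₅, cableQ_mul, d.rho_hom3, e₃] at e₆
  rw [e₃, e₄] at e₂
  rw [← ca34_asc3, mul_assoc, e₂, ← mul_assoc, e₆, mul_assoc, ca34_asc3]

/-! ### Assembling coherent data from a solution -/

/-- The homomorphisms on all braid groups. -/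
def homFam (d : HexPent a f) : ∀ n : ℕ, B n →* B n ⧸ NPB N.1 n
  | 2 => hom2 a
  | 3 => d.hom3
  | 4 => d.hom4
  | _ => 1

/-- The values of the associators in all arities. -/
def ascFam (f : B 3 ⧸ NPB N.1 3) : ∀ n : ℕ, FreeMagma Unit → B n ⧸ NPB N.1 n
  | 3 => asc3 f
  | 4 => asc4 f
  | _ => fun _ => 1

theorem rho_ascFam (d : HexPent a f) {n : ℕ} (hn : 1 ≤ n) (hn' : n ≤ 4) {x : FreeMagma Unit}
    (hx : x.length = n) : rhoQ N n (ascFam f n x) = 1 := by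
  rcases (show n = 1 ∨ n = 2 ∨ n = 3 ∨ n = 4 by omega) with rfl | rfl | rfl | rfl
  · exact map_one _
  · exact map_one _
  · exact d.rho_asc3 hx
  · change rhoQ N 4 (asc4 f x) = 1
    obtain ⟨y, p, hy, rfl⟩ := tree_four hx
    have pf : ∀ p, rhoQ N 4 (sh34 p f) = 1 := fun p => rhoQ_shiftQ_of_pure p d.rho_f
    have pc : ∀ p, rhoQ N 4 (ca34 p f) = 1 := fun p => rhoQ_cableQ_of_pure p d.rho_f
    have p₁ : rhoQ N 4 (ca34 1 f * sh34 0 f) = 1 := by rw [map_mul, pf, pc, one_mul]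
    have p₂ : rhoQ N 4 (ca34 2 f * ca34 0 f) = 1 := by rw [map_mul, pc, pc, one_mul]
    -- Splitting a leaf of a tree with three leaves gives six cases for five trees: (12)(34) occurs
    -- both from (12)3 and from 1(23).
    rcases tree_three hy with rfl | rfl <;> fin_cases p
    exacts [map_one _, pf 0, pc 0, pc 0, p₁, p₂]

theorem ascFam_leftComb (f : B 3 ⧸ NPB N.1 3) {n : ℕ} (hn : n + 1 ≤ 4) :
    ascFam f (n + 1) (leftComb n) = 1 := by
  rcases (show n = 0 ∨ n = 1 ∨ n = 2 ∨ n = 3 by omega) with rfl | rfl | rfl | rfl <;> rfl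

theorem ascFam_leftComb_pred (f : B 3 ⧸ NPB N.1 3) {n : ℕ} (hn : 1 ≤ n) (hn' : n ≤ 4) :
    ascFam f n (leftComb (n - 1)) = 1 := by
  obtain ⟨n, rfl⟩ := Nat.exists_eq_add_of_le' hn
  exact ascFam_leftComb f hn'

theorem ascFam_graft_leaf (f : B 3 ⧸ NPB N.1 3) {n : ℕ} (hn' : n ≤ 4) (p : Fin n) :
    ascFam f n (graft (leftComb (n - 1)) p (leftComb (1 - 1))) = 1 := by
  have hn : 1 ≤ n := by have := p.2; omega
  have : graft (leftComb (n - 1)) p (leftComb (1 - 1)) = leftComb (n - 1) :=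
    graft_leaf _ _ (by rw [leftComb_length]; omega)
  rw [this, ascFam_leftComb_pred f hn hn']

theorem ascFam_leaf_graft (f : B 3 ⧸ NPB N.1 3) {n : ℕ} (hn : 1 ≤ n) (hn' : n ≤ 4) (p : Fin 1) :
    ascFam f n (graft (leftComb (1 - 1)) p (leftComb (n - 1))) = 1 :=
  ascFam_leftComb_pred f hn hn'

/-- The definition of `asc4` already agrees with all decompositions but one. The exception is 1(23)
grafted into the second leaf of 12: the resulting tree 1(2(34)) received its value from the other
side of the pentagon. -/
theorem ascFam_graft (d : HexPent a f) {n m k : ℕ} (h : n + m = k + 1) (hm : 1 ≤ m) (hk : k ≤ 4)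
    (p : Fin n) (x y : FreeMagma Unit) (hx : x.length = n) (hy : y.length = m) :
    ascFam f k (graft x p y) =
      cableQ N h hm hk p (ascFam f n x) * shiftQ N h hm hk p (ascFam f m y) *
        ascFam f k (graft (leftComb (n - 1)) p (leftComb (m - 1))) := by
  have hn : 1 ≤ n := by have := p.2; omega
  rcases arity_cases h hn hm hk with ⟨rfl, rfl⟩ | ⟨rfl, rfl⟩ | ⟨rfl, rfl, rfl⟩ | ⟨rfl, rfl, rfl⟩ |
    ⟨rfl, rfl, rfl⟩
  · rw [ascFam_graft_leaf f hk, tree_one hy, graft_leaf _ _ (by omega), cableQ_unit,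
      quo_one_eq (ascFam f 1 _), map_one, mul_one, mul_one]
  · rw [ascFam_leaf_graft f hm hk, tree_one hx, shiftQ_unit, quo_one_eq (ascFam f 1 _), cableQ_one,
      one_mul, mul_one]
    rfl
  · rw [tree_two hx, tree_two hy]
    change _ = ca23 p 1 * sh23 p 1 * _
    rw [cableQ_one, map_one, one_mul, one_mul]
    rfl
  · rw [tree_two hy]
    change _ = ca34 p (asc3 f x) * sh24 p 1 * _
    rw [map_one, mul_one]
    rcases tree_three hx with rfl | rfl
    · change _ = ca34 p 1 * _
      rw [cableQ_one, one_mul]; rfl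
    · fin_cases p
      · exact (mul_one _).symm
      · rfl
      · rfl
  · rw [tree_two hx]
    change _ = ca24 p 1 * sh34 p (asc3 f y) * _
    rw [cableQ_one, one_mul]
    rcases tree_three hy with rfl | rfl
    · change _ = sh34 p 1 * _
      rw [map_one, one_mul]; rfl
    · fin_cases p
      · exact (mul_one _).symm
      · exact d.pent.symm

theorem homFam_cable (d : HexPent a f) {n m k : ℕ} (h : n + m = k + 1) (hm : 1 ≤ m) (hk : k ≤ 4)
    (p : Fin n) (g : B n) :
    ascFam f k (graft (leftComb (n - 1)) (rho n g p : Fin n) (leftComb (m - 1))) *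
        d.homFam k (cable h p g) =
      cableQ N h hm hk p (d.homFam n g) *
        ascFam f k (graft (leftComb (n - 1)) p (leftComb (m - 1))) := by
  have hn : 1 ≤ n := by have := p.2; omega
  rcases arity_cases h hn hm hk with ⟨rfl, rfl⟩ | ⟨rfl, rfl⟩ | ⟨rfl, rfl, rfl⟩ | ⟨rfl, rfl, rfl⟩ |
    ⟨rfl, rfl, rfl⟩
  · rw [ascFam_graft_leaf f hk, ascFam_graft_leaf f hk, cable_unit, cableQ_unit, one_mul, mul_one]
  · rw [B_one_eq g, cable_one, map_one, map_one, map_one, cableQ_one, mul_one, one_mul]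
    rfl
  · exact d.hom3_cable g p
  · exact d.hom4_cable_two g p
  · exact d.hom4_cable_three g p

theorem homFam_shift (d : HexPent a f) {n m k : ℕ} (h : n + m = k + 1) (hm : 1 ≤ m) (hk : k ≤ 4)
    (p : Fin n) (g : B m) :
    ascFam f k (graft (leftComb (n - 1)) p (leftComb (m - 1))) *
        d.homFam k (shift p (ins_bound h p) g) =
      shiftQ N h hm hk p (d.homFam m g) *
        ascFam f k (graft (leftComb (n - 1)) p (leftComb (m - 1))) := by
  have hn : 1 ≤ n := by have := p.2; omega
  rcases arity_cases h hn hm hk with ⟨rfl, rfl⟩ | ⟨rfl, rfl⟩ | ⟨rfl, rfl, rfl⟩ | ⟨rfl, rfl, rfl⟩ |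
    ⟨rfl, rfl, rfl⟩
  · rw [B_one_eq g, map_one, map_one, map_one, map_one, mul_one, one_mul]
  · rw [ascFam_leaf_graft f hm hk, shift_zero, shiftQ_unit, one_mul, mul_one]
  · exact d.hom3_shift p g
  · exact d.hom4_shift_two p g
  · exact d.hom4_shift_three p g

/-- The coherent data determined by a solution of the hexagon and pentagon relations. -/
def coherentData (d : HexPent a f) : CoherentData N where
  hom := d.homFam
  asc := ascFam f
  rho_hom {n} h₁ h₂ g := by
    rcases (show n = 1 ∨ n = 2 ∨ n = 3 ∨ n = 4 by omega) with rfl | rfl | rfl | rfl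
    · rw [B_one_eq g, map_one, map_one, map_one]
    · exact d.rho_hom2 g
    · exact d.rho_hom3 g
    · exact d.rho_hom4 g
  rho_asc h₁ h₂ _ hx := d.rho_ascFam h₁ h₂ hx
  asc_leftComb := ascFam_leftComb f
  asc_graft := d.ascFam_graft
  hom_cable := d.homFam_cable
  hom_shift := d.homFam_shift

end HexPent

/-! ### Coherent data satisfy the hexagons and the pentagon -/

namespace CoherentData

variable (D D' : CoherentData N)

theorem asc_two {x : FreeMagma Unit} (hx : x.length = 2) : D.asc 2 x = 1 := by
  rw [tree_two hx]; exact D.asc_leftComb (n := 1) (by omega)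

theorem asc_graft_two (p : Fin 3) (x : FreeMagma Unit) (hx : x.length = 3) :
    D.asc 4 (graft x p (leftComb 1)) =
      ca34 p (D.asc 3 x) * D.asc 4 (graft (leftComb 2) p (leftComb 1)) := by
  have := D.asc_graft split_three_two one_le_two_nat four_le_four p x (leftComb 1) hx rfl
  rwa [D.asc_two rfl, map_one, mul_one] at this

theorem asc_graft_three (p : Fin 2) (x : FreeMagma Unit) (hx : x.length = 3) :
    D.asc 4 (graft (leftComb 1) p x) =
      sh34 p (D.asc 3 x) * D.asc 4 (graft (leftComb 1) p (leftComb 2)) := by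
  have := D.asc_graft split_two_three one_le_three four_le_four p (leftComb 1) x rfl hx
  rwa [D.asc_two rfl, cableQ_one, one_mul] at this

theorem asc_split_zero : D.asc 4 (graft (leftComb 2) (0 : Fin 3) (leftComb 1)) = 1 :=
  D.asc_leftComb (n := 3) le_rfl

/-- The tree (1(23))4 is also 1(23) grafted into the first leaf of 12, and the comparison tree for
that graft is left-normed. -/
theorem asc_split_one : D.asc 4 (graft (leftComb 2) (1 : Fin 3) (leftComb 1)) =
    sh34 0 (D.asc 3 rightTree) := by
  refine (D.asc_graft_three 0 rightTree rfl).trans ?_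
  exact (congrArg _ (D.asc_leftComb (n := 3) le_rfl)).trans (mul_one _)

/-- The tree (12)(34) is also obtained by splitting the first leaf of 1(23), and the comparison tree
for that splitting is left-normed. -/
theorem asc_split_two : D.asc 4 (graft (leftComb 2) (2 : Fin 3) (leftComb 1)) =
    ca34 0 (D.asc 3 rightTree) := by
  refine (D.asc_graft_two 0 rightTree rfl).trans ?_
  exact (congrArg _ D.asc_split_zero).trans (mul_one _)

/-- The tree 1(2(34)) arises by grafting 1(23) into the last leaf of 12 and by splitting the last
leaf of 1(23); the two evaluations of its associator are the two sides. In the first, the comparison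
tree is 1((23)4), itself obtained by splitting the middle leaf of 1(23). -/
theorem asc_pentagon : sh34 1 (D.asc 3 rightTree) *
    (ca34 1 (D.asc 3 rightTree) * sh34 0 (D.asc 3 rightTree)) =
      ca34 2 (D.asc 3 rightTree) * ca34 0 (D.asc 3 rightTree) := by
  rw [← D.asc_split_one, ← D.asc_split_two, ← D.asc_graft_two 1 rightTree rfl,
    ← D.asc_graft_two 2 rightTree rfl]
  exact (D.asc_graft_three 1 rightTree rfl).symm

/-- The hexagon and pentagon relations hold for all coherent data. -/
theorem hexPent : HexPent (D.hom 2 (s 2 0)) (D.asc 3 rightTree) := by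
  have l : D.asc 3 (leftComb 2) = 1 := D.asc_leftComb (n := 2) (by omega)
  have h₀ : D.asc 3 (leftComb 2) * D.hom 3 (shift 0 (ins_bound split_two_two 0) (s 2 0)) =
      sh23 0 (D.hom 2 (s 2 0)) * D.asc 3 (leftComb 2) :=
    D.hom_shift split_two_two one_le_two_nat three_le_four 0 (s 2 0)
  have h₁ : D.asc 3 rightTree * D.hom 3 (shift 1 (ins_bound split_two_two 1) (s 2 0)) =
      sh23 1 (D.hom 2 (s 2 0)) * D.asc 3 rightTree :=
    D.hom_shift split_two_two one_le_two_nat three_le_four 1 (s 2 0)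
  rw [l, one_mul, mul_one, shift_s _ (by omega), zero_add] at h₀
  rw [shift_s _ (by omega), add_zero, ← eq_inv_mul_iff_mul_eq, ← mul_assoc] at h₁
  -- The law of cabling for σ₁, at the strand passing each way, becomes a hexagon once `h₀` and `h₁`
  -- express the images of the two generators of `B 3`.
  have c₀ := D.hom_cable split_two_two one_le_two_nat three_le_four 0 (s 2 0)
  have c₁ := D.hom_cable split_two_two one_le_two_nat three_le_four 1 (s 2 0)
  rw [rho_s (by omega), cable_s _ _ (by omega)] at c₀ c₁
  have c₀' : D.asc 3 rightTree * D.hom 3 (1 * s 3 0 * s 3 1) =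
    ca23 0 (D.hom 2 (s 2 0)) * D.asc 3 (leftComb 2) := c₀
  have c₁' : D.asc 3 (leftComb 2) * D.hom 3 (s 3 1 * (s 3 0 * 1)) =
    ca23 1 (D.hom 2 (s 2 0)) * D.asc 3 rightTree := c₁
  rw [l, one_mul, mul_one, map_mul, h₀, h₁] at c₀'
  rw [l, one_mul, mul_one, map_mul, h₀, h₁] at c₁'
  refine ⟨?_, D.rho_asc (by omega) (by omega) _ rfl, c₀', c₁', D.asc_pentagon⟩
  rw [D.rho_hom (by omega) (by omega), rho_s (by omega)]

/-! ### Coherent data are determined by two values -/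

variable {D D'}

/-- Every tree with four leaves is a split tree with three leaves, and 1(23) is the only tree with
three leaves whose associator is not forced to be trivial. -/
theorem asc_eq (h : D.asc 3 rightTree = D'.asc 3 rightTree) {n : ℕ} (hn : 1 ≤ n) (hn' : n ≤ 4)
    {x : FreeMagma Unit} (hx : x.length = n) : D.asc n x = D'.asc n x := by
  rcases (show n = 1 ∨ n = 2 ∨ n = 3 ∨ n = 4 by omega) with rfl | rfl | rfl | rfl
  · rw [quo_one_eq (D.asc 1 x), quo_one_eq (D'.asc 1 x)]
  · rw [D.asc_two hx, D'.asc_two hx]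
  · rcases tree_three hx with rfl | rfl
    · exact (D.asc_leftComb (n := 2) (by omega)).trans (D'.asc_leftComb (n := 2) (by omega)).symm
    · exact h
  · have e : ∀ p : Fin 3, D.asc 4 (graft (leftComb 2) p (leftComb 1)) =
        D'.asc 4 (graft (leftComb 2) p (leftComb 1)) := fun p => by
      fin_cases p
      · exact D.asc_split_zero.trans D'.asc_split_zero.symm
      · exact (D.asc_split_one.trans (by rw [h])).trans D'.asc_split_one.symm
      · exact (D.asc_split_two.trans (by rw [h])).trans D'.asc_split_two.symm
    obtain ⟨y, p, hy, rfl⟩ := tree_four hx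
    rw [D.asc_graft_two p y hy, D'.asc_graft_two p y hy, e]
    rcases tree_three hy with rfl | rfl
    · rw [show D.asc 3 (leftComb 2) = D'.asc 3 (leftComb 2) from
        (D.asc_leftComb (n := 2) (by omega)).trans (D'.asc_leftComb (n := 2) (by omega)).symm]
    · rw [h]

theorem hom_eq (h : D.asc 3 rightTree = D'.asc 3 rightTree)
    (h' : D.hom 2 (s 2 0) = D'.hom 2 (s 2 0)) {n : ℕ} (hn : 1 ≤ n) (hn' : n ≤ 4) (g : B n) :
    D.hom n g = D'.hom n g := by
  induction g using B_induction with
  | one => rw [map_one, map_one]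
  | gen i hi =>
    -- The generator at position `i` is σ₁ of `B 2` inserted at position `i` among `n - 1` strands,
    -- so the law of juxtaposition determines its image.
    have hk : (n - 1) + 2 = n + 1 := by omega
    have e := D.hom_shift hk one_le_two_nat hn' ⟨i, by omega⟩ (s 2 0)
    have e' := D'.hom_shift hk one_le_two_nat hn' ⟨i, by omega⟩ (s 2 0)
    have hl : (graft (leftComb (n - 1 - 1)) i (leftComb (2 - 1))).length = n := by
      have := graft_length (leftComb (n - 1 - 1)) i (leftComb (2 - 1))
        (by rw [leftComb_length]; omega)
      rw [leftComb_length, leftComb_length] at this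
      omega
    rw [shift_s _ (by omega), asc_eq h hn hn' hl, h'] at e
    rw [shift_s _ (by omega)] at e'
    exact mul_left_cancel (e.trans e'.symm)
  | mul a b ha hb => rw [map_mul, map_mul, ha, hb]
  | inv a ha => rw [map_inv, map_inv, ha]

theorem val_eq (h : D.asc 3 rightTree = D'.asc 3 rightTree)
    (h' : D.hom 2 (s 2 0) = D'.hom 2 (s 2 0)) {n : ℕ} (hn : 1 ≤ n) (hn' : n ≤ 4) (γ : PaBMor n) :
    D.val γ = D'.val γ := by
  rw [val, val, asc_eq h hn hn' γ.tgt.len, asc_eq h hn hn' γ.src.len, hom_eq h h' hn hn']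

/-! ### Kernels of the induced homomorphisms -/

variable (D)

/-- The law of juxtaposition has the same associator on both sides, so the two elements are
conjugate. -/
theorem shiftQ_hom_eq_one {n m k : ℕ} (h : n + m = k + 1) (hm : 1 ≤ m) (hk : k ≤ 4) (p : Fin n)
    (g : B m) : shiftQ N h hm hk p (D.hom m g) = 1 ↔
      D.hom k (shift p (ins_bound h p) g) = 1 := by
  have e := D.hom_shift h hm hk p g
  rw [← mul_inv_eq_iff_eq_mul] at e
  rw [← e, mul_inv_eq_one, mul_eq_left]

/-- Purity returns the strand to position `p`; then both sides of the cabling law carry the same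
associator and the two elements are conjugate. -/
theorem cableQ_hom_eq_one {n m k : ℕ} (h : n + m = k + 1) (hm : 1 ≤ m) (hk : k ≤ 4) (p : Fin n)
    {g : B n} (hg : rho n g = 1) : cableQ N h hm hk p (D.hom n g) = 1 ↔
      D.hom k (cable h p g) = 1 := by
  have e := D.hom_cable h hm hk p g
  rw [hg, Equiv.Perm.one_apply, ← mul_inv_eq_iff_eq_mul] at e
  rw [← e, mul_inv_eq_one, mul_eq_left]

theorem mem_PB_of_hom_eq_one {n : ℕ} (hn : 1 ≤ n) (hn' : n ≤ 4) {g : B n} (hg : D.hom n g = 1) :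
    g ∈ PB n := by
  rw [mem_PB, ← D.rho_hom hn hn', hg, map_one]

/-- The kernels of the induced homomorphisms are determined by the kernel in arity four. -/
theorem mem_NPB_ker {n : ℕ} (hn : 1 ≤ n) (hn' : n ≤ 4) (g : B n) :
    g ∈ NPB (D.hom 4).ker n ↔ D.hom n g = 1 := by
  -- Membership and triviality are both tested by the same insertions, and the two tests agree by
  -- conjugacy. Arity two is then treated by the same argument over arity three.
  have h₃ : ∀ g : B 3, g ∈ NPB3 (D.hom 4).ker ↔ D.hom 3 g = 1 := fun g => by
    rw [mem_NPB3, quo_three_eq_one_iff, D.rho_hom (by omega) (by omega), mem_PB]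
    refine and_congr_right fun hg => and_congr (forall_congr' fun p => ?_)
      (forall_congr' fun p => ?_)
    · exact (D.shiftQ_hom_eq_one _ _ _ p g).symm
    · exact (D.cableQ_hom_eq_one _ _ _ p hg).symm
  rcases (show n = 1 ∨ n = 2 ∨ n = 3 ∨ n = 4 by omega) with rfl | rfl | rfl | rfl
  · rw [B_one_eq g, map_one]
    exact ⟨fun _ => rfl, fun _ => one_mem _⟩
  · change g ∈ NPB2 _ ↔ _
    rw [mem_NPB2, quo_two_eq_one_iff, D.rho_hom (by omega) (by omega), mem_PB]
    refine and_congr_right fun hg => and_congr (forall_congr' fun p => ?_)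
      (forall_congr' fun p => ?_)
    · rw [h₃]; exact (D.shiftQ_hom_eq_one _ _ _ p g).symm
    · rw [h₃]; exact (D.cableQ_hom_eq_one _ _ _ p hg).symm
  · exact h₃ g
  · exact Iff.rfl

theorem val_eq_iff {n : ℕ} (hn : 1 ≤ n) (hn' : n ≤ 4) {γ γ' : PaBMor n} (hs : γ.src = γ'.src)
    (ht : γ.tgt = γ'.tgt) :
    D.val γ = D.val γ' ↔ γ.braid⁻¹ * γ'.braid ∈ NPB (D.hom 4).ker n := by
  rw [D.mem_NPB_ker hn hn', val, val, hs, ht, mul_left_inj, mul_right_inj, map_mul, map_inv,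
    inv_mul_eq_one]

end CoherentData

end

/-! ## Braids on two strands -/

theorem exists_zpow_s (g : B 2) : ∃ k : ℤ, g = s 2 0 ^ k := by
  induction g using B_induction with
  | one => exact ⟨0, (zpow_zero _).symm⟩
  | gen i hi =>
    obtain rfl : i = 0 := by omega
    exact ⟨1, (zpow_one _).symm⟩
  | mul a b ha hb =>
    obtain ⟨k, rfl⟩ := ha
    obtain ⟨l, rfl⟩ := hb
    exact ⟨k + l, (zpow_add _ _ _).symm⟩
  | inv a ha =>
    obtain ⟨k, rfl⟩ := ha
    exact ⟨-k, (zpow_neg _ _).symm⟩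

theorem exists_zpow_sq {g : B 2} (hg : rho 2 g = 1) : ∃ j : ℤ, g = (s 2 0 ^ 2) ^ j := by
  have h2 : rho 2 (s 2 0 ^ 2) = 1 := mem_PB.1 x12.2
  have e2 : (s 2 0 ^ 2 : B 2) = s 2 0 ^ (2 : ℤ) := (zpow_natCast _ 2).symm
  obtain ⟨k, rfl⟩ := exists_zpow_s g
  rcases Int.even_or_odd' k with ⟨j, rfl | rfl⟩
  · exact ⟨j, by rw [e2, ← zpow_mul]⟩
  -- An odd power of σ₁ maps to the transposition, which is not the identity.
  · rw [zpow_add, zpow_mul, ← e2, map_mul, map_zpow, h2, one_zpow, one_mul, zpow_one,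
      rho_s (by omega)] at hg
    exact absurd hg (by decide)

theorem exists_zpow_x12 (g : PB 2) : ∃ j : ℤ, g = x12 ^ j := by
  obtain ⟨j, hj⟩ := exists_zpow_sq (mem_PB.1 g.2)
  exact ⟨j, Subtype.ext (by rw [hj]; rfl)⟩

theorem exists_odd_zpow {g : B 2} (hg : rho 2 g = tr 2 0) :
    ∃ j : ℤ, g = s 2 0 * (s 2 0 ^ 2) ^ j := by
  obtain ⟨j, hj⟩ := exists_zpow_sq (g := (s 2 0)⁻¹ * g) (by
    rw [map_mul, map_inv, hg, rho_s (by omega), inv_mul_cancel])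
  exact ⟨j, by rw [← hj, mul_inv_cancel_left]⟩

theorem mk_eq_mk_iff_subgroupOf {G : Type*} [Group G] {H K : Subgroup G} (a b : K) :
    (QuotientGroup.mk a : K ⧸ H.subgroupOf K) = QuotientGroup.mk b ↔
      (QuotientGroup.mk (a : G) : G ⧸ H) = QuotientGroup.mk (b : G) := by
  rw [QuotientGroup.eq, QuotientGroup.eq, Subgroup.mem_subgroupOf]; rfl

/-- The power of `x₁₂` modulo `N_{PB₂}` determines the exponent modulo `N_ord`. -/
theorem mk_zpow_eq_iff (N : NFI) (m m' : ℤ) :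
    (QuotientGroup.mk ((x12 ^ m : PB 2) : B 2) : B 2 ⧸ NPB N.1 2) =
      QuotientGroup.mk ((x12 ^ m' : PB 2) : B 2) ↔ (m : ZMod (Nord N)) = m' := by
  -- The class of x₁₂ generates `PB 2` modulo `NPB N.1 2`, so its order is the cardinality of that
  -- quotient, which is the index `Nord N`.
  have hc : orderOf (QuotientGroup.mk x12 : PB 2 ⧸ (NPB N.1 2).subgroupOf (PB 2)) = Nord N := by
    refine orderOf_eq_card_of_forall_mem_zpowers fun y => ?_
    obtain ⟨y, rfl⟩ := QuotientGroup.mk_surjective y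
    obtain ⟨j, rfl⟩ := exists_zpow_x12 y
    exact ⟨j, rfl⟩
  rw [← mk_eq_mk_iff_subgroupOf, QuotientGroup.mk_zpow, QuotientGroup.mk_zpow,
    zpow_eq_zpow_iff_modEq, hc, ZMod.intCast_eq_intCast_iff]

theorem cable_zpow {n m k : ℕ} (h : n + m = k + 1) (p : Fin n) {g : B n} (hg : rho n g = 1)
    (j : ℤ) : cable h p (g ^ j) = cable h p g ^ j :=
  congrArg Subtype.val (map_zpow (cablePB h p) (⟨g, mem_PB.2 hg⟩ : PB n) j)

/-! ## GT-pairs -/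

theorem pairMk_eq_iff {N : NFI} {m m' : ℤ} {f f' : PB 3} : pairMk N m f = pairMk N m' f' ↔
    (m : ZMod (Nord N)) = m' ∧
      (QuotientGroup.mk (f : B 3) : B 3 ⧸ NPB N.1 3) = QuotientGroup.mk (f' : B 3) := by
  rw [pairMk, pairMk, Prod.mk.injEq, mk_eq_mk_iff_subgroupOf]

/-- The class of the image `σ₁ x₁₂^m` of the braiding. -/
def oddBraid (N : NFI) (m : ℤ) : B 2 ⧸ NPB N.1 2 :=
  QuotientGroup.mk (s 2 0 * ((x12 ^ m : PB 2) : B 2))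

theorem rhoQ_oddBraid (N : NFI) (m : ℤ) : rhoQ N 2 (oddBraid N m) = tr 2 0 := by
  rw [oddBraid, rhoQ_mk, map_mul, mem_PB.1 (x12 ^ m : PB 2).2, mul_one, rho_s (by omega)]

theorem oddBraid_eq_iff (N : NFI) (m m' : ℤ) :
    oddBraid N m = oddBraid N m' ↔ (m : ZMod (Nord N)) = m' := by
  rw [← mk_zpow_eq_iff, oddBraid, oddBraid, QuotientGroup.mk_mul, QuotientGroup.mk_mul,
    mul_right_inj]

/-- The relations in terms of x₁₂, x₂₃, x₁₃ are the abstract hexagons with both cables of σ₁x₁₂^m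
computed explicitly. The pentagon agrees up to bracketing. -/
theorem isGTPair_iff (N : NFI) (m : ℤ) (f : PB 3) :
    IsGTPair N m f ↔ HexPent (oddBraid N m) (QuotientGroup.mk (f : B 3) : B 3 ⧸ NPB N.1 3) := by
  have hx : rho 2 (s 2 0 ^ 2) = 1 := mem_PB.1 x12.2
  have ea : oddBraid N m = QuotientGroup.mk (s 2 0 * (s 2 0 ^ 2) ^ m) := rfl
  have sh : ∀ p : Fin 2, shiftQ N split_two_two one_le_two_nat three_le_four p (oddBraid N m) =
      QuotientGroup.mk (s 3 p * (s 3 p ^ 2) ^ m) := fun p => by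
    rw [ea, shiftQ_mk, map_mul, map_zpow, map_pow, shift_s _ (by omega), add_zero]
  have ca : ∀ p : Fin 2, cableQ N split_two_two one_le_two_nat three_le_four p (oddBraid N m) =
      QuotientGroup.mk (thick 3 2 0 p * (thick 3 2 0 (tr 2 0 p) * thick 3 2 0 p) ^ m) := fun p => by
    rw [ea, cableQ_mk, cable_mul, map_zpow, hx, one_zpow, cable_zpow _ _ hx, pow_two, cable_mul,
      cable_s _ _ (by omega), cable_s _ _ (by omega), cable_s _ _ (by omega), rho_s (by omega)]
    rfl
  have br := s_braid (n := 3) (i := 0) (by omega)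
  -- The cable of σ₁² along the first strand is σ₂σ₁²σ₂, which is x₁₃x₂₃.
  have ca₀ : cableQ N split_two_two one_le_two_nat three_le_four 0 (oddBraid N m) =
      QuotientGroup.mk (s 3 0 * s 3 1 * (s 3 1 * s 3 0 ^ 2 * (s 3 1)⁻¹ * s 3 1 ^ 2) ^ m) := by
    refine (ca 0).trans ?_
    change QuotientGroup.mk (1 * s 3 0 * s 3 1 *
      (s 3 1 * (s 3 0 * 1) * (1 * s 3 0 * s 3 1)) ^ m) = _
    simp only [pow_two, mul_assoc, inv_mul_cancel_left, one_mul, mul_one]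
  have ca₁ : cableQ N split_two_two one_le_two_nat three_le_four 1 (oddBraid N m) =
      QuotientGroup.mk (s 3 1 * s 3 0 * (s 3 0 ^ 2 * (s 3 1 * s 3 0 ^ 2 * (s 3 1)⁻¹)) ^ m) := by
    refine (ca 1).trans ?_
    change QuotientGroup.mk (s 3 1 * (s 3 0 * 1) *
      (1 * s 3 0 * s 3 1 * (s 3 1 * (s 3 0 * 1))) ^ m) = _
    -- Along the second strand the cable of σ₁² is σ₁σ₂²σ₁, and two uses of the braid relation
    -- identify it with x₁₂x₁₃.
    have e : s 3 0 * s 3 1 * (s 3 1 * s 3 0) =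
        s 3 0 ^ 2 * (s 3 1 * s 3 0 ^ 2 * (s 3 1)⁻¹) := by
      change s 3 0 * s 3 1 * s 3 0 = s 3 1 * s 3 0 * s 3 1 at br
      have h₁ : s 3 0 ^ 2 * (s 3 1 * s 3 0 ^ 2 * (s 3 1)⁻¹) =
        s 3 0 * (s 3 0 * s 3 1 * s 3 0) * s 3 0 * (s 3 1)⁻¹ := by
        simp only [pow_two, mul_assoc]
      have h₂ : s 3 0 * (s 3 1 * s 3 0 * s 3 1) * s 3 0 * (s 3 1)⁻¹ =
        s 3 0 * s 3 1 * (s 3 0 * s 3 1 * s 3 0) * (s 3 1)⁻¹ := by group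
      rw [h₁, br, h₂, br]
      group
    rw [one_mul, mul_one, e]
  have hex₁ : ((QuotientGroup.mk (s 3 0 * (s 3 0 ^ 2) ^ m * (f : B 3)⁻¹ *
      (s 3 1 * (s 3 1 ^ 2) ^ m) * f) : B 3 ⧸ NPB N.1 3) = QuotientGroup.mk ((f : B 3)⁻¹ *
      (s 3 0 * s 3 1) * (s 3 1 * s 3 0 ^ 2 * (s 3 1)⁻¹ * s 3 1 ^ 2) ^ m)) ↔
      (QuotientGroup.mk (f : B 3) : B 3 ⧸ NPB N.1 3) *
        (shiftQ N split_two_two one_le_two_nat three_le_four 0 (oddBraid N m) *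
          ((QuotientGroup.mk (f : B 3))⁻¹ *
            shiftQ N split_two_two one_le_two_nat three_le_four 1 (oddBraid N m) *
              QuotientGroup.mk (f : B 3))) =
        cableQ N split_two_two one_le_two_nat three_le_four 0 (oddBraid N m) := by
    -- The two forms of the first hexagon differ by left multiplication by `f`.
    rw [ca₀, sh 0, sh 1, mul_assoc (f : B 3)⁻¹, QuotientGroup.mk_mul _ (f : B 3)⁻¹ (_ * _),
      QuotientGroup.mk_inv, eq_inv_mul_iff_mul_eq]
    simp only [← QuotientGroup.mk_mul, ← QuotientGroup.mk_inv, mul_assoc]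
    rfl
  have hex₂ : ((QuotientGroup.mk ((f : B 3)⁻¹ * (s 3 1 * (s 3 1 ^ 2) ^ m) * f *
      (s 3 0 * (s 3 0 ^ 2) ^ m)) : B 3 ⧸ NPB N.1 3) = QuotientGroup.mk (s 3 1 * s 3 0 *
      (s 3 0 ^ 2 * (s 3 1 * s 3 0 ^ 2 * (s 3 1)⁻¹)) ^ m * f)) ↔
      (QuotientGroup.mk (f : B 3) : B 3 ⧸ NPB N.1 3)⁻¹ *
        shiftQ N split_two_two one_le_two_nat three_le_four 1 (oddBraid N m) *
          QuotientGroup.mk (f : B 3) *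
        shiftQ N split_two_two one_le_two_nat three_le_four 0 (oddBraid N m) =
        cableQ N split_two_two one_le_two_nat three_le_four 1 (oddBraid N m) *
          QuotientGroup.mk (f : B 3) := by
    rw [ca₁, sh 0, sh 1]; rfl
  constructor
  · rintro ⟨h₁, h₂, h₃⟩
    refine ⟨rhoQ_oddBraid N m, mem_PB.1 f.2, hex₁.1 h₁, hex₂.1 h₂, ?_⟩
    rw [← mul_assoc]
    exact h₃
  · rintro ⟨-, -, h₁, h₂, h₃⟩
    refine ⟨hex₁.2 h₁, hex₂.2 h₂, ?_⟩
    rw [← mul_assoc] at h₃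
    exact h₃

/-! ## Morphisms that realize a GT-pair -/

section

variable {N : NFI} {T : PaB ⟶ Quo N}

/-- A morphism of operads is required to be equivariant on morphisms only; the statement for objects
is recovered from the source of an identity morphism. The same device serves for insertions. -/
theorem ob_act (T : PaB ⟶ Quo N) {n : Arity} (θ : Equiv.Perm (Fin n)) (x : PaB.Ob n) :
    T.ob (PaB.actOb θ x) = (Quo N).actOb θ (T.ob x) := by
  have h₁ := T.map_src (PaB.act θ (PaB.ident x))
  rw [T.map_act, PaB.src_act, PaB.src_ident, (Quo N).src_act, T.map_src, PaB.src_ident] at h₁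
  exact h₁.symm

theorem ob_ins (T : PaB ⟶ Quo N) {n m k : Arity} (h : (n : ℕ) + m = k + 1) (i : Fin n)
    (x : PaB.Ob n) (y : PaB.Ob m) :
    T.ob (PaB.insOb h i x y) = (Quo N).insOb h i (T.ob x) (T.ob y) := by
  have h₁ := T.map_src (PaB.ins h i (PaB.ident x) (PaB.ident y))
  rw [T.map_ins, PaB.src_ins, PaB.src_ident, PaB.src_ident, (Quo N).src_ins, T.map_src, T.map_src,
    PaB.src_ident, PaB.src_ident] at h₁
  exact h₁.symm

/-- The prescribed images of α and β fix their sources and targets, which with the operadic unit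
give all trees with at most three leaves carrying the trivial labelling. Trees with four leaves
follow by insertion, and other labellings by the symmetric groups. -/
theorem idOnOb_of_values {f : PB 3} {g : PB 2} (hα : T.mor alpha = (projN N).mor (alphaMul f))
    (hβ : T.mor beta = (projN N).mor (betaMul g)) : IdOnOb T := by
  have o₁ : T.ob PaB.unit = PaB.unit := T.map_unit
  have o₂ : T.ob (stdOb ar2 1) = stdOb ar2 1 := by
    have := T.map_src beta
    rw [hβ] at this
    exact this.symm
  have o₃ : T.ob (stdOb ar3 1) = stdOb ar3 1 := by
    have := T.map_src alpha
    rw [hα] at this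
    exact this.symm
  have o₃' : T.ob (PaB.tgt alpha) = PaB.tgt alpha := by
    have := T.map_tgt alpha
    rw [hα] at this
    exact this.symm
  have key₃ : ∀ (x : FreeMagma Unit) (hx : x.length = 3),
      T.ob (n := ar3) (⟨x, hx, 1⟩ : PaBOb 3) = (⟨x, hx, 1⟩ : PaBOb 3) := fun x hx => by
    rcases tree_three hx with rfl | rfl
    · exact o₃
    · exact o₃'
  have key : ∀ (n : Arity) (x : FreeMagma Unit) (hx : x.length = n),
      T.ob (n := n) (⟨x, hx, 1⟩ : PaBOb n) = (⟨x, hx, 1⟩ : PaBOb n) := by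
    rintro ⟨n, hn, hn'⟩ x hx
    rcases (show n = 1 ∨ n = 2 ∨ n = 3 ∨ n = 4 by omega) with rfl | rfl | rfl | rfl
    · obtain rfl := tree_one hx
      exact o₁
    · obtain rfl := tree_two hx
      exact o₂
    · exact key₃ x hx
    · obtain ⟨y, p, hy, rfl⟩ := tree_four hx
      have e : PaB.insOb (n := ar3) (m := ar2) (k := ar4) split_three_two p
          (⟨y, hy, 1⟩ : PaBOb 3) (stdOb ar2 1) =
          (⟨graft y p (leftComb 1), hx, 1⟩ : PaBOb 4) :=
        PaBOb.ext rfl (insPerm_one _ _)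
      have := ob_ins T (n := ar3) (m := ar2) (k := ar4) split_three_two p
          (⟨y, hy, 1⟩ : PaBOb 3) (stdOb ar2 1)
      rw [key₃, o₂, e] at this
      exact this.trans e
  intro n x
  have e : PaB.actOb (PaBOb.perm x) (⟨PaBOb.shape x, PaBOb.len x, 1⟩ : PaBOb n) = x :=
    PaBOb.ext rfl (mul_one _)
  have := ob_act T (PaBOb.perm x) (⟨PaBOb.shape x, PaBOb.len x, 1⟩ : PaBOb n)
  rw [key, e] at this
  exact this.trans e

theorem idOnOb_of_realizes {p : Pair N} (h : Realizes N p T) : IdOnOb T := by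
  obtain ⟨m, f, -, hα, hβ⟩ := h
  exact idOnOb_of_values hα hβ

theorem mor_alpha_iff (hT : IdOnOb T) (f : PB 3) : T.mor alpha = (projN N).mor (alphaMul f) ↔
    (CoherentData.ofHom hT).asc 3 rightTree = QuotientGroup.mk (f : B 3) := by
  have e₁ : (CoherentData.ofHom hT).asc 3 rightTree = ouQ N (T.mor alpha) :=
    ascOf_eq T ar3 rightTree rfl
  have e₂ : ouQ N ((projN N).mor (alphaMul f)) = QuotientGroup.mk (f : B 3) :=
    congrArg QuotientGroup.mk (one_mul (f : B 3))
  rw [e₁, ← e₂]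
  exact ⟨fun h => by rw [h], fun h => quo_ext (src_mor hT alpha) (tgt_mor hT alpha) h⟩

theorem mor_beta_iff (hT : IdOnOb T) (m : ℤ) :
    T.mor beta = (projN N).mor (betaMul (x12 ^ m)) ↔
      (CoherentData.ofHom hT).hom 2 (s 2 0) = oddBraid N m := by
  have e₁ : (CoherentData.ofHom hT).hom 2 (s 2 0) = ouQ N (T.mor beta) :=
    congrArg (fun φ : B 2 →* _ => φ (s 2 0)) (homOf_eq T ar2)
  have e₂ : ouQ N ((projN N).mor (betaMul (x12 ^ m))) = oddBraid N m := rfl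
  rw [e₁, ← e₂]
  exact ⟨fun h => by rw [h], fun h => quo_ext (src_mor hT beta) (tgt_mor hT beta) h⟩

/-- The conditions on α and β depend only on the classes of `f` and of σ₁x₁₂^m, so any
representative of the pair may be used. -/
theorem realizes_iff (hT : IdOnOb T) (m : ℤ) (f : PB 3) : Realizes N (pairMk N m f) T ↔
    (CoherentData.ofHom hT).asc 3 rightTree = QuotientGroup.mk (f : B 3) ∧
      (CoherentData.ofHom hT).hom 2 (s 2 0) = oddBraid N m := by
  constructor
  · rintro ⟨m', f', h, hα, hβ⟩
    rw [pairMk_eq_iff, ← oddBraid_eq_iff] at h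
    exact ⟨((mor_alpha_iff hT f').1 hα).trans h.2, ((mor_beta_iff hT m').1 hβ).trans h.1⟩
  · rintro ⟨hα, hβ⟩
    exact ⟨m, f, rfl, (mor_alpha_iff hT f).2 hα, (mor_beta_iff hT m).2 hβ⟩

theorem hom_ext {T' : PaB ⟶ Quo N} (hT : IdOnOb T) (hT' : IdOnOb T')
    (h : ∀ (n : Arity) (γ : PaB.Mor n), ouQ N (T.mor γ) = ouQ N (T'.mor γ)) : T = T' := by
  refine TruncatedOperad.Hom.ext ?_ ?_
  · funext n x; exact (hT n x).trans (hT' n x).symm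
  · funext n γ
    exact quo_ext ((src_mor hT γ).trans (src_mor hT' γ).symm)
      ((tgt_mor hT γ).trans (tgt_mor hT' γ).symm) (h n γ)

/-- A morphism is determined by the GT-pair that it realizes. -/
theorem realizes_unique {p : Pair N} {T' : PaB ⟶ Quo N} (h : Realizes N p T)
    (h' : Realizes N p T') : T = T' := by
  have hT := idOnOb_of_realizes h
  have hT' := idOnOb_of_realizes h'
  obtain ⟨m, f, rfl, -⟩ := id h
  have k := (realizes_iff hT m f).1 h
  have k' := (realizes_iff hT' m f).1 h'
  refine hom_ext hT hT' fun n γ => ?_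
  rw [ouQ_mor_eq_val hT, ouQ_mor_eq_val hT']
  exact CoherentData.val_eq (k.1.trans k'.1.symm) (k.2.trans k'.2.symm) n.2.1 n.2.2 γ

/-- The images of α and β give back the class of `f` and, through the odd braid, the exponent modulo
`Nord N`. -/
theorem pair_unique {p p' : Pair N} (h : Realizes N p T) (h' : Realizes N p' T) : p = p' := by
  have hT := idOnOb_of_realizes h
  obtain ⟨m, f, rfl, -⟩ := id h
  obtain ⟨m', f', rfl, -⟩ := id h'
  have k := (realizes_iff hT m f).1 h
  have k' := (realizes_iff hT m' f').1 h'
  rw [pairMk_eq_iff, ← oddBraid_eq_iff]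
  exact ⟨k.2.symm.trans k'.2, k.1.symm.trans k'.1⟩

/-- The hexagons and the pentagon produce coherent data, and the resulting morphism takes the
prescribed values on α and β by construction. -/
theorem exists_realizes {p : Pair N} (hp : p ∈ GTpr N) : ∃ T : PaB ⟶ Quo N, Realizes N p T := by
  obtain ⟨m, f, rfl, h⟩ := hp
  have d := (isGTPair_iff N m f).1 h
  refine ⟨d.coherentData.toHom, m, f, rfl, quo_ext rfl rfl ?_, quo_ext rfl rfl ?_⟩
  · refine (d.coherentData.ouQ_toHom alpha).trans ?_
    change (QuotientGroup.mk (f : B 3) : B 3 ⧸ NPB N.1 3) * d.hom3 1 * 1⁻¹ =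
      QuotientGroup.mk (1 * (f : B 3))
    rw [map_one, mul_one, inv_one, mul_one, one_mul]
  · refine (d.coherentData.ouQ_toHom beta).trans ?_
    change 1 * HexPent.hom2 (oddBraid N m) (s 2 0) * 1⁻¹ = oddBraid N m
    rw [HexPent.hom2_s, one_mul, inv_one, mul_one]

theorem realizes_Tmf {p : Pair N} (hp : p ∈ GTpr N) : Realizes N p (Tmf N p) :=
  Classical.epsilon_spec (exists_realizes hp)

/-- Every morphism that acts as the identity on objects comes from a GT-pair. -/
theorem exists_pair (hT : IdOnOb T) : ∃ p ∈ GTpr N, Realizes N p T := by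
  have d := (CoherentData.ofHom hT).hexPent
  obtain ⟨f, hf⟩ := QuotientGroup.mk_surjective ((CoherentData.ofHom hT).asc 3 rightTree)
  obtain ⟨b, hb⟩ := QuotientGroup.mk_surjective ((CoherentData.ofHom hT).hom 2 (s 2 0))
  have hf' : rho 3 f = 1 := by rw [← rhoQ_mk N, hf, d.rho_f]
  -- The image of the braiding lies over the transposition, so any representative is an odd power of
  -- σ₁; this supplies the exponent `m`.
  obtain ⟨m, hm⟩ := exists_odd_zpow (g := b) (by rw [← rhoQ_mk N, hb, d.rho_a])
  have hb' : (CoherentData.ofHom hT).hom 2 (s 2 0) = oddBraid N m := by rw [← hb, hm]; rfl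
  refine ⟨pairMk N m ⟨f, mem_PB.2 hf'⟩, ⟨m, _, rfl, ?_⟩, (realizes_iff hT _ _).2 ⟨hf.symm, hb'⟩⟩
  rw [isGTPair_iff, ← hb']
  convert d

end

/-! ## Isomorphisms of truncated operads -/

namespace TruncatedOperad

/-- A morphism of truncated operads that is compatible with an equivalence relation factors through
the quotient. -/
def desc {O P : TruncatedOperad} (R : O.CompatibleEquiv) (T : O ⟶ P)
    (h : ∀ (n : Arity) (γ γ' : O.Mor n), (R.rel n).r γ γ' → T.mor γ = T.mor γ') :
    O.quotient R ⟶ P :=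
  Hom.mk (O := O.quotient R) (P := P)
    (ob := fun x => T.ob x)
    (mor := fun {n} => Quotient.lift (fun γ => T.mor γ) (h n))
    (map_src := by rintro n ⟨γ⟩; exact T.map_src γ)
    (map_tgt := by rintro n ⟨γ⟩; exact T.map_tgt γ)
    (map_ident := fun x => T.map_ident x)
    (map_comp := by rintro n ⟨γ⟩ ⟨η⟩ e e'; exact T.map_comp γ η e e')
    (map_act := by rintro n θ ⟨γ⟩; exact T.map_act θ γ)
    (map_ins := by rintro n m k h i ⟨γ⟩ ⟨γ'⟩; exact T.map_ins h i γ γ')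
    (map_unit := T.map_unit)

theorem proj_cancel {O P : TruncatedOperad} (R : O.CompatibleEquiv) {F G : O.quotient R ⟶ P}
    (h : O.proj R ≫ F = O.proj R ≫ G) : F = G := by
  refine Hom.ext ?_ ?_
  · exact congrArg (fun T : O ⟶ P => @Hom.ob _ _ T) h
  · funext n γ
    obtain ⟨γ⟩ := γ
    exact congrArg (fun T : O ⟶ P => T.mor γ) h

/-- The inverse of a morphism of truncated operads that is bijective on objects and morphisms. -/
noncomputable def inverse {O P : TruncatedOperad} (F : O ⟶ P)
    (ho : ∀ n : Arity, Function.Bijective fun x : O.Ob n => F.ob x)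
    (hm : ∀ n : Arity, Function.Bijective fun γ : O.Mor n => F.mor γ) : P ⟶ O :=
  have eo : ∀ {n : Arity} (x : P.Ob n), F.ob ((Equiv.ofBijective _ (ho n)).symm x) = x :=
    fun {n} x => (Equiv.ofBijective _ (ho n)).apply_symm_apply x
  have em : ∀ {n : Arity} (γ : P.Mor n), F.mor ((Equiv.ofBijective _ (hm n)).symm γ) = γ :=
    fun {n} γ => (Equiv.ofBijective _ (hm n)).apply_symm_apply γ
  Hom.mk (O := P) (P := O)
    (ob := fun {n} x => (Equiv.ofBijective _ (ho n)).symm x)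
    (mor := fun {n} γ => (Equiv.ofBijective _ (hm n)).symm γ)
    (map_src := fun {n} γ => (ho n).1 (by
      change F.ob _ = F.ob _
      rw [← F.map_src, em, eo]))
    (map_tgt := fun {n} γ => (ho n).1 (by
      change F.ob _ = F.ob _
      rw [← F.map_tgt, em, eo]))
    (map_ident := fun {n} x => (hm n).1 (by
      change F.mor _ = F.mor _
      rw [F.map_ident, em, eo]))
    (map_comp := fun {n} γ η e e' => (hm n).1 (by
      change F.mor _ = F.mor _
      rw [em, F.map_comp _ _ e' (by rw [em, em, e])]
      congr 1 <;> rw [em]))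
    (map_act := fun {n} θ γ => (hm n).1 (by
      change F.mor _ = F.mor _
      rw [F.map_act, em, em]))
    (map_ins := fun {n m k} h i γ γ' => (hm k).1 (by
      change F.mor _ = F.mor _
      rw [F.map_ins, em, em, em]))
    (map_unit := (ho ar1).1 (by
      change F.ob _ = F.ob _
      rw [eo, F.map_unit]))

/-- A morphism of truncated operads that is bijective on objects and morphisms is an
isomorphism. -/
noncomputable def isoOfBijective {O P : TruncatedOperad} (F : O ⟶ P)
    (ho : ∀ n : Arity, Function.Bijective fun x : O.Ob n => F.ob x)
    (hm : ∀ n : Arity, Function.Bijective fun γ : O.Mor n => F.mor γ) : O ≅ P where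
  hom := F
  inv := inverse F ho hm
  hom_inv_id := by
    refine Hom.ext ?_ ?_
    · funext n x; exact (Equiv.ofBijective _ (ho n)).symm_apply_apply x
    · funext n γ; exact (Equiv.ofBijective _ (hm n)).symm_apply_apply γ
  inv_hom_id := by
    refine Hom.ext ?_ ?_
    · funext n x; exact (Equiv.ofBijective _ (ho n)).apply_symm_apply x
    · funext n γ; exact (Equiv.ofBijective _ (hm n)).apply_symm_apply γ

theorem iso_mor_injective {O P : TruncatedOperad} (e : O ≅ P) (n : Arity) :
    Function.Injective fun γ : O.Mor n => e.hom.mor γ := fun a b h => by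
  have k : ∀ γ : O.Mor n, e.inv.mor (e.hom.mor γ) = γ := fun γ =>
    congrArg (fun T : O ⟶ O => T.mor γ) e.hom_inv_id
  rw [← k a, ← k b]
  exact congrArg _ h

theorem iso_mor_surjective {O P : TruncatedOperad} (e : O ≅ P) (n : Arity) :
    Function.Surjective fun γ : O.Mor n => e.hom.mor γ := fun b =>
  ⟨e.inv.mor b, congrArg (fun T : P ⟶ P => T.mor b) e.inv_hom_id⟩

end TruncatedOperad

/-! ## Kernels and surjectivity -/

section

variable {N : NFI} {T : PaB ⟶ Quo N}

/-- `T^{PBₙ}` is onto for `n = 2, 3, 4`. -/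
def IsOnto (T : PaB ⟶ Quo N) : Prop :=
  Function.Surjective (TPB T ar4) ∧ Function.Surjective (TPB T ar3) ∧
    Function.Surjective (TPB T ar2)

/-- The target is the finite group `B 4` modulo `N`, which gives finite index; purity holds because
the homomorphism covers `rho`. -/
theorem isNFI_ker (D : CoherentData N) : IsNFI (D.hom 4).ker := by
  have : N.1.FiniteIndex := N.2.2.1
  have : Finite (B 4 ⧸ NPB N.1 4) := Subgroup.finite_quotient_of_finiteIndex (H := N.1)
  exact ⟨inferInstance, inferInstance,
    fun g hg => D.mem_PB_of_hom_eq_one (by omega) le_rfl (MonoidHom.mem_ker.1 hg)⟩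

/-- The kernel on all of `B 4` consists of pure braids, so restricting to `PB 4` loses nothing. The
source of a shadow is thus normal in the full braid group. -/
theorem ker_TPB (hT : IdOnOb T) :
    (TPB T ar4).ker.map (PB 4).subtype = ((CoherentData.ofHom hT).hom 4).ker := by
  have e : (CoherentData.ofHom hT).hom 4 = TB T ar4 := homOf_eq T ar4
  ext g
  constructor
  · rintro ⟨x, hx, rfl⟩
    rw [MonoidHom.mem_ker, e]
    exact congrArg Subtype.val (MonoidHom.mem_ker.1 hx)
  · intro hg
    have hg' := (CoherentData.ofHom hT).mem_PB_of_hom_eq_one (by omega) le_rfl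
      (MonoidHom.mem_ker.1 hg)
    rw [MonoidHom.mem_ker, e] at hg
    exact ⟨⟨g, hg'⟩, MonoidHom.mem_ker.2 (Subtype.ext hg), rfl⟩

/-- With the same source and target the associators cancel, so equality of images is membership of
the quotient braid in a kernel; `CoherentData.mem_NPB_ker` describes that kernel in every arity
through the one in arity four. -/
theorem mor_eq_iff (hT : IdOnOb T) (K : NFI) (hK : K.1 = ((CoherentData.ofHom hT).hom 4).ker)
    (n : Arity) (γ γ' : PaB.Mor n) : T.mor γ = T.mor γ' ↔ ((simN K).rel n).r γ γ' := by
  change _ ↔ PaBMor.src γ = PaBMor.src γ' ∧ PaBMor.tgt γ = PaBMor.tgt γ' ∧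
    (PaBMor.braid γ)⁻¹ * PaBMor.braid γ' ∈ NPB K.1 n
  rw [hK]
  constructor
  · intro h
    have hs : PaBMor.src γ = PaBMor.src γ' :=
      (src_mor hT γ).symm.trans ((congrArg _ h).trans (src_mor hT γ'))
    have ht : PaBMor.tgt γ = PaBMor.tgt γ' :=
      (tgt_mor hT γ).symm.trans ((congrArg _ h).trans (tgt_mor hT γ'))
    refine ⟨hs, ht, ((CoherentData.ofHom hT).val_eq_iff n.2.1 n.2.2 hs ht).1 ?_⟩
    rw [← ouQ_mor_eq_val hT, ← ouQ_mor_eq_val hT, h]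
  · rintro ⟨hs, ht, h⟩
    refine quo_ext ((src_mor hT γ).trans (Eq.trans hs (src_mor hT γ').symm))
      ((tgt_mor hT γ).trans (Eq.trans ht (tgt_mor hT γ').symm)) ?_
    rw [ouQ_mor_eq_val hT, ouQ_mor_eq_val hT]
    exact ((CoherentData.ofHom hT).val_eq_iff n.2.1 n.2.2 hs ht).2 h

theorem hom_surjective (hT : IdOnOb T) (h : IsOnto T) (n : Arity) :
    Function.Surjective ((CoherentData.ofHom hT).hom n) := by
  have key : ∀ n : Arity, Function.Surjective (TPB T n) →
      Function.Surjective ((CoherentData.ofHom hT).hom n) := fun n hn c => by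
    have e : (CoherentData.ofHom hT).hom n = TB T n := homOf_eq T n
    obtain ⟨b, rfl⟩ := QuotientGroup.mk_surjective c
    obtain ⟨b', hb'⟩ := QuotientGroup.mk_surjective ((CoherentData.ofHom hT).hom n b)
    have hr : rho n b' = rho n b := by
      rw [← rhoQ_mk N b', hb', (CoherentData.ofHom hT).rho_hom n.2.1 n.2.2]
    -- The image of `b` has the permutation of `b`, so it misses the class of `b` only by a pure
    -- factor, which lies in the range by hypothesis.
    have hp : b * b'⁻¹ ∈ PB n := by rw [mem_PB, map_mul, map_inv, hr, mul_inv_cancel]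
    obtain ⟨x, hx⟩ := hn ⟨QuotientGroup.mk (b * b'⁻¹), ⟨b * b'⁻¹, hp, rfl⟩⟩
    have hx' : TB T n x = QuotientGroup.mk (b * b'⁻¹) := congrArg Subtype.val hx
    refine ⟨x * b, ?_⟩
    rw [map_mul, ← hb', e, hx', ← QuotientGroup.mk_mul, inv_mul_cancel_right]
  obtain ⟨n, hn, hn'⟩ := n
  rcases (show n = 1 ∨ n = 2 ∨ n = 3 ∨ n = 4 by omega) with rfl | rfl | rfl | rfl
  · exact fun c => ⟨1, (quo_one_eq _).trans (quo_one_eq c).symm⟩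
  · exact key ar2 h.2.2
  · exact key ar3 h.2.1
  · exact key ar4 h.1

theorem mor_surjective (hT : IdOnOb T) (h : IsOnto T) (n : Arity) :
    Function.Surjective fun γ : PaB.Mor n => T.mor γ := by
  rintro ⟨c⟩
  set D := CoherentData.ofHom hT
  -- The braid `g` solves asc · hom(g) · asc⁻¹ = class of `c` for the fixed source and target of
  -- `c`.
  obtain ⟨g, hg⟩ := hom_surjective hT h n ((D.asc n (PaBMor.tgt c).shape)⁻¹ *
    QuotientGroup.mk (PaBMor.braid c) * D.asc n (PaBMor.src c).shape)
  have hr : rho n g = (PaBMor.tgt c).perm⁻¹ * (PaBMor.src c).perm := by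
    rw [← D.rho_hom n.2.1 n.2.2, hg, map_mul, map_mul, map_inv,
      D.rho_asc n.2.1 n.2.2 _ (PaBMor.tgt c).len, D.rho_asc n.2.1 n.2.2 _ (PaBMor.src c).len,
      inv_one, one_mul, mul_one, rhoQ_mk]
    exact PaBMor.rho_braid c
  let γ : PaB.Mor n := (⟨PaBMor.src c, PaBMor.tgt c, g, hr⟩ : PaBMor n)
  refine ⟨γ, quo_ext (src_mor hT γ) (tgt_mor hT γ) ?_⟩
  rw [ouQ_mor_eq_val hT]
  change D.asc n (PaBMor.tgt c).shape * D.hom n g * (D.asc n (PaBMor.src c).shape)⁻¹ =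
    QuotientGroup.mk (PaBMor.braid c)
  rw [hg]
  group

theorem isOnto_of_mor_surjective (hT : IdOnOb T)
    (h : ∀ n : Arity, Function.Surjective fun γ : PaB.Mor n => T.mor γ) : IsOnto T := by
  have key : ∀ n : Arity, Function.Surjective (TPB T n) := by
    rintro n ⟨_, b, hb, rfl⟩
    obtain ⟨γ, hγ⟩ := h n ((projN N).mor (mm n b))
    change T.mor γ = _ at hγ
    have hs : PaBMor.src γ = stdOb n 1 :=
      (src_mor hT γ).symm.trans (congrArg (Quo N).src hγ)
    have ht : PaBMor.tgt γ = stdOb n (rho n b)⁻¹ :=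
      (tgt_mor hT γ).symm.trans (congrArg (Quo N).tgt hγ)
    have hr : rho n (PaBMor.braid γ) = 1 := by
      refine (PaBMor.rho_braid γ).trans ?_
      rw [hs, ht, mem_PB.1 hb, inv_one]
      exact inv_mul_cancel 1
    -- Since `T` fixes objects, a preimage of the morphism of a pure braid is an automorphism of the
    -- left-normed object, hence again given by a pure braid.
    have e : mm n (PaBMor.braid γ) = γ := PaBMor.ext hs.symm
      (Eq.trans (congrArg (fun π => stdOb n π⁻¹) (hr.trans (mem_PB.1 hb).symm)) ht.symm) rfl
    refine ⟨⟨PaBMor.braid γ, mem_PB.2 hr⟩, Subtype.ext ?_⟩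
    change ouQ N (T.mor (mm n (PaBMor.braid γ))) = _
    rw [e, hγ]
    rfl
  exact ⟨key ar4, key ar3, key ar2⟩

/-! ## The isomorphism defined by a GT-shadow -/

theorem projN_cancel {K : NFI} {F G : Quo K ⟶ Quo N} (h : projN K ≫ F = projN K ≫ G) : F = G :=
  TruncatedOperad.proj_cancel (simN K) h

theorem isom_unique {K : NFI} {e e' : Isom K N}
    (h : projN K ≫ e.1.hom = projN K ≫ e'.1.hom) : e = e' :=
  Subtype.ext (Iso.ext (projN_cancel h))

/-- The kernel condition makes `T` descend to an injective map on morphisms, and surjectivity on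
pure braids makes it onto; a bijective morphism of operads is invertible. -/
theorem exists_isom (hT : IdOnOb T) (h : IsOnto T) (K : NFI)
    (hK : K.1 = ((CoherentData.ofHom hT).hom 4).ker) :
    ∃ e : Isom K N, projN K ≫ e.1.hom = T := by
  have hr := mor_eq_iff hT K hK
  let F : Quo K ⟶ Quo N := TruncatedOperad.desc (simN K) T fun n γ γ' => (hr n γ γ').2
  refine ⟨⟨TruncatedOperad.isoOfBijective F (fun n => ⟨?_, ?_⟩) fun n => ⟨?_, ?_⟩, hT⟩, rfl⟩
  · intro x y hxy
    exact (hT n x).symm.trans (Eq.trans hxy (hT n y))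
  · exact fun x => ⟨x, hT n x⟩
  · rintro ⟨γ⟩ ⟨γ'⟩ hγ
    exact Quotient.sound ((hr n γ γ').1 hγ)
  · intro c
    obtain ⟨γ, hγ⟩ := mor_surjective hT h n c
    exact ⟨(projN K).mor γ, hγ⟩

theorem idOnOb_Tmf {p : Pair N} (hp : p ∈ GT N) : IdOnOb (Tmf N p) :=
  idOnOb_of_realizes (realizes_Tmf hp.1)

theorem sourceOf_eq {p : Pair N} (hp : p ∈ GT N) :
    sourceOf N p = ((CoherentData.ofHom (idOnOb_Tmf hp)).hom 4).ker := ker_TPB _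

theorem isNFI_sourceOf {p : Pair N} (hp : p ∈ GT N) : IsNFI (sourceOf N p) := by
  rw [sourceOf_eq hp]; exact isNFI_ker _

theorem exists_shadowIsom {N' : NFI} (p : ShadowHom N' N) :
    ∃ e : Isom N' N, projN N' ≫ e.1.hom = Tmf N p.1 :=
  exists_isom (idOnOb_Tmf p.2.1) p.2.1.2 N' (p.2.2.symm.trans (sourceOf_eq p.2.1))

/-- The isomorphism defined by a GT-shadow. -/
noncomputable def shadowIsom {N' : NFI} (p : ShadowHom N' N) : Isom N' N :=
  (exists_shadowIsom p).choose

theorem projN_shadowIsom {N' : NFI} (p : ShadowHom N' N) :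
    projN N' ≫ (shadowIsom p).1.hom = Tmf N p.1 := (exists_shadowIsom p).choose_spec

/-- Composing with the projection recovers the morphism realizing the pair, and that morphism
determines the pair. -/
theorem shadowIsom_injective (N' N : NFI) :
    Function.Injective (shadowIsom : ShadowHom N' N → Isom N' N) := fun p q h => by
  have e : Tmf N p.1 = Tmf N q.1 := by rw [← projN_shadowIsom, ← projN_shadowIsom, h]
  have hq := realizes_Tmf q.2.1.1
  rw [← e] at hq
  exact Subtype.ext (pair_unique (realizes_Tmf p.2.1.1) hq)

/-- The composite of the isomorphism with the projection fixes objects and is onto, so it is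
realized by a GT-shadow. The isomorphism identifies nothing further, so this composite identifies
exactly the pairs related by `simN N'`, and the source is `N'`. -/
theorem shadowIsom_surjective (N' N : NFI) :
    Function.Surjective (shadowIsom : ShadowHom N' N → Isom N' N) := fun e => by
  let T : PaB ⟶ Quo N := projN N' ≫ e.1.hom
  have hT : IdOnOb T := e.2
  obtain ⟨p, hp, hr⟩ := exists_pair hT
  have eT : Tmf N p = T := realizes_unique (realizes_Tmf hp) hr
  have hS : ∀ n : Arity, Function.Surjective fun γ : PaB.Mor n => T.mor γ := fun n c => by
    obtain ⟨⟨γ⟩, hγ⟩ := TruncatedOperad.iso_mor_surjective e.1 n c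
    exact ⟨γ, hγ⟩
  have hG : p ∈ GT N := ⟨hp, by
    have := isOnto_of_mor_surjective hT hS
    rwa [← eT] at this⟩
  have hK : sourceOf N p = N'.1 := by
    rw [sourceOf, eT, ker_TPB hT]
    ext g
    have hk := mor_eq_iff hT ⟨_, isNFI_ker (CoherentData.ofHom hT)⟩ rfl
    have hi : ∀ γ γ' : PaB.Mor ar4, T.mor γ = T.mor γ' ↔ ((simN N').rel ar4).r γ γ' :=
      fun γ γ' => ⟨fun h => Quotient.exact (TruncatedOperad.iso_mor_injective e.1 ar4 h),
        fun h => congrArg (fun x => e.1.hom.mor x) (Quotient.sound h :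
          (projN N').mor γ = (projN N').mor γ')⟩
    -- A subgroup is recovered from its equivalence relation: it consists of the pure braids that,
    -- as automorphisms of the left-normed object, are equivalent to the identity.
    have key : ∀ (K : NFI), g ∈ K.1 ↔ ∃ hg : rho 4 g = 1,
        ((simN K).rel ar4).r (PaB.ident (stdOb ar4 1))
          (⟨stdOb ar4 1, stdOb ar4 1, g, hg.trans (inv_mul_cancel _).symm⟩ : PaBMor 4) := fun K => by
      constructor
      · intro hg
        refine ⟨mem_PB.1 (K.2.2.2 hg), rfl, rfl, ?_⟩
        change (1 : B 4)⁻¹ * g ∈ K.1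
        rwa [inv_one, one_mul]
      · rintro ⟨_, _, _, hg⟩
        change (1 : B 4)⁻¹ * g ∈ K.1 at hg
        rwa [inv_one, one_mul] at hg
    exact (key ⟨_, isNFI_ker (CoherentData.ofHom hT)⟩).trans
      ((exists_congr fun hg => (hk _ _ _).symm.trans (hi _ _)).trans (key N').symm)
  refine ⟨⟨p, hG, hK⟩, isom_unique ?_⟩
  rw [projN_shadowIsom]
  exact eT

/-- The bijection between GT-shadows with source `N'` and target `N` and isomorphisms. -/
noncomputable def shadowEquiv (N' N : NFI) : ShadowHom N' N ≃ Isom N' N :=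
  Equiv.ofBijective shadowIsom ⟨shadowIsom_injective N' N, shadowIsom_surjective N' N⟩

end

/-- The groupoid of GT-shadows. -/
noncomputable abbrev shadowGroupoid : Groupoid.{0} NFI where
  Hom N' N := ShadowHom N' N
  id N := (shadowEquiv N N).symm ⟨Iso.refl _, fun _ _ => rfl⟩
  comp {N₁ N₂ N₃} f g := (shadowEquiv N₁ N₃).symm
    ⟨(shadowEquiv N₁ N₂ f).1 ≪≫ (shadowEquiv N₂ N₃ g).1, fun n x =>
      (congrArg (fun y => (shadowEquiv N₂ N₃ g).1.hom.ob y) ((shadowEquiv N₁ N₂ f).2 n x)).trans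
        ((shadowEquiv N₂ N₃ g).2 n x)⟩
  inv {N₁ N₂} f := (shadowEquiv N₂ N₁).symm ⟨(shadowEquiv N₁ N₂ f).1.symm, fun n x => by
    have h₁ : (shadowEquiv N₁ N₂ f).1.hom.ob x = x := (shadowEquiv N₁ N₂ f).2 n x
    have h₂ := congrArg (fun T : Quo N₁ ⟶ Quo N₁ => T.ob (n := n) x)
      (shadowEquiv N₁ N₂ f).1.hom_inv_id
    exact (congrArg (fun y => (shadowEquiv N₁ N₂ f).1.inv.ob y) h₁.symm).trans h₂⟩
  -- Every groupoid axiom becomes the corresponding identity for isomorphisms after applying the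
  -- injective map `shadowEquiv`.
  id_comp {N₁ N₂} f := (shadowEquiv N₁ N₂).injective <| Subtype.ext <| by
    simp only [Equiv.apply_symm_apply]; exact Iso.refl_trans _
  comp_id {N₁ N₂} f := (shadowEquiv N₁ N₂).injective <| Subtype.ext <| by
    simp only [Equiv.apply_symm_apply]; exact Iso.trans_refl _
  assoc {N₁ N₂ N₃ N₄} f g h := (shadowEquiv N₁ N₄).injective <| Subtype.ext <| by
    simp only [Equiv.apply_symm_apply]; exact Iso.trans_assoc _ _ _
  inv_comp {N₁ N₂} f := (shadowEquiv N₂ N₂).injective <| Subtype.ext <| by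
    simp only [Equiv.apply_symm_apply]; exact Iso.symm_self_id _
  comp_inv {N₁ N₂} f := (shadowEquiv N₁ N₁).injective <| Subtype.ext <| by
    simp only [Equiv.apply_symm_apply]; exact Iso.self_symm_id _

end GTShadows

theorem corollary2p11 :
    (∀ (N : NFI) (p : Pair N), p ∈ GTpr N →
      Realizes N p (Tmf N p) ∧
      (∀ (n : Arity) (x : PaB.Ob n), (Tmf N p).ob x = x) ∧
      ∀ T : PaB ⟶ Quo N, Realizes N p T → T = Tmf N p) ∧
    (∀ (N : NFI) (p : Pair N), p ∈ GT N → ∃ h : IsNFI (sourceOf N p),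
      (∀ (n : Arity) (γ γ' : PaB.Mor n),
        (Tmf N p).mor γ = (Tmf N p).mor γ' ↔ ((simN ⟨sourceOf N p, h⟩).rel n).r γ γ') ∧
      ∃! e : Isom ⟨sourceOf N p, h⟩ N, projN ⟨sourceOf N p, h⟩ ≫ e.1.hom = Tmf N p) ∧
    ∃ Φ : ∀ N' N : NFI, ShadowHom N' N ≃ Isom N' N,
      (∀ (N' N : NFI) (p : ShadowHom N' N), projN N' ≫ (Φ N' N p).1.hom = Tmf N p.1) ∧
      ∃ (G : Groupoid.{0} NFI) (e : ∀ N' N : NFI, (N' ⟶ N) ≃ ShadowHom N' N),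
        (∀ N : NFI, (Φ N N (e N N (𝟙 N))).1 = Iso.refl (Quo N)) ∧
        (∀ (N₁ N₂ N₃ : NFI) (f : N₁ ⟶ N₂) (g : N₂ ⟶ N₃),
          (Φ N₁ N₃ (e N₁ N₃ (f ≫ g))).1 =
            (Φ N₁ N₂ (e N₁ N₂ f)).1 ≪≫ (Φ N₂ N₃ (e N₂ N₃ g)).1) ∧
        ∀ (N₁ N₂ : NFI) (f : N₁ ⟶ N₂),
          (Φ N₂ N₁ (e N₂ N₁ (Groupoid.inv f))).1 = (Φ N₁ N₂ (e N₁ N₂ f)).1.symm := by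
  refine ⟨fun N p hp => ⟨realizes_Tmf hp, idOnOb_of_realizes (realizes_Tmf hp),
    fun T hT => realizes_unique hT (realizes_Tmf hp)⟩, fun N p hp => ⟨isNFI_sourceOf hp,
    mor_eq_iff (idOnOb_Tmf hp) _ (sourceOf_eq hp), ?_⟩, shadowEquiv,
    fun N' N p => projN_shadowIsom p, shadowGroupoid, fun N' N => Equiv.refl _, fun N => ?_,
    fun N₁ N₂ N₃ f g => ?_, fun N₁ N₂ f => ?_⟩
  · obtain ⟨e, he⟩ := exists_isom (idOnOb_Tmf hp) hp.2 ⟨sourceOf N p, isNFI_sourceOf hp⟩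
      (sourceOf_eq hp)
    exact ⟨e, he, fun e' he' => isom_unique (he'.trans he.symm)⟩
  · exact congrArg Subtype.val ((shadowEquiv N N).apply_symm_apply _)
  · exact congrArg Subtype.val ((shadowEquiv N₁ N₃).apply_symm_apply _)
  · exact congrArg Subtype.val ((shadowEquiv N₂ N₁).apply_symm_apply _)
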